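/- **Props.** A *prop* $A$ is a strict symmetric monoidal category with objects the natural numbers, with $n\oplus m=n+m$ and with $0$ a zero object; $A_{n,m}$ denotes the set of maps $m\to n$. It is *commutative* if $A_{1,1}$ is central and $q\circ p=(p\oplus\dots\oplus p)\circ\sigma_{m,n}\circ(q\oplus\dots\oplus q)$ for all rows $p\in A_{1,n}$ and columns $q\in A_{m,1}$ ($m$ copies of $p$, $n$ copies of $q$, and $\sigma_{m,n}$ the permutation taking position $(j-1)m+i$ to $(i-1)n+j$ for $1\le i\le m$, $1\le j\le n$). A commutative ring gives the commutative prop of its matrices, with matrix multiplication and block direct sum. An *ideal* of $A$ is a set $I\subseteq A_{1,1}$ with $p\circ(a_1\oplus\dots\oplus a_k)\circ q\in I$ for all $k\ge 0$, $a_i\in I$, $p\in A_{1,k}$, $q\in A_{k,1}$; it is *prime* if its complement is a submonoid of $A_{1,1}$. The space $\mathrm{spec}(A)$ is the set of primes with the Zariski topology and the sheaf of props of functions into the localizations $A_{\mathfrak p}$ that are locally fractions. A *prop scheme* is a topological space with a sheaf of commutative props, with local stalks, that is locally isomorphic to such spectra; maps of spaces with sheaves of commutative props with local stalks are required to be local on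 stalks. Objects of the pro-category of prop schemes are inverse systems indexed by directed, co-finite partially ordered sets, with $\mathrm{Hom}(\{X_j\},\{Y_i\})=\varprojlim_i\varinjlim_j\mathrm{Hom}(X_j,Y_i)$. Let $(\mathbb Z_{\mathbb R})_{n,m}$ be the set of real $n\times m$ matrices that map the Euclidean unit ball of $\mathbb R^m$ into that of $\mathbb R^n$. For $N\ge 2$ let $\mathbb Z[\frac1N]\cap\mathbb Z_{\mathbb R}$ be the prop of matrices over $\mathbb Z[\frac1N]$ that lie in $\mathbb Z_{\mathbb R}$. **Theorem.** There is an inverse system of prop schemes, indexed by the nonempty finite sets of primes $\{p_1,\dots,p_\ell\}$ ordered by inclusion, with $$X_{\{p_1,\dots,p_\ell\}}=\mathrm{spec}(\mathbb Z)\coprod_{\mathrm{spec}(\mathbb Z[\frac1N])}\mathrm{spec}\bigl(\mathbb Z[\tfrac1N]\cap\mathbb Z_{\mathbb R}\bigr),\qquad N=p_1\cdots p_\ell ,$$ (a pushout of spaces with sheaves of commutative props with local stalks), whose transition maps are induced by the identity of $\mathrm{spec}(\mathbb Z)$ and by the inclusions $\mathbb Z[\frac1N]\cap\mathbb Z_{\mathbb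 R}\subseteq\mathbb Z[\frac1{N'}]\cap\mathbb Z_{\mathbb R}$ for $N\mid N'$. As an object $\overline{\mathrm{spec}(\mathbb Z)}$ of the pro-category of prop schemes it is unique up to isomorphism. It has a limit $\varprojlim\overline{\mathrm{spec}(\mathbb Z)}$ in the category of spaces with sheaves of commutative props with local stalks, such that: 1. The points of the limit are $(0)$, the points $(p)$ for all primes $p$, and the real prime $\eta_{\mathbb R}$. The projections to the $X_{\{p_1,\dots,p_\ell\}}$ are bijective on points; they take $(0)$ and $(p)$ to the images of the primes $(0)$ and $(p)$ of $\mathrm{spec}(\mathbb Z)$, and $\eta_{\mathbb R}$ to the image of the prime $\mathbb Z[\frac1N]\cap(-1,1)$ of $\mathrm{spec}(\mathbb Z[\frac1N]\cap\mathbb Z_{\mathbb R})$. The closed points of $X_{\{p_1,\dots,p_\ell\}}$ are $(p_1),\dots,(p_\ell)$ and $\eta_{\mathbb R}$. 2. The limit has Krull dimension one; its only generic point is $(0)$, and its closed points are all the $(p)$ and $\eta_{\mathbb R}$. 3. For every nonempty open set $\mathcal U$ the prop of sections of the structure sheaf over $\mathcal U$ is isomorphic, compatibly with restrictions, to the sub-prop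 of the prop of rational matrices given by $$\mathcal O(\mathcal U)_{n,m}=\{a\in\mathbb Q_{n,m}: a\circ\mathbb Z_p^m\subseteq\mathbb Z_p^n\ \text{for all primes } p \text{ with } (p)\in\mathcal U,\ \text{and } a\in(\mathbb Z_{\mathbb R})_{n,m}\text{ if }\eta_{\mathbb R}\in\mathcal U\}.$$ 4. The global sections are $$\mathcal O\bigl(\varprojlim\overline{\mathrm{spec}(\mathbb Z)}\bigr)_{n,m}=\mathbb Z_{n,m}\cap(\mathbb Z_{\mathbb R})_{n,m}=\mathbb F[\pm1]_{n,m},$$ the $n\times m$ matrices with entries in $\{0,1,-1\}$ and at most one nonzero entry in each row and in each column. -/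

import Mathlib

open TopologicalSpace CategoryTheory

noncomputable section

namespace PropGeom

/-! ### Props -/

/-- A prop: a strict symmetric monoidal category whose objects are the natural numbers, with
`n ⊕ m = n + m`, and whose unit object `0` is a zero object.

`Hom n m` is the set `A_{n,m}` of maps from `m` to `n` (the `n` by `m` matrices, for a ring).
The symmetry is encoded as the action of the permutations. For convenience `perm` takes a bijection
`Fin m ≃ Fin n`; as then `m = n`, this is the same as an action of the symmetric groups. Strictness
of associativity and of the unit is expressed by the maps `perm (finCongr h)`, `h : m = n`, which
are identity maps. -/
structure Prp where
  Hom : ℕ → ℕ → Type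
  comp : ∀ {n m k : ℕ}, Hom n m → Hom m k → Hom n k
  sum : ∀ {n m n' m' : ℕ}, Hom n m → Hom n' m' → Hom (n + n') (m + m')
  perm : ∀ {n m : ℕ}, (Fin m ≃ Fin n) → Hom n m
  toZero : ∀ m : ℕ, Hom 0 m
  ofZero : ∀ n : ℕ, Hom n 0
  comp_assoc : ∀ {n m k l : ℕ} (a : Hom n m) (b : Hom m k) (c : Hom k l),
    comp (comp a b) c = comp a (comp b c)
  id_comp : ∀ {n m : ℕ} (a : Hom n m), comp (perm (Equiv.refl (Fin n))) a = a
  comp_id : ∀ {n m : ℕ} (a : Hom n m), comp a (perm (Equiv.refl (Fin m))) = a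
  perm_comp : ∀ {n m k : ℕ} (f : Fin m ≃ Fin n) (e : Fin k ≃ Fin m),
    comp (perm f) (perm e) = perm (e.trans f)
  sum_comp : ∀ {n m k n' m' k' : ℕ} (a : Hom n m) (b : Hom m k) (a' : Hom n' m') (b' : Hom m' k'),
    sum (comp a b) (comp a' b') = comp (sum a a') (sum b b')
  sum_perm : ∀ {n m n' m' : ℕ} (e : Fin m ≃ Fin n) (e' : Fin m' ≃ Fin n'),
    sum (perm e) (perm e') =
      perm ((finSumFinEquiv.symm.trans (Equiv.sumCongr e e')).trans finSumFinEquiv)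
  sum_assoc : ∀ {n m n' m' n'' m'' : ℕ} (a : Hom n m) (b : Hom n' m') (c : Hom n'' m''),
    comp (perm (finCongr (add_assoc n n' n''))) (sum (sum a b) c) =
      comp (sum a (sum b c)) (perm (finCongr (add_assoc m m' m'')))
  sum_zero : ∀ {n m : ℕ} (a : Hom n m), sum a (perm (Equiv.refl (Fin 0))) = a
  zero_sum : ∀ {n m : ℕ} (a : Hom n m),
    comp (perm (finCongr (zero_add n))) (sum (perm (Equiv.refl (Fin 0))) a) =
      comp a (perm (finCongr (zero_add m)))
  swap : ∀ {n m n' m' : ℕ} (a : Hom n m) (b : Hom n' m'),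
    comp (perm finAddFlip) (sum a b) = comp (sum b a) (perm finAddFlip)
  eq_toZero : ∀ {m : ℕ} (a : Hom 0 m), a = toZero m
  eq_ofZero : ∀ {n : ℕ} (a : Hom n 0), a = ofZero n

namespace Prp

variable (A : Prp)

/-- The identity of `n`. -/
def one (n : ℕ) : A.Hom n n := A.perm (Equiv.refl (Fin n))

variable {A}

/-- The block diagonal sum `a_1 ⊕ ⋯ ⊕ a_n` of elements of `A_{1,1}`. -/
def diag : ∀ {n : ℕ}, (Fin n → A.Hom 1 1) → A.Hom n n
  | 0, _ => A.one 0
  | _ + 1, a => A.sum (diag fun i => a i.castSucc) (a (Fin.last _))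

/-- The `m`-fold sum `p ⊕ ⋯ ⊕ p` of a row `p ∈ A_{1,n}`. -/
def rowSum {n : ℕ} (p : A.Hom 1 n) : ∀ m : ℕ, A.Hom m (n * m)
  | 0 => A.one 0
  | m + 1 => A.sum (rowSum p m) p

/-- The `n`-fold sum `q ⊕ ⋯ ⊕ q` of a column `q ∈ A_{m,1}`. -/
def colSum {m : ℕ} (q : A.Hom m 1) : ∀ n : ℕ, A.Hom (m * n) n
  | 0 => A.one 0
  | n + 1 => A.sum (colSum q n) q

/-- Multiplication of `a ∈ A_{n,m}` by the scalar `s ∈ A_{1,1}`: `(s ⊕ ⋯ ⊕ s) ∘ a`. -/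
def smul (s : A.Hom 1 1) {n m : ℕ} (a : A.Hom n m) : A.Hom n m :=
  A.comp (diag fun _ : Fin n => s) a

end Prp

/-- The permutation `σ_{m,n}`, sending `j m + i` to `i n + j` for `i < m`, `j < n`. -/
def sigma (m n : ℕ) : Fin (m * n) ≃ Fin (n * m) :=
  (finCongr (mul_comm m n)).trans <| finProdFinEquiv.symm.trans <|
    (Equiv.prodComm (Fin n) (Fin m)).trans <| finProdFinEquiv.trans (finCongr (mul_comm m n))

/-- Commutativity of a prop: every row `p ∈ A_{1,n}` commutes with every column `q ∈ A_{m,1}`, that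
is `q ∘ p = (p ⊕ ⋯ ⊕ p) ∘ σ_{m,n} ∘ (q ⊕ ⋯ ⊕ q)`, and the monoid `A_{1,1}` is central. -/
structure Prp.IsComm (A : Prp) : Prop where
  row_col : ∀ {n m : ℕ} (q : A.Hom m 1) (p : A.Hom 1 n), A.comp q p =
    A.comp (Prp.rowSum p m) (A.comp (A.perm (sigma m n)) (Prp.colSum q n))
  central : ∀ {n m : ℕ} (s : A.Hom 1 1) (a : A.Hom n m),
    A.comp (Prp.diag fun _ => s) a = A.comp a (Prp.diag fun _ => s)

/-- A commutative prop. -/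
structure CPrp extends Prp where
  comm : toPrp.IsComm

/-- Maps of props. -/
@[ext]
structure PrpHom (A B : Prp) where
  map : ∀ {n m : ℕ}, A.Hom n m → B.Hom n m
  map_comp : ∀ {n m k : ℕ} (a : A.Hom n m) (b : A.Hom m k),
    map (A.comp a b) = B.comp (map a) (map b)
  map_sum : ∀ {n m n' m' : ℕ} (a : A.Hom n m) (b : A.Hom n' m'),
    map (A.sum a b) = B.sum (map a) (map b)
  map_perm : ∀ {n m : ℕ} (e : Fin m ≃ Fin n), map (A.perm e) = B.perm e

namespace PrpHom

variable {A B C : Prp}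

/-- The identity map. -/
def id (A : Prp) : PrpHom A A := ⟨fun a => a, fun _ _ => rfl, fun _ _ => rfl, fun _ => rfl⟩

/-- `f` followed by `g`. -/
def trans (f : PrpHom A B) (g : PrpHom B C) : PrpHom A C where
  map a := g.map (f.map a)
  map_comp a b := by rw [f.map_comp, g.map_comp]
  map_sum a b := by rw [f.map_sum, g.map_sum]
  map_perm e := by rw [f.map_perm, g.map_perm]

theorem trans_map (f : PrpHom A B) (g : PrpHom B C) {n m : ℕ} (a : A.Hom n m) :
    (f.trans g).map a = g.map (f.map a) := rfl

theorem map_diag (f : PrpHom A B) : ∀ {n : ℕ} (a : Fin n → A.Hom 1 1),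
    f.map (Prp.diag a) = Prp.diag fun i => f.map (a i)
  | 0, _ => f.map_perm _
  | _ + 1, a => by simp only [Prp.diag]; rw [f.map_sum, map_diag f]

theorem map_rowSum (f : PrpHom A B) {n : ℕ} (p : A.Hom 1 n) : ∀ m : ℕ,
    f.map (Prp.rowSum p m) = Prp.rowSum (f.map p) m
  | 0 => f.map_perm _
  | m + 1 => by
    have h := f.map_sum (Prp.rowSum p m) p
    rw [map_rowSum f p m] at h
    exact h

theorem map_colSum (f : PrpHom A B) {m : ℕ} (q : A.Hom m 1) : ∀ n : ℕ,
    f.map (Prp.colSum q n) = Prp.colSum (f.map q) n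
  | 0 => f.map_perm _
  | n + 1 => by
    have h := f.map_sum (Prp.colSum q n) q
    rw [map_colSum f q n] at h
    exact h

theorem map_smul (f : PrpHom A B) (s : A.Hom 1 1) {n m : ℕ} (a : A.Hom n m) :
    f.map (Prp.smul s a) = Prp.smul (f.map s) (f.map a) := by
  simp only [Prp.smul]; rw [f.map_comp, map_diag]

end PrpHom

/-- A prop with a jointly injective family of maps to commutative props is commutative. -/
theorem Prp.IsComm.ofInjective (A : Prp) {ι : Type} (B : ι → CPrp)
    (f : ∀ i, PrpHom A (B i).toPrp)
    (hf : ∀ {n m : ℕ} (a b : A.Hom n m), (∀ i, (f i).map a = (f i).map b) → a = b) :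
    A.IsComm where
  row_col q p := hf _ _ fun i => by
    rw [(f i).map_comp, (f i).map_comp, (f i).map_comp, (f i).map_perm, (f i).map_rowSum,
      (f i).map_colSum, (B i).comm.row_col]
  central s a := hf _ _ fun i => by
    rw [(f i).map_comp, (f i).map_comp, (f i).map_diag, (f i).map_diag, (B i).comm.central]

/-- A sub-prop. -/
structure SubPrp (A : CPrp) where
  carrier : ∀ n m : ℕ, Set (A.Hom n m)
  comp_mem : ∀ {n m k : ℕ} {a : A.Hom n m} {b : A.Hom m k},
    a ∈ carrier n m → b ∈ carrier m k → A.comp a b ∈ carrier n k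
  sum_mem : ∀ {n m n' m' : ℕ} {a : A.Hom n m} {b : A.Hom n' m'},
    a ∈ carrier n m → b ∈ carrier n' m' → A.sum a b ∈ carrier (n + n') (m + m')
  perm_mem : ∀ {n m : ℕ} (e : Fin m ≃ Fin n), A.perm e ∈ carrier n m
  toZero_mem : ∀ m : ℕ, A.toZero m ∈ carrier 0 m
  ofZero_mem : ∀ n : ℕ, A.ofZero n ∈ carrier n 0

namespace SubPrp

variable {A B : CPrp}

/-- The underlying prop of a sub-prop, before recording its commutativity. -/
def toPrp (S : SubPrp A) : Prp where
  Hom n m := S.carrier n m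
  comp a b := ⟨A.comp a.1 b.1, S.comp_mem a.2 b.2⟩
  sum a b := ⟨A.sum a.1 b.1, S.sum_mem a.2 b.2⟩
  perm e := ⟨A.perm e, S.perm_mem e⟩
  toZero m := ⟨A.toZero m, S.toZero_mem m⟩
  ofZero n := ⟨A.ofZero n, S.ofZero_mem n⟩
  comp_assoc a b c := Subtype.ext (A.comp_assoc a.1 b.1 c.1)
  id_comp a := Subtype.ext (A.id_comp a.1)
  comp_id a := Subtype.ext (A.comp_id a.1)
  perm_comp f e := Subtype.ext (A.perm_comp f e)
  sum_comp a b a' b' := Subtype.ext (A.sum_comp a.1 b.1 a'.1 b'.1)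
  sum_perm e e' := Subtype.ext (A.sum_perm e e')
  sum_assoc a b c := Subtype.ext (A.sum_assoc a.1 b.1 c.1)
  sum_zero a := Subtype.ext (A.sum_zero a.1)
  zero_sum a := Subtype.ext (A.zero_sum a.1)
  swap a b := Subtype.ext (A.swap a.1 b.1)
  eq_toZero a := Subtype.ext (A.eq_toZero a.1)
  eq_ofZero a := Subtype.ext (A.eq_ofZero a.1)

/-- A sub-prop as a commutative prop. -/
def toCPrp (S : SubPrp A) : CPrp where
  toPrp := S.toPrp
  comm := Prp.IsComm.ofInjective S.toPrp (fun _ : Unit => A)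
    (fun _ => ⟨fun a => a.1, fun _ _ => rfl, fun _ _ => rfl, fun _ => rfl⟩)
    (fun _ _ h => Subtype.ext (h ()))

/-- The inclusion of a sub-prop. -/
def incl (S : SubPrp A) : PrpHom S.toCPrp.toPrp A.toPrp :=
  ⟨fun a => a.1, fun _ _ => rfl, fun _ _ => rfl, fun _ => rfl⟩

/-- A map of props with values in a sub-prop. -/
def lift {C : Prp} (S : SubPrp A) (f : PrpHom C A.toPrp)
    (h : ∀ {n m : ℕ} (c : C.Hom n m), f.map c ∈ S.carrier n m) : PrpHom C S.toCPrp.toPrp where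
  map c := ⟨f.map c, h c⟩
  map_comp a b := Subtype.ext (f.map_comp a b)
  map_sum a b := Subtype.ext (f.map_sum a b)
  map_perm e := Subtype.ext (f.map_perm e)

/-- The inverse image of a sub-prop. -/
def comap (f : PrpHom A.toPrp B.toPrp) (S : SubPrp B) : SubPrp A where
  carrier n m := {a | f.map a ∈ S.carrier n m}
  comp_mem {_ _ _ a b} h h' := by
    change f.map (A.comp a b) ∈ S.carrier _ _
    rw [f.map_comp]; exact S.comp_mem h h'
  sum_mem {_ _ _ _ a b} h h' := by
    change f.map (A.sum a b) ∈ S.carrier _ _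
    rw [f.map_sum]; exact S.sum_mem h h'
  perm_mem e := by
    change f.map (A.perm e) ∈ S.carrier _ _
    rw [f.map_perm]; exact S.perm_mem e
  toZero_mem m := by
    change f.map (A.toZero m) ∈ S.carrier _ _
    rw [B.eq_toZero (f.map (A.toZero m))]; exact S.toZero_mem m
  ofZero_mem n := by
    change f.map (A.ofZero n) ∈ S.carrier _ _
    rw [B.eq_ofZero (f.map (A.ofZero n))]; exact S.ofZero_mem n

theorem mem_comap (f : PrpHom A.toPrp B.toPrp) (S : SubPrp B) {n m : ℕ} (a : A.Hom n m) :
    a ∈ (S.comap f).carrier n m ↔ f.map a ∈ S.carrier n m := Iff.rfl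

theorem incl_mem (S : SubPrp A) {n m : ℕ} (c : S.toCPrp.Hom n m) :
    S.incl.map c ∈ S.carrier n m := c.2

end SubPrp

/-! ### Matrices over a commutative ring -/

section Matrices

variable (R : Type) [CommRing R]

/-- The block direct sum of matrices. -/
def blockSum {R : Type} [CommRing R] {n m n' m' : ℕ} (a : Matrix (Fin n) (Fin m) R)
    (b : Matrix (Fin n') (Fin m') R) : Matrix (Fin (n + n')) (Fin (m + m')) R :=
  Matrix.reindex finSumFinEquiv finSumFinEquiv (Matrix.fromBlocks a 0 0 b)

/-- The permutation matrix of `e`, with a `1` at the places `(e j, j)`. -/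
def permMat {n m : ℕ} (e : Fin m ≃ Fin n) : Matrix (Fin n) (Fin m) R :=
  (1 : Matrix (Fin n) (Fin n) R).submatrix id e

variable {R}

theorem permMat_mul {n m k : ℕ} (e : Fin m ≃ Fin n) (a : Matrix (Fin m) (Fin k) R) :
    permMat R e * a = a.submatrix e.symm id := by
  ext i j
  simp only [permMat, Matrix.mul_apply, Matrix.submatrix_apply, id, Matrix.one_apply]
  rw [Finset.sum_eq_single (e.symm i)]
  · simp
  · intro b _ hb
    rw [if_neg, zero_mul]
    rintro rfl; simp at hb
  · simp

theorem mul_permMat {n m k : ℕ} (e : Fin m ≃ Fin n) (a : Matrix (Fin k) (Fin n) R) :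
    a * permMat R e = a.submatrix id e := by
  ext i j
  simp [permMat, Matrix.mul_apply, Matrix.one_apply]

theorem permMat_refl (n : ℕ) : permMat R (Equiv.refl (Fin n)) = 1 := by
  simp [permMat]

@[simp] theorem blockSum_castAdd_castAdd {n m n' m' : ℕ} (a : Matrix (Fin n) (Fin m) R)
    (b : Matrix (Fin n') (Fin m') R) (i j) :
    blockSum a b (Fin.castAdd n' i) (Fin.castAdd m' j) = a i j := by
  simp [blockSum]

@[simp] theorem blockSum_castAdd_natAdd {n m n' m' : ℕ} (a : Matrix (Fin n) (Fin m) R)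
    (b : Matrix (Fin n') (Fin m') R) (i j) :
    blockSum a b (Fin.castAdd n' i) (Fin.natAdd m j) = 0 := by
  simp [blockSum]

@[simp] theorem blockSum_natAdd_castAdd {n m n' m' : ℕ} (a : Matrix (Fin n) (Fin m) R)
    (b : Matrix (Fin n') (Fin m') R) (i j) :
    blockSum a b (Fin.natAdd n i) (Fin.castAdd m' j) = 0 := by
  simp [blockSum]

@[simp] theorem blockSum_natAdd_natAdd {n m n' m' : ℕ} (a : Matrix (Fin n) (Fin m) R)
    (b : Matrix (Fin n') (Fin m') R) (i j) :
    blockSum a b (Fin.natAdd n i) (Fin.natAdd m j) = b i j := by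
  simp [blockSum]

theorem blockSum_mul {n m k n' m' k' : ℕ} (a : Matrix (Fin n) (Fin m) R)
    (b : Matrix (Fin m) (Fin k) R) (a' : Matrix (Fin n') (Fin m') R)
    (b' : Matrix (Fin m') (Fin k') R) :
    blockSum (a * b) (a' * b') = blockSum a a' * blockSum b b' := by
  simp only [blockSum, Matrix.reindex_apply, Matrix.submatrix_mul_equiv,
    Matrix.fromBlocks_multiply]
  simp

theorem blockSum_assoc {n m n' m' n'' m'' : ℕ} (a : Matrix (Fin n) (Fin m) R)
    (b : Matrix (Fin n') (Fin m') R) (c : Matrix (Fin n'') (Fin m'') R)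
    (i : Fin (n + n' + n'')) (j : Fin (m + m' + m'')) :
    blockSum (blockSum a b) c i j =
      blockSum a (blockSum b c) (Fin.cast (add_assoc n n' n'') i)
        (Fin.cast (add_assoc m m' m'') j) := by
  have h1 : ∀ {n n' n'' : ℕ} (i : Fin n), Fin.cast (add_assoc n n' n'')
      (Fin.castAdd n'' (Fin.castAdd n' i)) = Fin.castAdd (n' + n'') i := fun i => rfl
  have h2 : ∀ {n n' n'' : ℕ} (i : Fin n'), Fin.cast (add_assoc n n' n'')
      (Fin.castAdd n'' (Fin.natAdd n i)) = Fin.natAdd n (Fin.castAdd n'' i) := fun i => rfl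
  have h3 : ∀ {n n' n'' : ℕ} (i : Fin n''), Fin.cast (add_assoc n n' n'')
      (Fin.natAdd (n + n') i) = Fin.natAdd n (Fin.natAdd n' i) := fun i => by
    ext; simp [add_assoc]
  induction i using Fin.addCases with
  | left i =>
    induction i using Fin.addCases with
    | left i =>
      induction j using Fin.addCases with
      | left j => induction j using Fin.addCases <;> simp [h1, h2]
      | right j => simp only [h1, h3]; simp
    | right i =>
      induction j using Fin.addCases with
      | left j => induction j using Fin.addCases <;> simp [h1, h2]
      | right j => simp only [h2, h3]; simp
  | right i =>
    induction j using Fin.addCases with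
    | left j => induction j using Fin.addCases <;> simp only [h1, h2, h3] <;> simp
    | right j => simp only [h3]; simp

variable (R) in
/-- The prop of matrices over a commutative ring, before recording its commutativity. -/
def matPrp₀ : Prp where
  Hom n m := Matrix (Fin n) (Fin m) R
  comp a b := a * b
  sum a b := blockSum a b
  perm e := permMat R e
  toZero _ := 0
  ofZero _ := 0
  comp_assoc := Matrix.mul_assoc
  id_comp a := by rw [permMat_refl, Matrix.one_mul]
  comp_id a := by rw [permMat_refl, Matrix.mul_one]
  perm_comp f e := by rw [mul_permMat]; rfl
  sum_comp := blockSum_mul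
  sum_perm e e' := by
    ext i j
    refine Fin.addCases (fun i => ?_) (fun i => ?_) i <;>
      refine Fin.addCases (fun j => ?_) (fun j => ?_) j <;>
      simp [permMat, Matrix.one_apply]
    all_goals
      simp [Fin.ext_iff]
    all_goals
      omega
  sum_assoc {n m n' m' n'' m''} a b c := by
    rw [permMat_mul, mul_permMat]
    ext i j
    have h := blockSum_assoc a b c ((finCongr (add_assoc n n' n'')).symm i) j
    simpa using h
  sum_zero a := by
    ext i j
    exact blockSum_castAdd_castAdd a _ i j
  zero_sum {n m} a := by
    rw [permMat_mul, mul_permMat]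
    ext i j
    have hi : (finCongr (zero_add n)).symm i = Fin.natAdd 0 i := by ext; simp
    obtain ⟨j, rfl⟩ : ∃ j', j = Fin.natAdd 0 j' := ⟨Fin.cast (zero_add m) j, by ext; simp⟩
    have hj : finCongr (zero_add m) (Fin.natAdd 0 j) = j := by ext; simp
    simp only [Matrix.submatrix_apply, hi, hj, id, blockSum_natAdd_natAdd]
  swap a b := by
    rw [permMat_mul, mul_permMat]
    ext i j
    refine Fin.addCases (fun i => ?_) (fun i => ?_) i <;>
      refine Fin.addCases (fun j => ?_) (fun j => ?_) j <;>
      simp [finAddFlip]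
  eq_toZero a := by ext i; exact i.elim0
  eq_ofZero a := by ext _ i; exact i.elim0

theorem rowSum_apply {n : ℕ} (p : Matrix (Fin 1) (Fin n) R) (m : ℕ) (i : Fin m) (x : Fin m)
    (y : Fin n) : (Prp.rowSum (A := matPrp₀ R) p m : Matrix (Fin m) (Fin (n * m)) R) i
      (finCongr (mul_comm m n) (finProdFinEquiv (x, y))) = if i = x then p 0 y else 0 := by
  induction m with
  | zero => exact i.elim0
  | succ m ih =>
    change blockSum (Prp.rowSum (A := matPrp₀ R) p m : Matrix (Fin m) (Fin (n * m)) R) p i _ = _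
    induction x using Fin.lastCases with
    | last =>
      have h : (finCongr (mul_comm (m + 1) n) (finProdFinEquiv (Fin.last m, y)) :
          Fin (n * m + n)) = Fin.natAdd (n * m) y := by
        ext; simp [finProdFinEquiv, add_comm]
      rw [h]
      induction i using Fin.lastCases with
      | last => exact (blockSum_natAdd_natAdd _ p 0 y).trans (by simp)
      | cast i =>
        exact (blockSum_castAdd_natAdd _ p i y).trans (by simp [Fin.castSucc_ne_last])
    | cast x =>
      have h : (finCongr (mul_comm (m + 1) n) (finProdFinEquiv (x.castSucc, y)) :
          Fin (n * m + n)) =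
            Fin.castAdd n (finCongr (mul_comm m n) (finProdFinEquiv (x, y))) := by
        ext; simp [finProdFinEquiv]
      rw [h]
      induction i using Fin.lastCases with
      | last =>
        exact (blockSum_natAdd_castAdd _ p 0 _).trans (by simp [(Fin.castSucc_ne_last x).symm])
      | cast i =>
        exact (blockSum_castAdd_castAdd _ p i _).trans (by rw [ih i x]; simp)

theorem colSum_apply {m : ℕ} (q : Matrix (Fin m) (Fin 1) R) (n : ℕ) (j : Fin n) (x : Fin n)
    (y : Fin m) : (Prp.colSum (A := matPrp₀ R) q n : Matrix (Fin (m * n)) (Fin n) R)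
      (finCongr (mul_comm n m) (finProdFinEquiv (x, y))) j = if j = x then q y 0 else 0 := by
  induction n with
  | zero => exact j.elim0
  | succ n ih =>
    change blockSum (Prp.colSum (A := matPrp₀ R) q n : Matrix (Fin (m * n)) (Fin n) R) q _ j = _
    induction x using Fin.lastCases with
    | last =>
      have h : (finCongr (mul_comm (n + 1) m) (finProdFinEquiv (Fin.last n, y)) :
          Fin (m * n + m)) = Fin.natAdd (m * n) y := by
        ext; simp [finProdFinEquiv, add_comm]
      rw [h]
      induction j using Fin.lastCases with
      | last => exact (blockSum_natAdd_natAdd _ q y 0).trans (by simp)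
      | cast j =>
        exact (blockSum_natAdd_castAdd _ q y j).trans (by simp [Fin.castSucc_ne_last])
    | cast x =>
      have h : (finCongr (mul_comm (n + 1) m) (finProdFinEquiv (x.castSucc, y)) :
          Fin (m * n + m)) =
            Fin.castAdd m (finCongr (mul_comm n m) (finProdFinEquiv (x, y))) := by
        ext; simp [finProdFinEquiv]
      rw [h]
      induction j using Fin.lastCases with
      | last =>
        exact (blockSum_castAdd_natAdd _ q _ 0).trans (by simp [(Fin.castSucc_ne_last x).symm])
      | cast j =>
        exact (blockSum_castAdd_castAdd _ q _ j).trans (by rw [ih j x]; simp)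

theorem blockSum_scalar (s : Matrix (Fin 1) (Fin 1) R) (n : ℕ) :
    blockSum (s 0 0 • (1 : Matrix (Fin n) (Fin n) R)) s =
      s 0 0 • (1 : Matrix (Fin (n + 1)) (Fin (n + 1)) R) := by
  ext i j
  induction i using Fin.addCases with
  | left i =>
    induction j using Fin.addCases with
    | left j => simp [Matrix.one_apply]
    | right j =>
      have : Fin.castAdd 1 i ≠ Fin.natAdd n j := fun h => by
        have := congrArg Fin.val h; simp at this; omega
      simp [this]
  | right i =>
    induction j using Fin.addCases with
    | left j =>
      have : Fin.natAdd n i ≠ Fin.castAdd 1 j := fun h => by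
        have := congrArg Fin.val h; simp at this; omega
      simp [this]
    | right j => simp [Subsingleton.elim i 0, Subsingleton.elim j 0]

theorem diag_matPrp₀ (s : Matrix (Fin 1) (Fin 1) R) (n : ℕ) :
    Prp.diag (A := matPrp₀ R) (fun _ : Fin n => s) = s 0 0 • (1 : Matrix (Fin n) (Fin n) R) := by
  induction n with
  | zero => exact permMat_refl 0 |>.trans (Subsingleton.elim _ _)
  | succ n ih =>
    refine Eq.trans ?_ (blockSum_scalar s n)
    rw [← ih]
    rfl

theorem mul_eq_rowSum_colSum {n m : ℕ} (q : Matrix (Fin m) (Fin 1) R)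
    (p : Matrix (Fin 1) (Fin n) R) (r : Matrix (Fin m) (Fin (n * m)) R)
    (c : Matrix (Fin (m * n)) (Fin n) R)
    (hr : ∀ i x y, r i (finCongr (mul_comm m n) (finProdFinEquiv (x, y))) =
      if i = x then p 0 y else 0)
    (hc : ∀ j x y, c (finCongr (mul_comm n m) (finProdFinEquiv (x, y))) j =
      if j = x then q y 0 else 0) :
    q * p = r * (permMat R (sigma m n) * c) := by
  rw [← Matrix.mul_assoc, mul_permMat]
  ext i j
  rw [Matrix.mul_apply, Matrix.mul_apply,
    ← (finProdFinEquiv.trans (finCongr (mul_comm n m))).sum_comp, Fintype.sum_prod_type]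
  have h (x : Fin n) (y : Fin m) : sigma m n
      ((finProdFinEquiv.trans (finCongr (mul_comm n m))) (x, y)) =
      finCongr (mul_comm m n) (finProdFinEquiv (y, x)) := by
    simp only [sigma, Equiv.trans_apply]
    have : (finCongr (mul_comm m n)) ((finCongr (mul_comm n m)) (finProdFinEquiv (x, y))) =
        finProdFinEquiv (x, y) := by ext; simp
    rw [this]
    simp
  simp only [Matrix.submatrix_apply, h, id, hr]
  simp only [Equiv.trans_apply, hc]
  simp [mul_comm]

theorem scalar_central {n m : ℕ} (s : R) (a : Matrix (Fin n) (Fin m) R) :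
    (s • (1 : Matrix (Fin n) (Fin n) R)) * a = a * (s • (1 : Matrix (Fin m) (Fin m) R)) := by
  simp

variable (R) in
/-- The prop of matrices over a commutative ring. -/
def matPrp : CPrp where
  toPrp := matPrp₀ R
  comm :=
    { row_col := fun {n m} q p => mul_eq_rowSum_colSum q p _ _
        (rowSum_apply p m) (colSum_apply q n)
      central := fun {n m} s a =>
        (congrArg (fun d => (matPrp₀ R).comp d a) (diag_matPrp₀ s n)).trans <|
          Eq.trans (scalar_central _ a)
            (congrArg (fun d => (matPrp₀ R).comp a d) (diag_matPrp₀ s m)).symm }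

theorem blockSum_map {R S : Type} [CommRing R] [CommRing S] (f : R →+* S) {n m n' m' : ℕ}
    (a : Matrix (Fin n) (Fin m) R) (b : Matrix (Fin n') (Fin m') R) :
    (blockSum a b).map f = blockSum (a.map f) (b.map f) := by
  ext i j
  induction i using Fin.addCases <;> induction j using Fin.addCases <;> simp

/-- The map of matrix props induced by a ring homomorphism. -/
def matHom {R S : Type} [CommRing R] [CommRing S] (f : R →+* S) :
    PrpHom (matPrp R).toPrp (matPrp S).toPrp where
  map a := Matrix.map a f
  map_comp a b := Matrix.map_mul
  map_sum := blockSum_map f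
  map_perm e := by
    change Matrix.map (permMat R e) f = permMat S e
    ext i j
    simp only [permMat, Matrix.map_apply, Matrix.submatrix_apply, Matrix.one_apply]
    split_ifs <;> simp

theorem matHom_matHom {R S T : Type} [CommRing R] [CommRing S] [CommRing T] (f : R →+* S)
    (g : S →+* T) {n m : ℕ} (a : (matPrp R).Hom n m) :
    (matHom g).map ((matHom f).map a) = (matHom (g.comp f)).map a := rfl

end Matrices

/-! ### Localization -/

section Scalars

variable (A : CPrp)

theorem Prp.perm_of_eq_refl (A : Prp) {n : ℕ} (e : Fin n ≃ Fin n) (h : e = Equiv.refl _) :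
    A.perm e = A.one n := by rw [h]; rfl

theorem Prp.eq_of_zero_left (A : Prp) {m : ℕ} (a b : A.Hom 0 m) : a = b :=
  (A.eq_toZero a).trans (A.eq_toZero b).symm

theorem Prp.eq_of_zero_right (A : Prp) {n : ℕ} (a b : A.Hom n 0) : a = b :=
  (A.eq_ofZero a).trans (A.eq_ofZero b).symm

theorem Prp.diag_one (A : Prp) (s : Fin 1 → A.Hom 1 1) : Prp.diag s = s 0 := by
  have h := A.zero_sum (s 0)
  rw [A.perm_of_eq_refl (finCongr (zero_add 1)) (by ext i; simp)] at h
  exact (A.id_comp _).symm.trans (h.trans (A.comp_id _))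

/-- Multiplication in `A_{1,1}` is composition. -/
instance scalarMonoid : CommMonoid (A.Hom 1 1) where
  mul s t := A.comp s t
  one := A.one 1
  mul_assoc := A.comp_assoc
  one_mul := A.id_comp
  mul_one := A.comp_id
  mul_comm s t := by
    have h := A.comm.central s t
    rwa [A.diag_one] at h

variable {A}

theorem scalar_mul_def (s t : A.Hom 1 1) : s * t = A.comp s t := rfl

theorem scalar_one_def : (1 : A.Hom 1 1) = A.one 1 := rfl

theorem diag_const_one : ∀ n : ℕ, Prp.diag (fun _ : Fin n => (1 : A.Hom 1 1)) = A.one n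
  | 0 => rfl
  | n + 1 => by
    change A.sum (Prp.diag (fun _ : Fin n => (1 : A.Hom 1 1))) (A.one 1) = _
    rw [diag_const_one n]
    refine (A.sum_perm _ _).trans (A.perm_of_eq_refl _ ?_)
    simp

theorem diag_mul : ∀ {n : ℕ} (s t : Fin n → A.Hom 1 1),
    Prp.diag (fun i => s i * t i) = A.comp (Prp.diag s) (Prp.diag t)
  | 0, _, _ => A.eq_of_zero_left _ _
  | n + 1, s, t => by
    simp only [Prp.diag]
    rw [diag_mul, ← A.sum_comp]; rfl

theorem diag_const_add (s : A.Hom 1 1) (n : ℕ) : ∀ k : ℕ,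
    Prp.diag (fun _ : Fin (n + k) => s) =
      A.sum (Prp.diag fun _ : Fin n => s) (Prp.diag fun _ : Fin k => s)
  | 0 => (A.sum_zero _).symm
  | k + 1 => by
    change A.sum (Prp.diag fun _ : Fin (n + k) => s) s =
      A.sum _ (A.sum (Prp.diag fun _ : Fin k => s) s)
    rw [diag_const_add s n k]
    have h := A.sum_assoc (Prp.diag fun _ : Fin n => s) (Prp.diag fun _ : Fin k => s) s
    rw [A.perm_of_eq_refl (finCongr (add_assoc n k 1)) (by ext i; simp)] at h
    exact (A.id_comp _).symm.trans (h.trans (A.comp_id _))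

theorem one_smul' {n m : ℕ} (a : A.Hom n m) : Prp.smul (1 : A.Hom 1 1) a = a := by
  rw [Prp.smul, diag_const_one]; exact A.id_comp a

theorem smul_smul' (s t : A.Hom 1 1) {n m : ℕ} (a : A.Hom n m) :
    Prp.smul s (Prp.smul t a) = Prp.smul (s * t) a := by
  simp only [Prp.smul]
  rw [← A.comp_assoc, ← diag_mul]

theorem smul_scalar (s t : A.Hom 1 1) : Prp.smul s t = s * t := by
  rw [Prp.smul, A.diag_one]; rfl

theorem mul_smul_comp (s t : A.Hom 1 1) {n m k : ℕ} (a : A.Hom n m) (b : A.Hom m k) :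
    Prp.smul (s * t) (A.comp a b) = A.comp (Prp.smul s a) (Prp.smul t b) := by
  rw [← smul_smul']
  simp only [Prp.smul]
  rw [A.comp_assoc, ← A.comp_assoc _ a b, A.comm.central t a, A.comp_assoc]

theorem smul_sum' (s : A.Hom 1 1) {n m n' m' : ℕ} (a : A.Hom n m) (b : A.Hom n' m') :
    Prp.smul s (A.sum a b) = A.sum (Prp.smul s a) (Prp.smul s b) := by
  simp only [Prp.smul]
  rw [diag_const_add, A.sum_comp]

theorem smul_comp' (s : A.Hom 1 1) {n m k : ℕ} (a : A.Hom n m) (b : A.Hom m k) :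
    Prp.smul s (A.comp a b) = A.comp (Prp.smul s a) b := (A.comp_assoc _ _ _).symm

theorem comp_smul' (s : A.Hom 1 1) {n m k : ℕ} (a : A.Hom n m) (b : A.Hom m k) :
    Prp.smul s (A.comp a b) = A.comp a (Prp.smul s b) := by
  rw [← one_mul s, mul_smul_comp, one_smul', one_mul]

theorem smul_diag (s : A.Hom 1 1) {n : ℕ} (a : Fin n → A.Hom 1 1) :
    Prp.smul s (Prp.diag a) = Prp.diag fun i => s * a i := by
  rw [Prp.smul, diag_mul]

end Scalars

theorem PrpHom.map_one {A B : CPrp} (f : PrpHom A.toPrp B.toPrp) :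
    f.map (1 : A.Hom 1 1) = 1 := f.map_perm _

theorem PrpHom.map_mul {A B : CPrp} (f : PrpHom A.toPrp B.toPrp) (s t : A.Hom 1 1) :
    f.map (s * t) = f.map s * f.map t := f.map_comp _ _

namespace Loc

variable {A : CPrp} (S : Submonoid (A.Hom 1 1))

/-- Fractions `a / s` and `b / t` are identified when `u t a = u s b` for some `u ∈ S`. -/
def setoid (n m : ℕ) : Setoid (A.Hom n m × S) where
  r x y := ∃ u : S, Prp.smul (u * y.2 : A.Hom 1 1) x.1 = Prp.smul (u * x.2 : A.Hom 1 1) y.1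
  iseqv :=
    { refl := fun _ => ⟨1, rfl⟩
      symm := fun ⟨u, h⟩ => ⟨u, h.symm⟩
      trans := fun {x y z} ⟨u, h⟩ ⟨v, h'⟩ => ⟨u * v * y.2, by
        have e1 : ((u * v * y.2 : S) * z.2 : A.Hom 1 1) = (v * z.2) * (u * y.2) := by
          push_cast; ac_rfl
        have e2 : ((v : A.Hom 1 1) * z.2) * (u * x.2) = (u * x.2) * (v * z.2) := mul_comm _ _
        have e3 : ((u : A.Hom 1 1) * x.2) * (v * y.2) = (u * v * y.2 : S) * x.2 := by
          push_cast; ac_rfl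
        rw [e1, ← smul_smul', h, smul_smul', e2, ← smul_smul', h', smul_smul', e3]⟩ }

/-- The set `(S⁻¹ A)_{n,m}`. -/
def Hom (n m : ℕ) : Type := Quotient (setoid S n m)

variable {S}

/-- The fraction `a / s`. -/
def mk {n m : ℕ} (a : A.Hom n m) (s : S) : Hom S n m := Quotient.mk (setoid S n m) (a, s)

theorem mk_eq {n m : ℕ} {a b : A.Hom n m} {s t : S} : mk a s = mk b t ↔
    ∃ u : S, Prp.smul (u * t : A.Hom 1 1) a = Prp.smul (u * s : A.Hom 1 1) b :=
  Quotient.eq (r := setoid S n m)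

theorem ind {n m : ℕ} {P : Hom S n m → Prop} (h : ∀ a s, P (mk a s)) (x : Hom S n m) : P x :=
  Quotient.ind (fun y => h y.1 y.2) x

theorem mk_smul {n m : ℕ} (a : A.Hom n m) (s u : S) :
    mk (Prp.smul (u : A.Hom 1 1) a) (u * s) = mk a s :=
  mk_eq.2 ⟨1, by
    rw [smul_smul']; congr 1; push_cast; ac_rfl⟩

/-- Composition of fractions, `(a / s) ∘ (b / t) = (a ∘ b) / (s t)`. -/
def comp {n m k : ℕ} (x : Hom S n m) (y : Hom S m k) : Hom S n k :=
  Quotient.liftOn₂ x y (fun x y => mk (A.comp x.1 y.1) (x.2 * y.2)) (by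
    rintro ⟨a, s⟩ ⟨b, t⟩ ⟨a', s'⟩ ⟨b', t'⟩ ⟨u, hu⟩ ⟨v, hv⟩
    refine mk_eq.2 ⟨u * v, ?_⟩
    have e1 : ((u * v : S) * (s' * t' : S) : A.Hom 1 1) = (u * s') * (v * t') := by
      push_cast; ac_rfl
    have e2 : ((u * v : S) * (s * t : S) : A.Hom 1 1) = (u * s) * (v * t) := by
      push_cast; ac_rfl
    dsimp only at hu hv ⊢
    rw [e1, mul_smul_comp, hu, hv, ← mul_smul_comp, e2])

/-- The sum of fractions, `(a / s) ⊕ (b / t) = (t a ⊕ s b) / (s t)`. -/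
def sum {n m n' m' : ℕ} (x : Hom S n m) (y : Hom S n' m') : Hom S (n + n') (m + m') :=
  Quotient.liftOn₂ x y (fun x y => mk (A.sum (Prp.smul (y.2 : A.Hom 1 1) x.1)
    (Prp.smul (x.2 : A.Hom 1 1) y.1)) (x.2 * y.2)) (by
    rintro ⟨a, s⟩ ⟨b, t⟩ ⟨a', s'⟩ ⟨b', t'⟩ ⟨u, hu⟩ ⟨v, hv⟩
    refine mk_eq.2 ⟨u * v, ?_⟩
    dsimp only at hu hv ⊢
    rw [smul_sum', smul_sum', smul_smul', smul_smul', smul_smul', smul_smul']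
    have e1 : ((u * v : S) * (s' * t' : S) : A.Hom 1 1) * t = (v * t * t') * (u * s') := by
      push_cast; ac_rfl
    have e2 : ((u * v : S) * (s' * t' : S) : A.Hom 1 1) * s = (u * s * s') * (v * t') := by
      push_cast; ac_rfl
    have e3 : ((u * v : S) * (s * t : S) : A.Hom 1 1) * t' = (v * t * t') * (u * s) := by
      push_cast; ac_rfl
    have e4 : ((u * v : S) * (s * t : S) : A.Hom 1 1) * s' = (u * s * s') * (v * t) := by
      push_cast; ac_rfl
    rw [e1, e2, e3, e4, ← smul_smul', hu, smul_smul', ← smul_smul' _ _ b, hv, smul_smul'])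

theorem mk_comp_mk {n m k : ℕ} (a : A.Hom n m) (b : A.Hom m k) (s t : S) :
    comp (mk a s) (mk b t) = mk (A.comp a b) (s * t) := rfl

theorem mk_sum_mk {n m n' m' : ℕ} (a : A.Hom n m) (b : A.Hom n' m') (s t : S) :
    sum (mk a s) (mk b t) = mk (A.sum (Prp.smul (t : A.Hom 1 1) a)
      (Prp.smul (s : A.Hom 1 1) b)) (s * t) := rfl

theorem mk_sum_mk_same {n m n' m' : ℕ} (a : A.Hom n m) (b : A.Hom n' m') (s : S) :
    sum (mk a s) (mk b s) = mk (A.sum a b) s := by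
  rw [mk_sum_mk, ← smul_sum', mk_smul]

theorem mk_congr {n m : ℕ} {a b : A.Hom n m} {s t : S} (h : a = b)
    (h' : (s : A.Hom 1 1) = t) : mk a s = mk b t := by
  rw [h, Subtype.ext h']

variable (S)

/-- The localization `S⁻¹ A`, before recording its commutativity. -/
def loc₀ : Prp where
  Hom := Hom S
  comp := comp
  sum := sum
  perm e := mk (A.perm e) 1
  toZero m := mk (A.toZero m) 1
  ofZero n := mk (A.ofZero n) 1
  comp_assoc x y z := by
    induction x using ind with | _ a s
    induction y using ind with | _ b t
    induction z using ind with | _ c u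
    exact mk_congr (A.comp_assoc a b c) (by rw [mul_assoc])
  id_comp x := by
    induction x using ind with | _ a s
    exact mk_congr (A.id_comp a) (by rw [one_mul])
  comp_id x := by
    induction x using ind with | _ a s
    exact mk_congr (A.comp_id a) (by rw [mul_one])
  perm_comp f e := mk_congr (A.perm_comp f e) (by rw [mul_one])
  sum_comp x y x' y' := by
    induction x using ind with | _ a s
    induction y using ind with | _ b t
    induction x' using ind with | _ a' s'
    induction y' using ind with | _ b' t'
    rw [mk_comp_mk, mk_comp_mk, mk_sum_mk, mk_sum_mk, mk_sum_mk, mk_comp_mk]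
    refine mk_congr ?_ (by push_cast; ac_rfl)
    rw [Submonoid.coe_mul, Submonoid.coe_mul, mul_smul_comp, mul_smul_comp, A.sum_comp]
  sum_perm e e' := by
    rw [mk_sum_mk_same]
    exact mk_congr (A.sum_perm e e') rfl
  sum_assoc x y z := by
    induction x using ind with | _ a s
    induction y using ind with | _ b t
    induction z using ind with | _ c u
    rw [mk_sum_mk, mk_sum_mk, mk_sum_mk, mk_sum_mk, mk_comp_mk, mk_comp_mk]
    refine mk_congr ?_ (by push_cast; ac_rfl)
    rw [smul_sum', smul_sum', smul_smul', smul_smul', smul_smul', smul_smul', A.sum_assoc]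
    push_cast
    rw [mul_comm (u : A.Hom 1 1) t, mul_comm (u : A.Hom 1 1) s]
  sum_zero x := by
    induction x using ind with | _ a s
    rw [mk_sum_mk]
    have h : Prp.smul (s : A.Hom 1 1) (A.perm (Equiv.refl (Fin 0))) = A.perm (Equiv.refl (Fin 0)) :=
      A.eq_of_zero_left _ _
    rw [h]
    refine (mk_congr (A.sum_zero _) ?_).trans (mk_smul a s 1)
    push_cast; ac_rfl
  zero_sum x := by
    induction x using ind with | _ a s
    rw [mk_sum_mk, mk_comp_mk, mk_comp_mk]
    have h : Prp.smul (s : A.Hom 1 1) (A.perm (Equiv.refl (Fin 0))) = A.perm (Equiv.refl (Fin 0)) :=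
      A.eq_of_zero_left _ _
    rw [h, Submonoid.coe_one, one_smul', A.zero_sum]
    exact mk_congr rfl (by push_cast; simp)
  swap x y := by
    induction x using ind with | _ a s
    induction y using ind with | _ b t
    rw [mk_sum_mk, mk_sum_mk, mk_comp_mk, mk_comp_mk]
    exact mk_congr (A.swap _ _) (by push_cast; simp [mul_comm])
  eq_toZero x := by
    induction x using ind with | _ a s
    exact mk_eq.2 ⟨1, A.eq_of_zero_left _ _⟩
  eq_ofZero x := by
    induction x using ind with | _ a s
    exact mk_eq.2 ⟨1, A.eq_of_zero_right _ _⟩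

variable {S}

theorem rowSum_mk {n : ℕ} (p : A.Hom 1 n) (s : S) : ∀ m : ℕ,
    Prp.rowSum (A := loc₀ S) (mk p s) m = mk (Prp.rowSum p m) s
  | 0 => (loc₀ S).eq_of_zero_left _ _
  | m + 1 => by
    change sum (Prp.rowSum (A := loc₀ S) (mk p s) m) (mk p s) = _
    rw [rowSum_mk p s m]; exact mk_sum_mk_same _ _ _

theorem colSum_mk {m : ℕ} (q : A.Hom m 1) (s : S) : ∀ n : ℕ,
    Prp.colSum (A := loc₀ S) (mk q s) n = mk (Prp.colSum q n) s
  | 0 => (loc₀ S).eq_of_zero_right (n := m * 0) _ _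
  | n + 1 => by
    change sum (Prp.colSum (A := loc₀ S) (mk q s) n) (mk q s) = _
    rw [colSum_mk q s n]; exact mk_sum_mk_same _ _ _

theorem diag_mk (s : S) : ∀ {n : ℕ} (a : Fin n → A.Hom 1 1),
    Prp.diag (A := loc₀ S) (fun i => mk (a i) s) = mk (Prp.diag a) s
  | 0, _ => (loc₀ S).eq_of_zero_left _ _
  | n + 1, a => by
    change sum (Prp.diag (A := loc₀ S) (fun i : Fin n => mk (a i.castSucc) s)) (mk _ s) = _
    rw [diag_mk s]; exact mk_sum_mk_same _ _ _

end Loc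

/-- The localization `S⁻¹ A` of a commutative prop. -/
def loc {A : CPrp} (S : Submonoid (A.Hom 1 1)) : CPrp where
  toPrp := Loc.loc₀ S
  comm :=
    { row_col := fun q p => by
        induction q using Loc.ind with | _ q s
        induction p using Loc.ind with | _ p t
        rw [Loc.rowSum_mk, Loc.colSum_mk]
        exact Loc.mk_congr (A.comm.row_col q p) (by push_cast; simp [mul_comm])
      central := fun x y => by
        induction x using Loc.ind with | _ a s
        induction y using Loc.ind with | _ b t
        rw [Loc.diag_mk, Loc.diag_mk]
        exact Loc.mk_congr (A.comm.central a b) (by push_cast; simp [mul_comm]) }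

/-- The map of localizations induced by a map of props which sends `S` into `T`. -/
def locMap {A B : CPrp} (f : PrpHom A.toPrp B.toPrp) {S : Submonoid (A.Hom 1 1)}
    {T : Submonoid (B.Hom 1 1)} (h : ∀ s ∈ S, f.map s ∈ T) :
    PrpHom (loc S).toPrp (loc T).toPrp where
  map x := Quotient.liftOn x (fun y => Loc.mk (f.map y.1) ⟨f.map y.2.1, h _ y.2.2⟩) (by
    rintro ⟨a, s⟩ ⟨b, t⟩ ⟨u, hu⟩
    refine Loc.mk_eq.2 ⟨⟨f.map u, h _ u.2⟩, ?_⟩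
    have := congrArg f.map hu
    rw [f.map_smul, f.map_smul, f.map_mul, f.map_mul] at this
    exact this)
  map_comp x y := by
    induction x using Loc.ind with | _ a s
    induction y using Loc.ind with | _ b t
    exact Loc.mk_congr (f.map_comp a b) (f.map_mul _ _)
  map_sum x y := by
    induction x using Loc.ind with | _ a s
    induction y using Loc.ind with | _ b t
    refine Loc.mk_congr ?_ (f.map_mul _ _)
    dsimp only
    rw [f.map_sum, f.map_smul, f.map_smul]
  map_perm e := Loc.mk_congr (f.map_perm e) f.map_one

/-! ### Prime ideals and the spectrum -/

/-- An ideal of a commutative prop: a set `I ⊆ A_{1,1}` with `p ∘ (a_1 ⊕ ⋯ ⊕ a_n) ∘ q ∈ I` for all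
`n ≥ 0`, `a_i ∈ I`, `p ∈ A_{1,n}`, `q ∈ A_{n,1}`. -/
def IsIdeal (A : CPrp) (I : Set (A.Hom 1 1)) : Prop :=
  ∀ (n : ℕ) (p : A.Hom 1 n) (a : Fin n → A.Hom 1 1) (q : A.Hom n 1),
    (∀ i, a i ∈ I) → A.comp p (A.comp (Prp.diag a) q) ∈ I

theorem IsIdeal.mul_mem {A : CPrp} {I : Set (A.Hom 1 1)} (h : IsIdeal A I) (s : A.Hom 1 1)
    {a : A.Hom 1 1} (ha : a ∈ I) : s * a ∈ I := by
  have := h 1 s (fun _ => a) 1 (fun _ => ha)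
  rw [A.diag_one, ← scalar_mul_def, ← scalar_mul_def, mul_one] at this
  exact this

/-- A prime ideal of a commutative prop: a proper ideal whose complement is multiplicative. -/
@[ext]
structure PrimeIdeal (A : CPrp) where
  carrier : Set (A.Hom 1 1)
  isIdeal : IsIdeal A carrier
  one_notMem : (1 : A.Hom 1 1) ∉ carrier
  mem_or_mem : ∀ {a b : A.Hom 1 1}, a * b ∈ carrier → a ∈ carrier ∨ b ∈ carrier

namespace PrimeIdeal

variable {A B : CPrp}

/-- The complement of a prime ideal. -/
def compl (x : PrimeIdeal A) : Submonoid (A.Hom 1 1) where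
  carrier := x.carrierᶜ
  one_mem' := x.one_notMem
  mul_mem' ha hb h := (x.mem_or_mem h).elim ha hb

theorem mem_compl {x : PrimeIdeal A} {a : A.Hom 1 1} : a ∈ x.compl ↔ a ∉ x.carrier := Iff.rfl

/-- The inverse image of a prime ideal. -/
def comap (f : PrpHom A.toPrp B.toPrp) (x : PrimeIdeal B) : PrimeIdeal A where
  carrier := {a | f.map a ∈ x.carrier}
  isIdeal n p a q h := by
    change f.map _ ∈ x.carrier
    rw [f.map_comp, f.map_comp, f.map_diag]
    exact x.isIdeal n _ _ _ h
  one_notMem h := x.one_notMem (f.map_one ▸ h)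
  mem_or_mem {a b} h := by
    change f.map (a * b) ∈ x.carrier at h
    rw [f.map_mul] at h
    exact x.mem_or_mem h

/-- The basic open set `D(a)` of all primes which do not contain `a`. -/
def basicOpen (a : A.Hom 1 1) : Set (PrimeIdeal A) := {x | a ∉ x.carrier}

/-- The Zariski topology. The sets `D(a)` form a basis, as `D(a) ∩ D(b) = D(a b)`; so the closed sets
are the sets `V(E)` of all primes which contain a given set `E ⊆ A_{1,1}`. -/
instance zariski (A : CPrp) : TopologicalSpace (PrimeIdeal A) :=
  TopologicalSpace.generateFrom (Set.range basicOpen)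

theorem isOpen_basicOpen (a : A.Hom 1 1) : IsOpen (basicOpen a) :=
  TopologicalSpace.isOpen_generateFrom_of_mem ⟨a, rfl⟩

theorem continuous_comap (f : PrpHom A.toPrp B.toPrp) : Continuous (comap f) :=
  continuous_generateFrom_iff.2 (by
    rintro _ ⟨a, rfl⟩
    exact isOpen_basicOpen (f.map a))

/-- The stalk `A_x`. -/
def stalk (x : PrimeIdeal A) : CPrp := loc x.compl

/-- The fraction `a / s` in `A_x`. -/
def frac (x : PrimeIdeal A) {n m : ℕ} (a : A.Hom n m) (s : A.Hom 1 1) (hs : s ∉ x.carrier) :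
    x.stalk.Hom n m := Loc.mk a (⟨s, hs⟩ : x.compl)

theorem frac_ind (x : PrimeIdeal A) {n m : ℕ} {P : x.stalk.Hom n m → Prop}
    (h : ∀ a s hs, P (x.frac a s hs)) (b : x.stalk.Hom n m) : P b :=
  Loc.ind (fun a s => h a s.1 s.2) b

theorem frac_eq (x : PrimeIdeal A) {n m : ℕ} {a b : A.Hom n m} {s t : A.Hom 1 1}
    {hs : s ∉ x.carrier} {ht : t ∉ x.carrier} : x.frac a s hs = x.frac b t ht ↔
      ∃ u ∉ x.carrier, Prp.smul (u * t) a = Prp.smul (u * s) b :=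
  Loc.mk_eq.trans ⟨fun ⟨u, h⟩ => ⟨u.1, u.2, h⟩, fun ⟨u, hu, h⟩ => ⟨⟨u, hu⟩, h⟩⟩

/-- The maximal ideal of `A_x`. -/
def maxIdeal (x : PrimeIdeal A) : Set (x.stalk.Hom 1 1) :=
  {b | ∃ a ∈ x.carrier, ∃ s hs, b = x.frac a s hs}

theorem frac_mem_maxIdeal (x : PrimeIdeal A) (a s : A.Hom 1 1) (hs : s ∉ x.carrier) :
    x.frac a s hs ∈ x.maxIdeal ↔ a ∈ x.carrier := by
  refine ⟨fun ⟨b, hb, t, ht, h⟩ => ?_, fun h => ⟨a, h, s, hs, rfl⟩⟩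
  obtain ⟨u, hu', hu⟩ := x.frac_eq.1 h
  rw [smul_scalar, smul_scalar] at hu
  have h1 : (u * t : A.Hom 1 1) * a ∈ x.carrier := hu ▸ x.isIdeal.mul_mem _ hb
  exact (x.mem_or_mem h1).resolve_left (x.compl.mul_mem (x := u) (y := t) hu' ht)

theorem isIdeal_maxIdeal (x : PrimeIdeal A) : IsIdeal x.stalk x.maxIdeal := by
  have key : ∀ (n : ℕ) (a : Fin n → x.stalk.Hom 1 1), (∀ i, a i ∈ x.maxIdeal) →
      ∃ (b : Fin n → A.Hom 1 1) (s : A.Hom 1 1) (hs : s ∉ x.carrier), (∀ i, b i ∈ x.carrier) ∧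
        Prp.diag a = x.frac (Prp.diag b) s hs := by
    intro n
    induction n with
    | zero =>
      exact fun a _ => ⟨fun _ => 1, 1, x.one_notMem, fun i => i.elim0,
        x.stalk.eq_of_zero_left _ _⟩
    | succ n ih =>
      intro a ha
      obtain ⟨b, s, hs, hb, h⟩ := ih (fun i => a i.castSucc) fun i => ha _
      obtain ⟨c, hc, t, ht, h'⟩ := ha (Fin.last n)
      refine ⟨Fin.snoc (α := fun _ => A.Hom 1 1) (fun i => t * b i) (s * c), s * t,
        x.compl.mul_mem (x := s) (y := t) hs ht, fun i => ?_, ?_⟩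
      · induction i using Fin.lastCases with
        | last => simpa using x.isIdeal.mul_mem _ hc
        | cast i => simpa using x.isIdeal.mul_mem _ (hb i)
      · simp only [Prp.diag, Fin.snoc_castSucc, Fin.snoc_last]
        rw [h, h', ← smul_diag, ← smul_scalar]
        rfl
  intro n p a q ha
  obtain ⟨b, s, hs, hb, h⟩ := key n a ha
  rw [h]
  induction p using x.frac_ind with | _ p t ht
  induction q using x.frac_ind with | _ q u hu
  exact (x.frac_mem_maxIdeal _ _ (x.compl.mul_mem ht (x.compl.mul_mem hs hu))).2
    (x.isIdeal n p b q hb)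

theorem frac_mul_inv (x : PrimeIdeal A) (a s : A.Hom 1 1) (hs : s ∉ x.carrier)
    (ha : a ∉ x.carrier) : x.frac a s hs * x.frac s a ha = 1 :=
  (x.frac_eq (a := a * s) (b := (1 : A.Hom 1 1)) (s := s * a) (t := 1)
    (hs := x.compl.mul_mem (x := s) (y := a) hs ha) (ht := x.one_notMem)).2 ⟨1, x.one_notMem, by
      rw [smul_scalar, smul_scalar, mul_comm a s]; simp⟩

theorem isUnit_iff (x : PrimeIdeal A) (b : x.stalk.Hom 1 1) : IsUnit b ↔ b ∉ x.maxIdeal := by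
  induction b using x.frac_ind with | _ a s hs
  rw [frac_mem_maxIdeal]
  constructor
  · intro h ha
    obtain ⟨c, hc⟩ := h.exists_right_inv
    have h1 : (1 : x.stalk.Hom 1 1) ∈ x.maxIdeal := by
      rw [← hc, mul_comm]
      exact x.isIdeal_maxIdeal.mul_mem _ ((x.frac_mem_maxIdeal _ _ _).2 ha)
    exact x.one_notMem ((x.frac_mem_maxIdeal 1 1 x.one_notMem).1 h1)
  · intro ha
    refine .of_mul_eq_one (x.frac s a ha) ?_
    exact x.frac_mul_inv a s hs ha

end PrimeIdeal

/-- A family of fractions over an open set is regular if it is locally a single fraction. -/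
def IsRegular {A : CPrp} (U : Opens (PrimeIdeal A)) {n m : ℕ}
    (s : ∀ x : PrimeIdeal A, x ∈ U → x.stalk.Hom n m) : Prop :=
  ∀ x ∈ U, ∃ V ≤ U, x ∈ V ∧ ∃ (a : A.Hom n m) (f : A.Hom 1 1),
    ∀ y ∈ V, ∃ hf : f ∉ y.carrier, ∀ hy : y ∈ U, s y hy = y.frac a f hf

theorem IsRegular.two {A : CPrp} {U : Opens (PrimeIdeal A)} {n m n' m' : ℕ}
    {s : ∀ x : PrimeIdeal A, x ∈ U → x.stalk.Hom n m}
    {t : ∀ x : PrimeIdeal A, x ∈ U → x.stalk.Hom n' m'} (hs : IsRegular U s)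
    (ht : IsRegular U t) (x : PrimeIdeal A) (hx : x ∈ U) : ∃ V ≤ U, x ∈ V ∧
      ∃ (a : A.Hom n m) (f : A.Hom 1 1) (b : A.Hom n' m') (g : A.Hom 1 1),
        ∀ y ∈ V, ∃ (hf : f ∉ y.carrier) (hg : g ∉ y.carrier), ∀ hy : y ∈ U,
          s y hy = y.frac a f hf ∧ t y hy = y.frac b g hg := by
  obtain ⟨V, h, hx, a, f, H⟩ := hs x hx
  obtain ⟨V', h', hx', b, g, H'⟩ := ht x (h hx)
  refine ⟨V ⊓ V', inf_le_left.trans h, ⟨hx, hx'⟩, a, f, b, g, fun y hy => ?_⟩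
  obtain ⟨hf, e⟩ := H y hy.1
  obtain ⟨hg, e'⟩ := H' y hy.2
  exact ⟨hf, hg, fun hy => ⟨e hy, e' hy⟩⟩

theorem isRegular_const {A : CPrp} (U : Opens (PrimeIdeal A)) {n m : ℕ} (a : A.Hom n m) :
    IsRegular U fun x _ => x.frac a 1 x.one_notMem :=
  fun x hx => ⟨U, le_rfl, hx, a, 1, fun y _ => ⟨y.one_notMem, fun _ => rfl⟩⟩

/-- The prop of sections of the structure sheaf of the spectrum, before recording its
commutativity. -/
def sections₀ (A : CPrp) (U : Opens (PrimeIdeal A)) : Prp where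
  Hom n m := {s : ∀ x : PrimeIdeal A, x ∈ U → x.stalk.Hom n m // IsRegular U s}
  comp s t := ⟨fun x hx => x.stalk.comp (s.1 x hx) (t.1 x hx), fun x hx => by
    obtain ⟨V, h, hx, a, f, b, g, H⟩ := s.2.two t.2 x hx
    refine ⟨V, h, hx, A.comp a b, f * g, fun y hy => ?_⟩
    obtain ⟨hf, hg, e⟩ := H y hy
    exact ⟨y.compl.mul_mem hf hg, fun hy =>
      (congrArg₂ y.stalk.comp (e hy).1 (e hy).2).trans rfl⟩⟩
  sum s t := ⟨fun x hx => x.stalk.sum (s.1 x hx) (t.1 x hx), fun x hx => by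
    obtain ⟨V, h, hx, a, f, b, g, H⟩ := s.2.two t.2 x hx
    refine ⟨V, h, hx, A.sum (Prp.smul g a) (Prp.smul f b), f * g, fun y hy => ?_⟩
    obtain ⟨hf, hg, e⟩ := H y hy
    exact ⟨y.compl.mul_mem hf hg, fun hy =>
      (congrArg₂ y.stalk.sum (e hy).1 (e hy).2).trans rfl⟩⟩
  perm e := ⟨fun x _ => x.stalk.perm e, isRegular_const U (A.perm e)⟩
  toZero m := ⟨fun x _ => x.stalk.toZero m, isRegular_const U (A.toZero m)⟩
  ofZero n := ⟨fun x _ => x.stalk.ofZero n, isRegular_const U (A.ofZero n)⟩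
  comp_assoc a b c := Subtype.ext (funext₂ fun x _ => x.stalk.comp_assoc _ _ _)
  id_comp a := Subtype.ext (funext₂ fun x _ => x.stalk.id_comp _)
  comp_id a := Subtype.ext (funext₂ fun x _ => x.stalk.comp_id _)
  perm_comp f e := Subtype.ext (funext₂ fun x _ => x.stalk.perm_comp f e)
  sum_comp a b a' b' := Subtype.ext (funext₂ fun x _ => x.stalk.sum_comp _ _ _ _)
  sum_perm e e' := Subtype.ext (funext₂ fun x _ => x.stalk.sum_perm e e')
  sum_assoc a b c := Subtype.ext (funext₂ fun x _ => x.stalk.sum_assoc _ _ _)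
  sum_zero a := Subtype.ext (funext₂ fun x _ => x.stalk.sum_zero _)
  zero_sum a := Subtype.ext (funext₂ fun x _ => x.stalk.zero_sum _)
  swap a b := Subtype.ext (funext₂ fun x _ => x.stalk.swap _ _)
  eq_toZero a := Subtype.ext (funext₂ fun x _ => x.stalk.eq_toZero _)
  eq_ofZero a := Subtype.ext (funext₂ fun x _ => x.stalk.eq_ofZero _)

/-- The prop of sections of the structure sheaf of the spectrum. -/
def sections (A : CPrp) (U : Opens (PrimeIdeal A)) : CPrp where
  toPrp := sections₀ A U
  comm := Prp.IsComm.ofInjective _ (fun x : U => x.1.stalk)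
    (fun x => ⟨fun s => s.1 x.1 x.2, fun _ _ => rfl, fun _ _ => rfl, fun _ => rfl⟩)
    (fun _ _ h => Subtype.ext (funext₂ fun x hx => h ⟨x, hx⟩))

/-- The value of a section at a point. -/
def evalAt {A : CPrp} {U : Opens (PrimeIdeal A)} (x : PrimeIdeal A) (hx : x ∈ U) :
    PrpHom (sections A U).toPrp x.stalk.toPrp :=
  ⟨fun s => s.1 x hx, fun _ _ => rfl, fun _ _ => rfl, fun _ => rfl⟩

/-- Restriction of sections. -/
def restrict (A : CPrp) {U V : Opens (PrimeIdeal A)} (h : U ≤ V) :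
    PrpHom (sections A V).toPrp (sections A U).toPrp where
  map s := ⟨fun x hx => s.1 x (h hx), fun x hx => by
    obtain ⟨W, hW, hxW, a, f, H⟩ := s.2 x (h hx)
    exact ⟨W ⊓ U, inf_le_right, ⟨hxW, hx⟩, a, f, fun y hy =>
      ⟨(H y hy.1).1, fun hy' => (H y hy.1).2 (h hy')⟩⟩⟩
  map_comp _ _ := rfl
  map_sum _ _ := rfl
  map_perm _ := rfl

/-! ### Locally propped spaces -/

/-- A topological space with a sheaf of commutative props. -/
structure PSpace where
  carrier : Type
  [top : TopologicalSpace carrier]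
  O : Opens carrier → CPrp
  res : ∀ {U V : Opens carrier}, U ≤ V → PrpHom (O V).toPrp (O U).toPrp
  res_self : ∀ {U : Opens carrier} {n m : ℕ} (s : (O U).Hom n m), (res le_rfl).map s = s
  res_res : ∀ {U V W : Opens carrier} (h : U ≤ V) (h' : V ≤ W) {n m : ℕ} (s : (O W).Hom n m),
    (res h).map ((res h').map s) = (res (h.trans h')).map s
  glue : ∀ {ι : Type} (U : ι → Opens carrier) (n m : ℕ) (s : ∀ i, (O (U i)).Hom n m),
    (∀ i j, (res (inf_le_left : U i ⊓ U j ≤ U i)).map (s i) =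
      (res (inf_le_right : U i ⊓ U j ≤ U j)).map (s j)) →
    ∃! t : (O (iSup U)).Hom n m, ∀ i, (res (le_iSup U i)).map t = s i

attribute [instance] PSpace.top

namespace PSpace

/-- The germ of `s` at `x` is invertible in the stalk at `x`. -/
def UnitAt (X : PSpace) (x : X.carrier) {U : Opens X.carrier} (s : (X.O U).Hom 1 1) : Prop :=
  ∃ (V : Opens X.carrier) (h : V ≤ U), x ∈ V ∧ IsUnit ((X.res h).map s)

/-- All stalks are local props: the germs at `x` which are not invertible form a (proper) ideal of
the stalk at `x`. As any finite number of germs at `x` is defined on a common open neighbourhood,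
this is expressed by sections over open neighbourhoods. The ideal is proper as `1` is invertible. -/
def IsLocal (X : PSpace) : Prop :=
  ∀ (x : X.carrier) (U : Opens X.carrier), x ∈ U →
    IsIdeal (X.O U) {s | ¬ X.UnitAt x s}

end PSpace

/-- A locally propped space: an object of `CProp/Top`. -/
structure LPSpace extends PSpace where
  isLocal : toPSpace.IsLocal

/-- Maps of locally propped spaces: a continuous map, with a pull-back of sections which is
compatible with restrictions, such that the induced maps of stalks send the maximal ideal to the
maximal ideal. -/
@[ext]
structure LPSpace.Map (X Y : LPSpace) where
  base : C(X.carrier, Y.carrier)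
  app : ∀ U : Opens Y.carrier, PrpHom (Y.O U).toPrp (X.O (Opens.comap base U)).toPrp
  naturality : ∀ {U V : Opens Y.carrier} (h : U ≤ V) {n m : ℕ} (s : (Y.O V).Hom n m),
    (app U).map ((Y.res h).map s) = (X.res (Opens.comap_mono base h)).map ((app V).map s)
  isLocal : ∀ (x : X.carrier) (U : Opens Y.carrier), base x ∈ U → ∀ s : (Y.O U).Hom 1 1,
    ¬ Y.UnitAt (base x) s → ¬ X.UnitAt x ((app U).map s)

instance : Category LPSpace where
  Hom := LPSpace.Map
  id _ :=
    { base := ContinuousMap.id _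
      app := fun _ => PrpHom.id _
      naturality := fun _ _ _ _ => rfl
      isLocal := fun _ _ _ _ h => h }
  comp f g :=
    { base := g.base.comp f.base
      app := fun U => (g.app U).trans (f.app (Opens.comap g.base U))
      naturality := fun h _ _ s =>
        (congrArg (f.app _).map (g.naturality h s)).trans (f.naturality _ _)
      isLocal := fun x U hx s hs => f.isLocal x _ hx _ (g.isLocal _ U hx s hs) }
  id_comp _ := rfl
  comp_id _ := rfl
  assoc _ _ _ := rfl

/-- The spectrum, as a space with a sheaf of props. -/
def specPSpace (A : CPrp) : PSpace where
  carrier := PrimeIdeal A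
  O := sections A
  res := restrict A
  res_self _ := rfl
  res_res _ _ _ _ _ := rfl
  glue {ι} U n m s hs := by
    have key : ∀ i j x (hi : x ∈ U i) (hj : x ∈ U j), (s i).1 x hi = (s j).1 x hj :=
      fun i j x hi hj => congrFun (congrFun (congrArg Subtype.val (hs i j)) x) ⟨hi, hj⟩
    have hex (x : PrimeIdeal A) (hx : x ∈ iSup U) : ∃ i, x ∈ U i := Opens.mem_iSup.1 hx
    choose idx hidx using hex
    refine ⟨⟨fun x hx => (s (idx x hx)).1 x (hidx x hx), fun x hx => ?_⟩, fun i => ?_,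
      fun t ht => ?_⟩
    · obtain ⟨V, h, hxV, a, f, H⟩ := (s (idx x hx)).2 x (hidx x hx)
      refine ⟨V, h.trans (le_iSup U _), hxV, a, f, fun y hy => ?_⟩
      obtain ⟨hf, e⟩ := H y hy
      exact ⟨hf, fun hy' => (key _ _ _ _ _).trans (e (h hy))⟩
    · exact Subtype.ext (funext₂ fun x hx => key _ _ _ _ _)
    · exact Subtype.ext (funext₂ fun x hx =>
        congrFun (congrFun (congrArg Subtype.val (ht (idx x hx))) x) (hidx x hx))

theorem spec_unitAt_iff {A : CPrp} (x : PrimeIdeal A) {U : Opens (PrimeIdeal A)} (hx : x ∈ U)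
    (s : (sections A U).Hom 1 1) :
    (specPSpace A).UnitAt x s ↔ s.1 x hx ∉ x.maxIdeal := by
  rw [← x.isUnit_iff]
  constructor
  · rintro ⟨V, h, hV, hu⟩
    obtain ⟨t, ht⟩ := hu.exists_right_inv
    exact .of_mul_eq_one (t.1 x hV) (congrFun (congrFun (congrArg Subtype.val ht) x) hV)
  · intro hu
    obtain ⟨V, h, hV, a, f, H⟩ := s.2 x hx
    obtain ⟨hf, e⟩ := H x hV
    rw [e, x.isUnit_iff, x.frac_mem_maxIdeal] at hu
    let W : Opens (PrimeIdeal A) := V ⊓ ⟨PrimeIdeal.basicOpen a, PrimeIdeal.isOpen_basicOpen a⟩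
    have ha (y : PrimeIdeal A) (hy : y ∈ W) : a ∉ y.carrier := hy.2
    refine ⟨W, inf_le_left.trans h, ⟨hV, hu⟩, .of_mul_eq_one
      (⟨fun y hy => y.frac f a (ha y hy), fun y hy => ⟨W, le_rfl, hy, f, a, fun z hz =>
        ⟨ha z hz, fun _ => rfl⟩⟩⟩ : (sections A W).Hom 1 1) ?_⟩
    refine Subtype.ext (funext₂ fun y hy => ?_)
    change y.stalk.comp (s.1 y _) (y.frac f a (ha y hy)) = _
    rw [(H y hy.1).2]
    exact y.frac_mul_inv a f _ _

/-- The spectrum of a commutative prop, as a locally propped space. -/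
def spec (A : CPrp) : LPSpace where
  toPSpace := specPSpace A
  isLocal x U hx n p a q ha := by
    have ha' (i) : (a i).1 x hx ∈ x.maxIdeal := by
      by_contra h
      exact ha i ((spec_unitAt_iff x hx (a i)).2 h)
    intro h
    refine (spec_unitAt_iff x hx _).1 h ?_
    have e := (evalAt x hx).map_diag a
    change x.stalk.comp _ (x.stalk.comp ((evalAt x hx).map (Prp.diag a)) _) ∈ _
    rw [e]
    exact x.isIdeal_maxIdeal n _ _ _ ha'

/-- The map `A_{f⁻¹(y)} → B_y` of stalks induced by a map of props. -/
def stalkMap {A B : CPrp} (f : PrpHom A.toPrp B.toPrp) (y : PrimeIdeal B) :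
    PrpHom (PrimeIdeal.comap f y).stalk.toPrp y.stalk.toPrp :=
  locMap f (S := (PrimeIdeal.comap f y).compl) (T := y.compl) fun _ h => h

/-- The map of spectra induced by a map of props. -/
def specMap {A B : CPrp} (f : PrpHom A.toPrp B.toPrp) : spec B ⟶ spec A where
  base := ⟨PrimeIdeal.comap f, PrimeIdeal.continuous_comap f⟩
  app U :=
    { map := fun s => ⟨fun y hy => (stalkMap f y).map (s.1 (PrimeIdeal.comap f y) hy),
        fun y hy => by
          obtain ⟨V, h, hx, a, g, H⟩ := s.2 (PrimeIdeal.comap f y) hy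
          refine ⟨⟨PrimeIdeal.comap f ⁻¹' V, V.2.preimage (PrimeIdeal.continuous_comap f)⟩,
            fun z hz => h hz, hx, f.map a, f.map g, fun z hz => ?_⟩
          obtain ⟨hg, e⟩ := H (PrimeIdeal.comap f z) hz
          exact ⟨hg, fun hz => (congrArg (stalkMap f z).map (e hz)).trans rfl⟩⟩
      map_comp := fun s t => Subtype.ext (funext₂ fun y _ => (stalkMap f y).map_comp _ _)
      map_sum := fun s t => Subtype.ext (funext₂ fun y _ => (stalkMap f y).map_sum _ _)
      map_perm := fun e => Subtype.ext (funext₂ fun y _ => (stalkMap f y).map_perm _) }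
  naturality _ _ _ _ := rfl
  isLocal y U hy s hs h := by
    refine (spec_unitAt_iff y hy _).1 h ?_
    have hm : s.1 (PrimeIdeal.comap f y) hy ∈ (PrimeIdeal.comap f y).maxIdeal := by
      by_contra h'
      exact hs ((spec_unitAt_iff _ hy s).2 h')
    obtain ⟨a, ha, t, ht, e⟩ := hm
    exact ⟨f.map a, ha, f.map t, ht, (congrArg (stalkMap f y).map e).trans rfl⟩

/-! ### Prop schemes and pro-objects -/

/-- An open immersion: an open embedding such that the sections over an open set contained in the
image are the same on both sides. -/
def IsOpenImmersion {X Y : LPSpace} (f : X ⟶ Y) : Prop :=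
  Topology.IsOpenEmbedding f.base ∧ ∀ U : Opens Y.carrier, (U : Set Y.carrier) ⊆ Set.range f.base →
    ∀ n m : ℕ, Function.Bijective ((f.app U).map : (Y.O U).Hom n m → _)

/-- A prop scheme: a locally propped space which is covered by open subspaces that are spectra of
commutative props. -/
def isPropScheme : ObjectProperty LPSpace := fun X =>
  ∀ x : X.carrier, ∃ (A : CPrp) (f : spec A ⟶ X), IsOpenImmersion f ∧ x ∈ Set.range f.base

/-- The category of prop schemes. -/
abbrev PSch : Type 1 := isPropScheme.FullSubcategory

universe v u

/-- An object of the pro-category of `C`: an inverse system in `C` over a directed, co-finite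
partially ordered set. -/
structure PreCat (C : Type u) [Category.{v} C] where
  J : Type
  [order : PartialOrder J]
  directed : ∀ j₁ j₂ : J, ∃ j, j₁ ≤ j ∧ j₂ ≤ j
  cofinite : ∀ j : J, {j' | j' ≤ j}.Finite
  sys : Jᵒᵖ ⥤ C

attribute [instance] PreCat.order

namespace PreCat

variable {C : Type u} [Category.{v} C]

/-- The direct limit over `j` of the sets of maps `X_j ⟶ c`. -/
def ColimHom (X : PreCat C) (c : C) : Type v :=
  Quot fun a b : Σ j : X.J, (X.sys.obj (.op j) ⟶ c) =>
    ∃ h : a.1 ≤ b.1, b.2 = X.sys.map (homOfLE h).op ≫ a.2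

/-- Composition with a map `c ⟶ d`. -/
def ColimHom.post {X : PreCat C} {c d : C} (g : c ⟶ d) : X.ColimHom c → X.ColimHom d :=
  Quot.map (fun a => ⟨a.1, a.2 ≫ g⟩) (by
    rintro ⟨j, a⟩ ⟨j', b⟩ ⟨h, e⟩
    exact ⟨h, by dsimp only at e ⊢; rw [e, Category.assoc]⟩)

theorem ColimHom.post_id {X : PreCat C} {c : C} (x : X.ColimHom c) : post (𝟙 c) x = x := by
  induction x using Quot.ind with | _ a
  exact congrArg (Quot.mk _) (by simp)

theorem ColimHom.post_post {X : PreCat C} {c d e : C} (g : c ⟶ d) (h : d ⟶ e)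
    (x : X.ColimHom c) : post h (post g x) = post (g ≫ h) x := by
  induction x using Quot.ind with | _ a
  exact congrArg (Quot.mk _) (by simp)

/-- Maps of pro-objects: the inverse limit over `i` of the direct limit over `j` of the sets of maps
`X_j ⟶ Y_i`. -/
@[ext]
structure Map (X Y : PreCat C) where
  comp : ∀ i : Y.J, X.ColimHom (Y.sys.obj (.op i))
  compat : ∀ {i i' : Y.J} (h : i ≤ i'), ColimHom.post (Y.sys.map (homOfLE h).op) (comp i') = comp i

/-- The effect of a map of pro-objects `X ⟶ Y` on the direct limits of maps to `c`. -/
def Map.pull {X Y : PreCat C} (f : Map X Y) {c : C} : Y.ColimHom c → X.ColimHom c :=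
  Quot.lift (fun a => ColimHom.post a.2 (f.comp a.1)) (by
    rintro ⟨j, a⟩ ⟨j', b⟩ ⟨h, e⟩
    dsimp only at h e ⊢
    rw [e, ← ColimHom.post_post, f.compat])

theorem Map.pull_post {X Y : PreCat C} (f : Map X Y) {c d : C} (g : c ⟶ d) (x : Y.ColimHom c) :
    f.pull (ColimHom.post g x) = ColimHom.post g (f.pull x) := by
  induction x using Quot.ind with | _ a
  exact (ColimHom.post_post _ _ _).symm

instance : Category (PreCat C) where
  Hom := Map
  id X :=
    { comp := fun i => Quot.mk _ ⟨i, 𝟙 _⟩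
      compat := fun h => Eq.symm (Quot.sound ⟨h, by simp⟩) }
  comp f g :=
    { comp := fun k => f.pull (g.comp k)
      compat := fun h => by rw [← Map.pull_post, g.compat] }
  id_comp {X Y} f := Map.ext (funext fun k => by
    change Map.pull _ (f.comp k) = f.comp k
    induction f.comp k using Quot.ind with | _ a
    exact congrArg (Quot.mk _) (by simp))
  comp_id f := Map.ext (funext fun k => ColimHom.post_id _)
  assoc f g h := Map.ext (funext fun k => by
    change Map.pull _ (h.comp k) = Map.pull f (Map.pull g (h.comp k))
    induction h.comp k using Quot.ind with | _ a
    exact (Map.pull_post f _ _).symm)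

end PreCat

/-! ### The compactification of the spectrum of the integers -/

theorem blockSum_mulVec_castAdd {R : Type} [CommRing R] {n m n' m' : ℕ}
    (a : Matrix (Fin n) (Fin m) R) (b : Matrix (Fin n') (Fin m') R) (z : Fin (m + m') → R)
    (i : Fin n) : (blockSum a b).mulVec z (Fin.castAdd n' i) =
      a.mulVec (fun j => z (Fin.castAdd m' j)) i := by
  simp [Matrix.mulVec, dotProduct, Fin.sum_univ_add]

theorem blockSum_mulVec_natAdd {R : Type} [CommRing R] {n m n' m' : ℕ}
    (a : Matrix (Fin n) (Fin m) R) (b : Matrix (Fin n') (Fin m') R) (z : Fin (m + m') → R)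
    (i : Fin n') : (blockSum a b).mulVec z (Fin.natAdd n i) =
      b.mulVec (fun j => z (Fin.natAdd m j)) i := by
  simp [Matrix.mulVec, dotProduct, Fin.sum_univ_add]

/-- The unit ball `{z : z_1² + ⋯ + z_m² ≤ 1}` of `ℝ^m`. -/
def unitBall (m : ℕ) : Set (Fin m → ℝ) := {z | ∑ i, z i ^ 2 ≤ 1}

theorem mapsTo_unitBall_iff {n m : ℕ} (a : Matrix (Fin n) (Fin m) ℝ) :
    Set.MapsTo a.mulVec (unitBall m) (unitBall n) ↔
      ∀ z, ∑ i, a.mulVec z i ^ 2 ≤ ∑ i, z i ^ 2 := by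
  refine ⟨fun h z => ?_, fun h z hz => (h z).trans hz⟩
  have hs : 0 ≤ ∑ i, z i ^ 2 := Finset.sum_nonneg fun i _ => sq_nonneg _
  rcases hs.eq_or_lt with h0 | h0
  · have hz : z = 0 := by
      funext i
      have := (Finset.sum_eq_zero_iff_of_nonneg fun i _ => sq_nonneg (z i)).1 h0.symm i
        (Finset.mem_univ i)
      simpa using this
    subst hz; simp
  · set c := Real.sqrt (∑ i, z i ^ 2) with hc
    have hc2 : c ^ 2 = ∑ i, z i ^ 2 := Real.sq_sqrt hs
    have hc0 : c ^ 2 ≠ 0 := by rw [hc2]; exact h0.ne'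
    have h1 : ∑ i, a.mulVec (c⁻¹ • z) i ^ 2 ≤ 1 := h (show ∑ i, (c⁻¹ • z) i ^ 2 ≤ 1 by
      simp only [Pi.smul_apply, smul_eq_mul, mul_pow, ← Finset.mul_sum, ← hc2, inv_pow]
      rw [inv_mul_cancel₀ hc0])
    simp only [Matrix.mulVec_smul, Pi.smul_apply, smul_eq_mul, mul_pow, ← Finset.mul_sum,
      inv_pow] at h1
    rw [← hc2]
    rwa [inv_mul_le_iff₀ (by rw [hc2]; exact h0), mul_one] at h1

theorem mapsTo_unitBall_mul {n m k : ℕ} {a : Matrix (Fin n) (Fin m) ℝ}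
    {b : Matrix (Fin m) (Fin k) ℝ} (h : Set.MapsTo a.mulVec (unitBall m) (unitBall n))
    (h' : Set.MapsTo b.mulVec (unitBall k) (unitBall m)) :
    Set.MapsTo (a * b).mulVec (unitBall k) (unitBall n) := by
  intro z hz
  rw [← Matrix.mulVec_mulVec]
  exact h (h' hz)

theorem mapsTo_unitBall_blockSum {n m n' m' : ℕ} {a : Matrix (Fin n) (Fin m) ℝ}
    {b : Matrix (Fin n') (Fin m') ℝ} (h : Set.MapsTo a.mulVec (unitBall m) (unitBall n))
    (h' : Set.MapsTo b.mulVec (unitBall m') (unitBall n')) :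
    Set.MapsTo (blockSum a b).mulVec (unitBall (m + m')) (unitBall (n + n')) := by
  rw [mapsTo_unitBall_iff] at h h' ⊢
  intro z
  simp only [Fin.sum_univ_add, blockSum_mulVec_castAdd, blockSum_mulVec_natAdd]
  exact add_le_add (h _) (h' _)

theorem mapsTo_unitBall_permMat {n m : ℕ} (e : Fin m ≃ Fin n) :
    Set.MapsTo (permMat ℝ e).mulVec (unitBall m) (unitBall n) := by
  rw [mapsTo_unitBall_iff]
  intro z
  have h (i : Fin m) : (permMat ℝ e).mulVec z (e i) = z i := by
    simp [Matrix.mulVec, dotProduct, permMat, Matrix.one_apply]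
  rw [← e.sum_comp]
  simp [h]

theorem mapsTo_unitBall_zero (n m : ℕ) :
    Set.MapsTo (0 : Matrix (Fin n) (Fin m) ℝ).mulVec (unitBall m) (unitBall n) := by
  rw [mapsTo_unitBall_iff]
  intro z
  simpa using Finset.sum_nonneg fun i _ => sq_nonneg (z i)

/-- The sub-prop `ℤ_ℝ` of the prop of real matrices: the matrices which map the unit ball to the unit
ball. -/
def realInt : SubPrp (matPrp ℝ) where
  carrier n m := {a : Matrix (Fin n) (Fin m) ℝ | Set.MapsTo a.mulVec (unitBall m) (unitBall n)}
  comp_mem h h' := mapsTo_unitBall_mul h h'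
  sum_mem h h' := mapsTo_unitBall_blockSum h h'
  perm_mem e := mapsTo_unitBall_permMat e
  toZero_mem m := mapsTo_unitBall_zero 0 m
  ofZero_mem n := mapsTo_unitBall_zero n 0

/-- The subring `ℤ[1/N]` of `ℚ`. -/
def intInv (N : ℕ) : Subring ℚ := Subring.closure {(N : ℚ)⁻¹}

/-- The embedding of `ℤ[1/N]` in the real numbers. -/
def intInvToReal (N : ℕ) : intInv N →+* ℝ := (algebraMap ℚ ℝ).comp (intInv N).subtype

/-- The prop `ℤ[1/N] ∩ ℤ_ℝ`, as a sub-prop of the prop of matrices over `ℤ[1/N]`. -/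
def intInvReal (N : ℕ) : SubPrp (matPrp (intInv N)) :=
  realInt.comap (matHom (intInvToReal N))

/-- The map `ℤ → ℤ[1/N]`. -/
def intToInv (N : ℕ) : PrpHom (matPrp ℤ).toPrp (matPrp (intInv N)).toPrp :=
  matHom (Int.castRingHom (intInv N))

theorem intInvToReal_comp {M N : ℕ} (h : intInv M ≤ intInv N) :
    (intInvToReal N).comp (Subring.inclusion h) = intInvToReal M :=
  RingHom.ext fun x => congrArg (algebraMap ℚ ℝ) (Subring.coe_inclusion h x)

theorem inclusion_mem_intInvReal {M N : ℕ} (h : intInv M ≤ intInv N) {n m : ℕ}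
    (c : (intInvReal M).toCPrp.Hom n m) :
    ((intInvReal M).incl.trans (matHom (Subring.inclusion h))).map c ∈
      (intInvReal N).carrier n m := by
  have e := matHom_matHom (Subring.inclusion h) (intInvToReal N) ((intInvReal M).incl.map c)
  rw [intInvToReal_comp] at e
  refine (SubPrp.mem_comap _ _ _).2 ?_
  rw [PrpHom.trans_map, e]
  exact (SubPrp.mem_comap _ _ _).1 (SubPrp.incl_mem (intInvReal M) c)

/-- The inclusion `ℤ[1/M] ∩ ℤ_ℝ → ℤ[1/N] ∩ ℤ_ℝ`, if `ℤ[1/M] ⊆ ℤ[1/N]`. -/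
def intInvRealMap {M N : ℕ} (h : intInv M ≤ intInv N) :
    PrpHom (intInvReal M).toCPrp.toPrp (intInvReal N).toCPrp.toPrp :=
  (intInvReal N).lift ((intInvReal M).incl.trans (matHom (Subring.inclusion h)))
    (inclusion_mem_intInvReal h)

/-- The nonempty finite sets of primes, ordered by inclusion. -/
abbrev PrimeSet : Type := {s : Finset Nat.Primes // s.Nonempty}

/-- The product of the primes in a finite set. -/
def PrimeSet.prod (j : PrimeSet) : ℕ := ∏ p ∈ j.1, (p : ℕ)

theorem PrimeSet.intInv_le {j j' : PrimeSet} (h : j ≤ j') : intInv j.prod ≤ intInv j'.prod := by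
  refine Subring.closure_le.2 ?_
  rintro _ rfl
  have hd : j.prod ∣ j'.prod := Finset.prod_dvd_prod_of_subset _ _ _ h
  have h0 : j'.prod ≠ 0 := Finset.prod_ne_zero_iff.2 fun p _ => p.2.ne_zero
  obtain ⟨k, hk⟩ := hd
  have h1 : (j.prod : ℚ)⁻¹ = k * (j'.prod : ℚ)⁻¹ := by
    rw [hk] at h0 ⊢
    have hj : (j.prod : ℚ) ≠ 0 := by exact_mod_cast (mul_ne_zero_iff.1 h0).1
    have hk : (k : ℚ) ≠ 0 := by exact_mod_cast (mul_ne_zero_iff.1 h0).2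
    push_cast; field_simp
  rw [h1]
  exact Subring.mul_mem _ (natCast_mem _ k) (Subring.subset_closure rfl)

/-- The inverse system of prop schemes which compactifies the spectrum of `ℤ`. For a set of primes
with product `N`, the prop scheme `X_N` is the pushout of `spec ℤ` and `spec (ℤ[1/N] ∩ ℤ_ℝ)` over
`spec ℤ[1/N]`. The maps `X_N' ⟶ X_N` for `N ∣ N'` are induced by the identity of `spec ℤ` and by the
inclusion of `ℤ[1/N] ∩ ℤ_ℝ` in `ℤ[1/N'] ∩ ℤ_ℝ`. -/
structure CompactSpecZ where
  sys : PrimeSetᵒᵖ ⥤ PSch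
  inl : ∀ j : PrimeSet, spec (matPrp ℤ) ⟶ (sys.obj (.op j)).obj
  inr : ∀ j : PrimeSet, spec (intInvReal j.prod).toCPrp ⟶ (sys.obj (.op j)).obj
  isPushout : ∀ j : PrimeSet,
    IsPushout (specMap (intToInv j.prod)) (specMap (intInvReal j.prod).incl) (inl j) (inr j)
  inl_map : ∀ {j j' : PrimeSet} (h : j ≤ j'),
    inl j' ≫ (sys.map (homOfLE h).op).hom = inl j
  inr_map : ∀ {j j' : PrimeSet} (h : j ≤ j'),
    inr j' ≫ (sys.map (homOfLE h).op).hom =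
      specMap (intInvRealMap (PrimeSet.intInv_le h)) ≫ inr j

/-- The points of the compactified spectrum of `ℤ`: the generic point `(0)`, the primes `(p)` and the
real prime `η_ℝ`. -/
inductive Place
  | generic
  | prime (p : Nat.Primes)
  | real

namespace CompactSpecZ

variable (X : CompactSpecZ)

/-- The compactified spectrum of `ℤ` as an object of the pro-category of prop schemes. -/
@[reducible] def pro : PreCat PSch where
  J := PrimeSet
  directed j j' := ⟨⟨j.1 ∪ j'.1, j.2.mono Finset.subset_union_left⟩,
    Finset.subset_union_left, Finset.subset_union_right⟩
  cofinite j := (j.1.powerset.finite_toSet.preimage Subtype.val_injective.injOn).subset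
    fun i hi => by simpa using hi
  sys := X.sys

/-- The point `x` of `X_N` is the place `v`: the image of the prime `(0)` or `(p)` of `spec ℤ`, or
the image of the prime `η_ℝ = ℤ[1/N] ∩ (-1, 1)` of `spec (ℤ[1/N] ∩ ℤ_ℝ)`. -/
def IsPlace (j : PrimeSet) (x : (X.sys.obj (.op j)).obj.carrier) : Place → Prop
  | .generic => ∃ y : PrimeIdeal (matPrp ℤ),
      y.carrier = {a : Matrix (Fin 1) (Fin 1) ℤ | a 0 0 = 0} ∧ (X.inl j).base y = x
  | .prime p => ∃ y : PrimeIdeal (matPrp ℤ),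
      y.carrier = {a : Matrix (Fin 1) (Fin 1) ℤ | (p : ℤ) ∣ a 0 0} ∧ (X.inl j).base y = x
  | .real => ∃ y : PrimeIdeal (intInvReal j.prod).toCPrp,
      y.carrier = (intInvReal j.prod).incl.map ⁻¹'
        {a : Matrix (Fin 1) (Fin 1) (intInv j.prod) | |(a 0 0 : ℚ)| < 1} ∧ (X.inr j).base y = x

end CompactSpecZ

/-- Integrality of a rational matrix at a place: no condition at the generic point; at a prime `p`,
the matrix maps `ℤ_p^m` to `ℤ_p^n`; at the real prime, it belongs to `ℤ_ℝ`. -/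
def IsIntegralAt : Place → ∀ {n m : ℕ}, Matrix (Fin n) (Fin m) ℚ → Prop
  | .generic, _, _, _ => True
  | .prime p, _, _, a => haveI : Fact (p : ℕ).Prime := ⟨p.2⟩
      Set.MapsTo (a.map (Rat.cast : ℚ → ℚ_[p])).mulVec
        {z | ∀ i, z i ∈ PadicInt.subring p} {z | ∀ i, z i ∈ PadicInt.subring p}
  | .real, n, m, a => a.map (Rat.cast : ℚ → ℝ) ∈ realInt.carrier n m

/-- `𝔽[±1]_{n,m}`: the `n` by `m` matrices with entries `0`, `1`, `-1` which have at most one nonzero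
entry in each row and in each column. -/
def signedF (n m : ℕ) : Set (Matrix (Fin n) (Fin m) ℤ) :=
  {a | (∀ i j, a i j = 0 ∨ a i j = 1 ∨ a i j = -1) ∧
    (∀ i j j', a i j ≠ 0 → a i j' ≠ 0 → j = j') ∧ ∀ i i' j, a i j ≠ 0 → a i' j ≠ 0 → i = i'}

end PropGeom

end

open PropGeom

noncomputable section

namespace PropGeom

open scoped Topology

/-! ### Sections over the empty set, extensionality of maps -/

/-! All the spaces in question can be described inside the rational matrices. If a prop embeds in
the prop of rational matrices, its denominators outside a prime are nonzero numbers, so every stalk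
of its spectrum embeds there too. The zero ideal lies in every nonempty open set, so a section over
such a set is one rational matrix, subject to one membership condition at each point. `RatModel`
records this description. A map that is the identity on matrices (`Compat`) is then determined by
its effect on points, and commuting diagrams are checked on points.

The arithmetic is contained in one classification. Let `T` be a set of places containing the generic
one, and let `A` be the prop of rational matrices integral at `T`; if `T` contains the real place,
suppose that there are numbers, arbitrarily small in absolute value, that are units at all primes of
`T`. Then the primes of `A` are exactly the sets of elements of absolute value less than one at `v`,
for `v` in `T` (`IntegralModel.exists_place`). Such a set is an ideal by the ultrametric inequality
at a prime, and because contractions compose at the real place (`nm_sum_lt_one`). Conversely, a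
prime containing a `T`-unit `c` must be the real one: an element of absolute value less than one has
a power divisible by `c`. If it contains no `T`-unit, it is determined by the integers it contains
up to `T`-units. These form a prime ideal of the integers, either zero or generated by a prime
number of `T`. Addition is not available in `A`, but sums can be formed after scaling by small
`T`-units.

At the real prime the only elements of `A_{1,1}` outside the ideal are `1` and `-1`, so the stalk is
`A` itself and the only open neighbourhood of that point is the whole spectrum. This dictates the
model `placeSpace J`: all places, with cofinite open sets containing the generic point, and with
every neighbourhood of the real place containing all primes outside `J`. When `J` is the set of
prime divisors of `N`, the spectra of the integers and of the contractions over `ℤ[1/N]` are open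
subspaces covering `placeSpace J`, and they overlap in the spectrum of `ℤ[1/N]`
(`IntegralModel.model_S`, `IntegralModel.isOpenEmbedding_place`). Gluing maps along this overlap
gives the pushout (`isPushout_placeSpace`), and universality of pushouts gives uniqueness of the
system.

The transition maps are the identity on places and on matrices. Only the topology grows with `J`,
and the limit is the case where `J` consists of all primes: an open set of the limit omits finitely
many primes, hence is already open at a finite level (`exists_isOpen_placeTopology`), where its
sections can be pulled back. In the limit every subset of a proper closed set is closed, which gives
dimension one. The global sections are the integral contractions. Testing such a matrix on basis
vectors and on its own rows bounds the sums of squares of all columns and rows by one. -/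

/-- This is the gluing axiom for the empty cover. It disposes of empty preimages, over which there
is no generic point and hence no rational matrix attached to a section. -/
theorem PSpace.uniqueOfEmpty (X : PSpace) {U : Opens X.carrier}
    (hU : ¬ (U : Set X.carrier).Nonempty) (n m : ℕ) : ∃! _t : (X.O U).Hom n m, True := by
  obtain rfl : U = ⨆ i : Empty, (i.elim : Opens X.carrier) := by
    rw [iSup_of_empty]
    exact Opens.ext (by simpa [Set.not_nonempty_iff_eq_empty] using hU)
  obtain ⟨t, -, ht⟩ := X.glue (fun i : Empty => i.elim) n m (fun i => i.elim) (fun i => i.elim)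
  exact ⟨t, trivial, fun y _ => ht y fun i => i.elim⟩

theorem PSpace.eq_of_empty (X : PSpace) {U : Opens X.carrier}
    (hU : ¬ (U : Set X.carrier).Nonempty) {n m : ℕ} (s t : (X.O U).Hom n m) : s = t :=
  (X.uniqueOfEmpty hU n m).unique trivial trivial

/-- The two pull-backs land in sections over preimages that agree only propositionally. Comparing
them through a restriction map avoids a transport along the equality of the bases. -/
theorem LPSpace.hom_ext {X Y : LPSpace} (f g : X ⟶ Y) (hb : f.base = g.base)
    (h : ∀ (U : Opens Y.carrier) (n m : ℕ) (s : (Y.O U).Hom n m),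
      (X.res (hb ▸ le_rfl : Opens.comap f.base U ≤ Opens.comap g.base U)).map ((g.app U).map s) =
        (f.app U).map s) : f = g := by
  obtain ⟨b, α, hα, hα'⟩ := f
  obtain ⟨b', β, hβ, hβ'⟩ := g
  obtain rfl : b = b' := hb
  have : α = β := by
    funext U
    refine PrpHom.ext ?_
    funext n m s
    exact (h U n m s).symm.trans (X.res_self _)
  subst this
  rfl

/-- Factorization of a map of props through an injective map of props. -/
def PrpHom.factor {A B C : Prp} (f : PrpHom A C) (g : PrpHom B C)
    (hf : ∀ n m, Function.Injective (f.map : A.Hom n m → C.Hom n m))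
    (h : ∀ {n m : ℕ} (b : B.Hom n m), ∃ a : A.Hom n m, f.map a = g.map b) : PrpHom B A where
  map b := (h b).choose
  map_comp a b := hf _ _ <| by
    rw [f.map_comp, (h _).choose_spec, (h _).choose_spec, (h _).choose_spec, g.map_comp]
  map_sum a b := hf _ _ <| by
    rw [f.map_sum, (h _).choose_spec, (h _).choose_spec, (h _).choose_spec, g.map_sum]
  map_perm e := hf _ _ <| by rw [(h _).choose_spec, f.map_perm, g.map_perm]

theorem PrpHom.map_factor {A B C : Prp} (f : PrpHom A C) (g : PrpHom B C)
    (hf : ∀ n m, Function.Injective (f.map : A.Hom n m → C.Hom n m))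
    (h : ∀ {n m : ℕ} (b : B.Hom n m), ∃ a : A.Hom n m, f.map a = g.map b) {n m : ℕ}
    (b : B.Hom n m) : f.map ((f.factor g hf h).map b) = g.map b :=
  (h b).choose_spec

/-- The map to a prop all of whose sets of maps have one element. -/
def PrpHom.toTrivial (A : Prp) {B : Prp} (h : ∀ n m : ℕ, ∃! _t : B.Hom n m, True) :
    PrpHom A B where
  map _ := (h _ _).choose
  map_comp _ _ := (h _ _).unique trivial trivial
  map_sum _ _ := (h _ _).unique trivial trivial
  map_perm _ := (h _ _).unique trivial trivial

/-! ### Spaces whose sections are rational matrices -/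

/-- An identification of the sections of a space with sheaf of props, over nonempty open sets, with
the rational matrices that belong to a set `S x` for all points `x`; the sets `S x` are the
stalks. -/
structure RatModel (X : PSpace) where
  S : X.carrier → ∀ n m : ℕ, Set (Matrix (Fin n) (Fin m) ℚ)
  val : ∀ U : Opens X.carrier, (U : Set X.carrier).Nonempty →
    PrpHom (X.O U).toPrp (matPrp ℚ).toPrp
  val_res : ∀ {U V : Opens X.carrier} (h : U ≤ V) (hU : (U : Set X.carrier).Nonempty)
    (hV : (V : Set X.carrier).Nonempty) {n m : ℕ} (s : (X.O V).Hom n m),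
    (val U hU).map ((X.res h).map s) = (val V hV).map s
  val_inj : ∀ (U : Opens X.carrier) (hU : (U : Set X.carrier).Nonempty) (n m : ℕ),
    Function.Injective ((val U hU).map : (X.O U).Hom n m → (matPrp ℚ).Hom n m)
  val_mem : ∀ (U : Opens X.carrier) (hU : (U : Set X.carrier).Nonempty) {n m : ℕ}
    (s : (X.O U).Hom n m) (x : X.carrier), x ∈ U → (val U hU).map s ∈ S x n m
  exists_val : ∀ (U : Opens X.carrier) (hU : (U : Set X.carrier).Nonempty) {n m : ℕ}
    (a : Matrix (Fin n) (Fin m) ℚ), (∀ x ∈ U, a ∈ S x n m) →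
    ∃ s : (X.O U).Hom n m, (val U hU).map s = a
  spread : ∀ (x : X.carrier) {n m : ℕ} (a : Matrix (Fin n) (Fin m) ℚ), a ∈ S x n m →
    ∃ V : Opens X.carrier, x ∈ V ∧ ∀ y ∈ V, a ∈ S y n m

namespace RatModel

/-- A rational number, as a matrix, is invertible in the stalk at `x`. -/
def UnitIn {X : PSpace} (M : RatModel X) (x : X.carrier) (a : Matrix (Fin 1) (Fin 1) ℚ) : Prop :=
  ∃ b ∈ M.S x 1 1, a * b = 1

/-- An inverse in the stalk is again a rational matrix, and `spread` makes it integral on a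
neighbourhood. Thus invertibility of a germ becomes a question about numbers. -/
theorem unitAt_iff {X : PSpace} (M : RatModel X) {U : Opens X.carrier}
    (hU : (U : Set X.carrier).Nonempty) {x : X.carrier} (hx : x ∈ U) (s : (X.O U).Hom 1 1) :
    X.UnitAt x s ↔ M.UnitIn x ((M.val U hU).map s) := by
  constructor
  · rintro ⟨V, h, hV, hu⟩
    obtain ⟨t, ht⟩ := hu.exists_right_inv
    have hV' : (V : Set X.carrier).Nonempty := ⟨x, hV⟩
    refine ⟨(M.val V hV').map t, M.val_mem V hV' t x hV, ?_⟩
    have h1 := congrArg (M.val V hV').map ht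
    rw [PrpHom.map_mul, PrpHom.map_one, M.val_res h hV' hU] at h1
    exact h1.trans (permMat_refl 1)
  · rintro ⟨b, hb, hab⟩
    obtain ⟨V, hV, hb⟩ := M.spread x b hb
    have hW : ((V ⊓ U : Opens X.carrier) : Set X.carrier).Nonempty := ⟨x, hV, hx⟩
    obtain ⟨t, ht⟩ := M.exists_val (V ⊓ U) hW b fun y hy => hb y hy.1
    refine ⟨V ⊓ U, inf_le_right, ⟨hV, hx⟩, .of_mul_eq_one t (M.val_inj _ hW _ _ ?_)⟩
    rw [PrpHom.map_mul, PrpHom.map_one, M.val_res inf_le_right hW hU, ht]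
    exact hab.trans (permMat_refl 1).symm

theorem hom_ext {X W : LPSpace} (M : RatModel X.toPSpace) (f g : X ⟶ W) (hb : f.base = g.base)
    (h : ∀ (U : Opens W.carrier) (hU : (Opens.comap f.base U : Set X.carrier).Nonempty)
      (hU' : (Opens.comap g.base U : Set X.carrier).Nonempty) (n m : ℕ) (s : (W.O U).Hom n m),
      (M.val _ hU).map ((f.app U).map s) = (M.val _ hU').map ((g.app U).map s)) : f = g := by
  refine LPSpace.hom_ext f g hb fun U n m s => ?_
  by_cases hU : (Opens.comap f.base U : Set X.carrier).Nonempty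
  · have hU' : (Opens.comap g.base U : Set X.carrier).Nonempty := by rwa [← hb]
    exact M.val_inj _ hU _ _ ((M.val_res _ hU hU' _).trans (h U hU hU' n m s).symm)
  · exact X.eq_of_empty hU _ _

section mkMap

variable {X W : LPSpace} (M : RatModel X.toPSpace) (base : C(X.carrier, W.carrier))
  (θ : ∀ U : Opens W.carrier, (Opens.comap base U : Set X.carrier).Nonempty →
    PrpHom (W.O U).toPrp (matPrp ℚ).toPrp)
  (θ_res : ∀ {U V : Opens W.carrier} (h : U ≤ V)
    (hU : (Opens.comap base U : Set X.carrier).Nonempty)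
    (hV : (Opens.comap base V : Set X.carrier).Nonempty) {n m : ℕ} (s : (W.O V).Hom n m),
    (θ U hU).map ((W.res h).map s) = (θ V hV).map s)
  (θ_mem : ∀ (U : Opens W.carrier) (hU : (Opens.comap base U : Set X.carrier).Nonempty)
    {n m : ℕ} (s : (W.O U).Hom n m) (x : X.carrier), base x ∈ U → (θ U hU).map s ∈ M.S x n m)
  (θ_local : ∀ (U : Opens W.carrier) (hU : (Opens.comap base U : Set X.carrier).Nonempty)
    (s : (W.O U).Hom 1 1) (x : X.carrier), base x ∈ U → M.UnitIn x ((θ U hU).map s) →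
    W.UnitAt (base x) s)

open Classical in
/-- The pull-back of sections determined by maps to rational matrices. -/
def mkApp (U : Opens W.carrier) : PrpHom (W.O U).toPrp (X.O (Opens.comap base U)).toPrp :=
  if hU : (Opens.comap base U : Set X.carrier).Nonempty then
    (M.val _ hU).factor (θ U hU) (M.val_inj _ hU) fun s =>
      M.exists_val _ hU _ fun x hx => θ_mem U hU s x hx
  else PrpHom.toTrivial _ (X.uniqueOfEmpty hU)

theorem val_mkApp (U : Opens W.carrier) (hU : (Opens.comap base U : Set X.carrier).Nonempty)
    {n m : ℕ} (s : (W.O U).Hom n m) :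
    (M.val _ hU).map ((M.mkApp base θ θ_mem U).map s) = (θ U hU).map s := by
  rw [mkApp, dif_pos hU]
  exact PrpHom.map_factor (M.val _ hU) (θ U hU) (M.val_inj _ hU)
    (fun s => M.exists_val _ hU _ fun x hx => θ_mem U hU s x hx) s

/-- A map from a space of rational matrices, given by a continuous map and by maps of sections to
rational matrices. -/
def mkMap : X ⟶ W where
  base := base
  app := M.mkApp base θ θ_mem
  naturality {U V} h {n m} s := by
    by_cases hU : (Opens.comap base U : Set X.carrier).Nonempty
    · have hV : (Opens.comap base V : Set X.carrier).Nonempty := hU.mono fun x hx => h hx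
      refine M.val_inj _ hU _ _ ?_
      rw [val_mkApp, M.val_res _ hU hV, val_mkApp, θ_res h hU hV]
    · exact X.eq_of_empty hU _ _
  isLocal x U hx s hs h := by
    have hU : (Opens.comap base U : Set X.carrier).Nonempty := ⟨x, hx⟩
    rw [M.unitAt_iff hU hx, val_mkApp] at h
    exact hs (θ_local U hU s x hx h)

end mkMap

/-- A map which is the identity on rational matrices. -/
def Compat {X Y : LPSpace} (M : RatModel X.toPSpace) (N : RatModel Y.toPSpace) (f : X ⟶ Y) :
    Prop :=
  ∀ (U : Opens Y.carrier) (hU : (Opens.comap f.base U : Set X.carrier).Nonempty)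
    (hU' : (U : Set Y.carrier).Nonempty) (n m : ℕ) (s : (Y.O U).Hom n m),
    (M.val _ hU).map ((f.app U).map s) = (N.val _ hU').map s

theorem Compat.comp {X Y Z : LPSpace} {M : RatModel X.toPSpace} {N : RatModel Y.toPSpace}
    {P : RatModel Z.toPSpace} {f : X ⟶ Y} {g : Y ⟶ Z} (hf : M.Compat N f) (hg : N.Compat P g) :
    M.Compat P (f ≫ g) := fun U hU hU' n m s =>
  have h : (Opens.comap g.base U : Set Y.carrier).Nonempty := ⟨f.base hU.some, hU.some_mem⟩
  (hf (Opens.comap g.base U) hU h n m ((g.app U).map s)).trans (hg U h hU' n m s)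

/-- Both maps leave the underlying rational matrix of a section unchanged, so only the points remain
to be compared. Most commuting diagrams below are proved in this way. -/
theorem Compat.ext {X Y : LPSpace} {M : RatModel X.toPSpace} {N : RatModel Y.toPSpace}
    {f g : X ⟶ Y} (hf : M.Compat N f) (hg : M.Compat N g) (hb : f.base = g.base) : f = g :=
  M.hom_ext f g hb fun U hU hU' n m s =>
    have h : (U : Set Y.carrier).Nonempty := ⟨f.base hU.some, hU.some_mem⟩
    (hf U hU h n m s).trans (hg U hU' h n m s).symm

section ofBase

variable {X Y : LPSpace} (M : RatModel X.toPSpace) (N : RatModel Y.toPSpace)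
  (base : C(X.carrier, Y.carrier)) (hS : ∀ x n m, N.S (base x) n m ⊆ M.S x n m)
  (hloc : ∀ x, ∀ a ∈ N.S (base x) 1 1, M.UnitIn x a → N.UnitIn (base x) a)

/-- The map of spaces of rational matrices with given continuous map. -/
def ofBase : X ⟶ Y :=
  M.mkMap base
    (fun U hU => N.val U ⟨base hU.some, hU.some_mem⟩)
    (fun h _ _ _ _ s => N.val_res h _ _ s)
    (fun U _ _ _ s x hx => hS x _ _ (N.val_mem U _ s _ hx))
    (fun _ _ s x hx h => (N.unitAt_iff _ hx s).2 (hloc x _ (N.val_mem _ _ s _ hx) h))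

theorem compat_ofBase : M.Compat N (M.ofBase N base hS hloc) := fun U hU _ _ _ s =>
  M.val_mkApp base _ _ U hU s

end ofBase

/-- Over an open set inside the image, the conditions on a matrix at the points of the target are
implied by those at their preimages, so no section is lost; `Compat` already makes the pull-back
injective. -/
theorem Compat.isOpenImmersion {X Y : LPSpace} {M : RatModel X.toPSpace}
    {N : RatModel Y.toPSpace} {f : X ⟶ Y} (h : M.Compat N f)
    (hf : Topology.IsOpenEmbedding f.base) (hS : ∀ x n m, M.S x n m ⊆ N.S (f.base x) n m) :
    IsOpenImmersion f := by
  refine ⟨hf, fun U hU n m => ?_⟩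
  by_cases hU' : (U : Set Y.carrier).Nonempty
  · have hU'' : (Opens.comap f.base U : Set X.carrier).Nonempty := by
      obtain ⟨y, hy⟩ := hU'
      obtain ⟨x, rfl⟩ := hU hy
      exact ⟨x, hy⟩
    constructor
    · intro s t hst
      refine N.val_inj U hU' _ _ ?_
      rw [← h U hU'' hU', hst, h U hU'' hU']
    · intro t
      obtain ⟨s, hs⟩ := N.exists_val U hU' ((M.val _ hU'').map t) fun y hy => by
        obtain ⟨x, rfl⟩ := hU hy
        exact hS x _ _ (M.val_mem _ hU'' t x hy)
      exact ⟨s, M.val_inj _ hU'' _ _ ((h U hU'' hU' n m s).trans hs)⟩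
  · have hU'' : ¬ (Opens.comap f.base U : Set X.carrier).Nonempty := fun ⟨x, hx⟩ => hU' ⟨_, hx⟩
    exact ⟨fun s t _ => Y.eq_of_empty hU' _ _, fun t =>
      ⟨(Y.uniqueOfEmpty hU' n m).choose, X.eq_of_empty hU'' _ _⟩⟩

end RatModel

/-! ### Absolute values and integrality at the places -/

theorem factPrime (p : Nat.Primes) : Fact (p : ℕ).Prime := ⟨p.2⟩

attribute [local instance] factPrime

/-- Numerator and denominator are coprime: if `p` divides the denominator, the numerator is a
`p`-adic unit and the norm exceeds one. -/
theorem padicNorm_le_one_iff (p : Nat.Primes) (q : ℚ) :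
    padicNorm p q ≤ 1 ↔ ¬ (p : ℕ) ∣ q.den := by
  have hq : padicNorm p q = padicNorm p q.num / padicNorm p q.den := by
    rw [← padicNorm.div, Rat.num_div_den]
  constructor
  · intro h hp
    have h1 : padicNorm p q.den < 1 := (padicNorm.nat_lt_one_iff _).2 hp
    have h2 : padicNorm p q.num = 1 := (padicNorm.int_eq_one_iff _).2 fun h => by
      have h3 : (p : ℕ) ∣ q.num.natAbs := Int.natCast_dvd.1 h
      exact p.2.one_lt.ne' (Nat.dvd_one.1 (q.reduced ▸ Nat.dvd_gcd h3 hp))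
    have h3 : 0 < padicNorm p q.den :=
      (padicNorm.nonneg _).lt_of_ne' (padicNorm.nonzero (by exact_mod_cast q.den_nz))
    rw [hq, h2, div_le_one h3] at h
    exact absurd h1 h.not_gt
  · intro hp
    rw [hq, (padicNorm.nat_eq_one_iff _).2 hp, div_one]
    exact padicNorm.of_int _

theorem finite_setOf_dvd {n : ℕ} (hn : n ≠ 0) : {p : Nat.Primes | (p : ℕ) ∣ n}.Finite :=
  .of_finite_image ((Nat.divisors n).finite_toSet.subset (by
    rintro _ ⟨p, hp, rfl⟩
    simpa using ⟨hp, hn⟩)) Subtype.val_injective.injOn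

theorem finite_padicNorm_ne_one {q : ℚ} (hq : q ≠ 0) :
    {p : Nat.Primes | padicNorm p q ≠ 1}.Finite := by
  refine ((finite_setOf_dvd (Int.natAbs_ne_zero.2 (Rat.num_ne_zero.2 hq))).union
    (finite_setOf_dvd q.den_nz)).subset fun p hp => ?_
  by_contra h
  rw [Set.mem_union, not_or] at h
  refine hp ?_
  rw [← Rat.num_div_den q, padicNorm.div, (padicNorm.nat_eq_one_iff _).2 h.2,
    (padicNorm.int_eq_one_iff _).2 fun h' => h.1 (Int.natCast_dvd.1 h'), div_one]

/-- The normalized absolute values; the one of the generic point is trivial. -/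
def Place.nm : Place → ℚ → ℚ
  | .generic, q => if q = 0 then 0 else 1
  | .prime p, q => padicNorm p q
  | .real, q => |q|

namespace Place

theorem nm_mul (v : Place) (q r : ℚ) : v.nm (q * r) = v.nm q * v.nm r := by
  cases v with
  | generic => by_cases hq : q = 0 <;> by_cases hr : r = 0 <;> simp [nm, hq, hr]
  | prime p => exact padicNorm.mul q r
  | real => exact abs_mul q r

theorem nm_one (v : Place) : v.nm 1 = 1 := by
  cases v <;> simp [nm]

theorem nm_zero (v : Place) : v.nm 0 = 0 := by
  cases v <;> simp [nm]

theorem nm_nonneg (v : Place) (q : ℚ) : 0 ≤ v.nm q := by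
  cases v with
  | generic => by_cases hq : q = 0 <;> simp [nm, hq]
  | prime p => exact padicNorm.nonneg q
  | real => exact abs_nonneg q

end Place

/-- Basis vectors pick out the entries, and conversely the `p`-adic integers form a ring. In
contrast with the real place, integrality at a prime can be read off entry by entry. -/
theorem isIntegralAt_prime_iff (p : Nat.Primes) {n m : ℕ} (a : Matrix (Fin n) (Fin m) ℚ) :
    IsIntegralAt (.prime p) a ↔ ∀ i j, padicNorm p (a i j) ≤ 1 := by
  have key (q : ℚ) : padicNorm p q ≤ 1 ↔ (q : ℚ_[p]) ∈ PadicInt.subring p := by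
    rw [PadicInt.mem_subring_iff, Padic.eq_padicNorm]
    exact_mod_cast Iff.rfl
  simp only [key]
  constructor
  · intro h i j
    have hz : Pi.single j (1 : ℚ_[p]) ∈ {z : Fin m → ℚ_[p] | ∀ i, z i ∈ PadicInt.subring p} := by
      intro k
      by_cases hk : k = j
      · subst hk; simp
      · simp [hk]
    have := h hz i
    simpa [Matrix.mulVec_single_one] using this
  · intro h z hz i
    simp only [Matrix.mulVec, dotProduct]
    exact sum_mem fun j _ => mul_mem (h i j) (hz j)

theorem isIntegralAt_real_iff {n m : ℕ} (a : Matrix (Fin n) (Fin m) ℚ) :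
    IsIntegralAt .real a ↔
      ∀ z : Fin m → ℝ, ∑ i, (∑ j, (a i j : ℝ) * z j) ^ 2 ≤ ∑ j, z j ^ 2 :=
  mapsTo_unitBall_iff _

theorem isIntegralAt_one_iff (v : Place) (a : Matrix (Fin 1) (Fin 1) ℚ) :
    IsIntegralAt v a ↔ v.nm (a 0 0) ≤ 1 := by
  cases v with
  | generic =>
    refine iff_of_true trivial ?_
    by_cases h : a 0 0 = 0 <;> simp [Place.nm, h]
  | prime p => rw [isIntegralAt_prime_iff]; simp [Place.nm]
  | real =>
    rw [isIntegralAt_real_iff]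
    simp only [Fin.sum_univ_one, mul_pow, Place.nm]
    have h1 : |a 0 0| ≤ 1 ↔ (a 0 0 : ℝ) ^ 2 ≤ 1 := by
      rw [sq_le_one_iff_abs_le_one]; exact_mod_cast Iff.rfl
    rw [h1]
    constructor
    · intro h
      simpa using h fun _ => 1
    · intro h z
      exact mul_le_of_le_one_left (sq_nonneg _) h

/-- The sub-prop of the rational matrices which are integral at a place. -/
def intAt (v : Place) : SubPrp (matPrp ℚ) where
  carrier n m := {a : Matrix (Fin n) (Fin m) ℚ | IsIntegralAt v a}
  comp_mem {n m k a b} h h' := by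
    cases v with
    | generic => trivial
    | prime p =>
      refine (isIntegralAt_prime_iff p (Matrix.of a * Matrix.of b)).2 fun i j => ?_
      rw [Matrix.mul_apply]
      refine padicNorm.sum_le' (fun k _ => ?_) zero_le_one
      rw [padicNorm.mul]
      exact mul_le_one₀ ((isIntegralAt_prime_iff p _).1 h i k) (padicNorm.nonneg _)
        ((isIntegralAt_prime_iff p _).1 h' k j)
    | real => exact (realInt.comap (matHom (algebraMap ℚ ℝ))).comp_mem h h'
  sum_mem {n m n' m' a b} h h' := by
    cases v with
    | generic => trivial
    | prime p =>
      let a : Matrix (Fin n) (Fin m) ℚ := a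
      let b : Matrix (Fin n') (Fin m') ℚ := b
      refine (isIntegralAt_prime_iff p (blockSum a b)).2 fun i j => ?_
      have ha := (isIntegralAt_prime_iff p _).1 h
      have hb := (isIntegralAt_prime_iff p _).1 h'
      induction i using Fin.addCases with
      | left i =>
        induction j using Fin.addCases with
        | left j => exact (blockSum_castAdd_castAdd a b i j).symm ▸ ha i j
        | right j => exact (blockSum_castAdd_natAdd a b i j).symm ▸ by simp
      | right i =>
        induction j using Fin.addCases with
        | left j => exact (blockSum_natAdd_castAdd a b i j).symm ▸ by simp
        | right j => exact (blockSum_natAdd_natAdd a b i j).symm ▸ hb i j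
    | real => exact (realInt.comap (matHom (algebraMap ℚ ℝ))).sum_mem h h'
  perm_mem e := by
    cases v with
    | generic => trivial
    | prime p =>
      refine (isIntegralAt_prime_iff p (permMat ℚ e)).2 fun i j => ?_
      simp only [permMat, Matrix.submatrix_apply, Matrix.one_apply]
      split_ifs <;> simp
    | real => exact (realInt.comap (matHom (algebraMap ℚ ℝ))).perm_mem e
  toZero_mem m := by
    cases v with
    | generic => trivial
    | prime p => exact (isIntegralAt_prime_iff p _).2 fun i => i.elim0
    | real => exact (realInt.comap (matHom (algebraMap ℚ ℝ))).toZero_mem m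
  ofZero_mem n := by
    cases v with
    | generic => trivial
    | prime p => exact (isIntegralAt_prime_iff p _).2 fun _ i => i.elim0
    | real => exact (realInt.comap (matHom (algebraMap ℚ ℝ))).ofZero_mem n

/-- This estimate makes the elements of absolute value less than one an ideal, and makes the stalks
of the space of places local. At a prime it is ultrametric. At the real place `p` contracts the
vector with entries `b i * q i 0`, whose length is already less than one. -/
theorem nm_sum_lt_one (v : Place) {n : ℕ} (p : Matrix (Fin 1) (Fin n) ℚ) (b : Fin n → ℚ)
    (q : Matrix (Fin n) (Fin 1) ℚ) (hp : IsIntegralAt v p) (hb : ∀ i, v.nm (b i) < 1)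
    (hq : IsIntegralAt v q) : v.nm (∑ i, p 0 i * (b i * q i 0)) < 1 := by
  cases v with
  | generic =>
    have hb' (i) : b i = 0 := by
      by_contra h
      have := hb i
      simp [Place.nm, h] at this
    simp [Place.nm, hb']
  | prime l =>
    refine padicNorm.sum_lt' (fun i _ => ?_) zero_lt_one
    rw [padicNorm.mul, padicNorm.mul]
    have h1 := (isIntegralAt_prime_iff l _).1 hp 0 i
    have h2 := (isIntegralAt_prime_iff l _).1 hq i 0
    have h3 : padicNorm l (b i) * padicNorm l (q i 0) < 1 :=
      mul_lt_one_of_nonneg_of_lt_one_left (padicNorm.nonneg _) (hb i) h2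
    exact mul_lt_one_of_nonneg_of_lt_one_right h1
      (mul_nonneg (padicNorm.nonneg _) (padicNorm.nonneg _)) h3
  | real =>
    have h1 := (isIntegralAt_real_iff p).1 hp fun i => (b i : ℝ) * q i 0
    have h2 := (isIntegralAt_real_iff q).1 hq fun _ => 1
    simp only [Fin.sum_univ_one, mul_one, one_pow] at h1 h2
    have hb' (i) : (b i : ℝ) ^ 2 < 1 := by
      rw [sq_lt_one_iff_abs_lt_one]; exact_mod_cast hb i
    have h3 : ∑ i, ((b i : ℝ) * q i 0) ^ 2 < 1 := by
      -- Shortening each coordinate of `q` shortens the vector strictly only if some coordinate is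
      -- nonzero; the zero column is treated apart.
      by_cases h : ∀ i, q i 0 = 0
      · simp [h]
      · push Not at h
        obtain ⟨i, hi⟩ := h
        refine lt_of_lt_of_le (Finset.sum_lt_sum (fun j _ => ?_) ⟨i, Finset.mem_univ _, ?_⟩) h2
        · rw [mul_pow]
          exact mul_le_of_le_one_left (sq_nonneg _) (hb' j).le
        · rw [mul_pow]
          refine mul_lt_of_lt_one_left ?_ (hb' i)
          have : (q i 0 : ℝ) ≠ 0 := by exact_mod_cast hi
          positivity
    have h4 : (∑ i, (p 0 i : ℝ) * ((b i : ℝ) * q i 0)) ^ 2 < 1 := h1.trans_lt h3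
    rw [sq_lt_one_iff_abs_lt_one] at h4
    change |_| < _
    exact_mod_cast h4

theorem finite_not_isIntegralAt {n m : ℕ} (a : Matrix (Fin n) (Fin m) ℚ) :
    {p : Nat.Primes | ¬ IsIntegralAt (.prime p) a}.Finite := by
  refine (Set.finite_iUnion fun i : Fin n => Set.finite_iUnion fun j : Fin m =>
    finite_setOf_dvd (a i j).den_nz).subset fun p hp => ?_
  simp only [Set.mem_ofPred_eq, isIntegralAt_prime_iff, padicNorm_le_one_iff] at hp
  push Not at hp
  simpa using hp

/-- By the Cauchy–Schwarz inequality the operator norm is at most the Frobenius norm, so a small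
enough multiple of any matrix is a contraction. -/
theorem exists_isIntegralAt_real_smul {n m : ℕ} (a : Matrix (Fin n) (Fin m) ℚ) :
    ∃ ε : ℚ, 0 < ε ∧ ∀ c : ℚ, |c| < ε → IsIntegralAt .real (c • a) := by
  have hF : 0 ≤ ∑ i, ∑ j, a i j ^ 2 :=
    Finset.sum_nonneg fun i _ => Finset.sum_nonneg fun j _ => sq_nonneg _
  set F := ∑ i, ∑ j, a i j ^ 2 with hF'
  -- The bound `(F + 1)⁻¹` is rational, makes sense for `F = 0`, and gives `c ^ 2 * F ≤ F / (F + 1)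
  -- ^ 2 ≤ 1` without square roots.
  refine ⟨(F + 1)⁻¹, by positivity, fun c hc => (isIntegralAt_real_iff _).2 fun z => ?_⟩
  have h1 : c ^ 2 * F ≤ 1 := by
    have h2 : c ^ 2 ≤ (F + 1)⁻¹ ^ 2 := sq_le_sq' (abs_lt.1 hc).1.le (abs_lt.1 hc).2.le
    calc c ^ 2 * F ≤ (F + 1)⁻¹ ^ 2 * F := by gcongr
      _ ≤ (F + 1)⁻¹ ^ 2 * (F + 1) ^ 2 := by gcongr; nlinarith
      _ = 1 := by field_simp
  have h2 : ((c ^ 2 * F : ℚ) : ℝ) ≤ 1 := by exact_mod_cast h1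
  calc ∑ i, (∑ j, (((c • a) i j : ℚ) : ℝ) * z j) ^ 2
      = (c : ℝ) ^ 2 * ∑ i, (∑ j, (a i j : ℝ) * z j) ^ 2 := by
        rw [Finset.mul_sum]
        refine Finset.sum_congr rfl fun i _ => ?_
        rw [← mul_pow, Finset.mul_sum]
        simp [mul_assoc]
    _ ≤ (c : ℝ) ^ 2 * ∑ i, (∑ j, (a i j : ℝ) ^ 2) * ∑ j, z j ^ 2 := by
        gcongr with i
        exact Finset.sum_mul_sq_le_sq_mul_sq _ _ _
    _ = ((c ^ 2 * F : ℚ) : ℝ) * ∑ j, z j ^ 2 := by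
        rw [← Finset.sum_mul, hF']; push_cast; ring
    _ ≤ ∑ j, z j ^ 2 := mul_le_of_le_one_left (Finset.sum_nonneg fun j _ => sq_nonneg _) h2

/-! ### Diagonal matrices -/

theorem diag_matPrp {R : Type} [CommRing R] : ∀ {n : ℕ} (s : Fin n → (matPrp R).Hom 1 1),
    Prp.diag (A := (matPrp R).toPrp) s =
      Matrix.diagonal fun i => (s i : Matrix (Fin 1) (Fin 1) R) 0 0
  | 0, _ => Matrix.ext fun i => i.elim0
  | n + 1, s => by
    change blockSum (Prp.diag (A := (matPrp R).toPrp) fun i : Fin n => s i.castSucc)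
      (s (Fin.last n)) = _
    rw [diag_matPrp]
    ext i j
    induction i using Fin.lastCases with
    | last =>
      induction j using Fin.lastCases with
      | last => exact (blockSum_natAdd_natAdd _ _ 0 0).trans (by simp)
      | cast j =>
        exact (blockSum_natAdd_castAdd _ _ 0 j).trans (by
          rw [Matrix.diagonal_apply_ne _ (Fin.castSucc_ne_last j).symm])
    | cast i =>
      induction j using Fin.lastCases with
      | last =>
        exact (blockSum_castAdd_natAdd _ _ i 0).trans (by
          rw [Matrix.diagonal_apply_ne _ (Fin.castSucc_ne_last i)])
      | cast j =>
        refine (blockSum_castAdd_castAdd _ _ i j).trans ?_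
        simp [Matrix.diagonal_apply]

theorem comp_diag_comp {R : Type} [CommRing R] {n : ℕ} (p : Matrix (Fin 1) (Fin n) R)
    (s : Fin n → Matrix (Fin 1) (Fin 1) R) (q : Matrix (Fin n) (Fin 1) R) :
    ((matPrp R).comp p ((matPrp R).comp (Prp.diag (A := (matPrp R).toPrp) s) q) :
      Matrix (Fin 1) (Fin 1) R) 0 0 = ∑ i, p 0 i * (s i 0 0 * q i 0) := by
  have h : p * (Matrix.diagonal (fun i => s i 0 0) * q) =
      (matPrp R).comp p ((matPrp R).comp (Prp.diag (A := (matPrp R).toPrp) s) q) :=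
    congrArg (fun d : Matrix (Fin n) (Fin n) R => p * (d * q)) (diag_matPrp s).symm
  rw [← h, Matrix.mul_apply]
  simp [Matrix.diagonal_mul]

theorem smul_matPrp {R : Type} [CommRing R] {n m : ℕ} (s : Matrix (Fin 1) (Fin 1) R)
    (a : Matrix (Fin n) (Fin m) R) : Prp.smul (A := (matPrp R).toPrp) s a = s 0 0 • a := by
  have h : Prp.smul (A := (matPrp R).toPrp) s a = Matrix.diagonal (fun _ => s 0 0) * a :=
    congrArg (fun d : Matrix (Fin n) (Fin n) R => d * a) (diag_matPrp fun _ => s)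
  exact h.trans (Matrix.ext fun i j => Matrix.diagonal_mul _ _ i j)

/-! ### Spectra of props of rational matrices -/

theorem inv_smul_eq_inv_smul_iff_of_ne_zero {n m : ℕ} {s t : ℚ} (hs : s ≠ 0) (ht : t ≠ 0)
    (a b : Matrix (Fin n) (Fin m) ℚ) : s⁻¹ • a = t⁻¹ • b ↔ t • a = s • b := by
  rw [inv_smul_eq_iff₀ hs, smul_comm, eq_inv_smul_iff₀ ht]

section Embedded

variable {A : CPrp} (φ : PrpHom A.toPrp (matPrp ℚ).toPrp)

/-- The rational matrix defined by an element of `A`. -/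
def mat {n m : ℕ} (a : A.Hom n m) : Matrix (Fin n) (Fin m) ℚ := φ.map a

/-- The rational number defined by an element of `A_{1,1}`. -/
def scal (a : A.Hom 1 1) : ℚ := mat φ a 0 0

theorem mat_comp {n m k : ℕ} (a : A.Hom n m) (b : A.Hom m k) :
    mat φ (A.comp a b) = mat φ a * mat φ b := φ.map_comp a b

theorem mat_sum {n m n' m' : ℕ} (a : A.Hom n m) (b : A.Hom n' m') :
    mat φ (A.sum a b) = blockSum (mat φ a) (mat φ b) := φ.map_sum a b

theorem mat_perm {n m : ℕ} (e : Fin m ≃ Fin n) : mat φ (A.perm e) = permMat ℚ e := φ.map_perm e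

theorem mat_smul (s : A.Hom 1 1) {n m : ℕ} (a : A.Hom n m) :
    mat φ (Prp.smul s a) = scal φ s • mat φ a :=
  (φ.map_smul s a).trans (smul_matPrp (mat φ s) (mat φ a))

theorem mat_eq_iff_scal (a : Matrix (Fin 1) (Fin 1) ℚ) (s : A.Hom 1 1) :
    mat φ s = a ↔ scal φ s = a 0 0 := by
  refine ⟨fun h => congrFun (congrFun h 0) 0, fun h => Matrix.ext fun i j => ?_⟩
  rw [Subsingleton.elim i 0, Subsingleton.elim j 0]; exact h

theorem scal_mul (s t : A.Hom 1 1) : scal φ (s * t) = scal φ s * scal φ t := by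
  have h := mat_comp φ s t
  rw [mat_eq_iff_scal] at h
  exact h.trans (by simp [Matrix.mul_apply, scal])

theorem scal_one : scal φ (1 : A.Hom 1 1) = 1 := by
  have h := mat_perm φ (Equiv.refl (Fin 1))
  rw [mat_eq_iff_scal, permMat_refl] at h
  exact h.trans (by simp)

theorem scal_comp_diag_comp {n : ℕ} (p : A.Hom 1 n) (s : Fin n → A.Hom 1 1) (q : A.Hom n 1) :
    scal φ (A.comp p (A.comp (Prp.diag s) q)) =
      ∑ i, mat φ p 0 i * (scal φ (s i) * mat φ q i 0) := by
  have h : φ.map (A.comp p (A.comp (Prp.diag s) q)) = (matPrp ℚ).comp (φ.map p)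
      ((matPrp ℚ).comp (Prp.diag fun i => φ.map (s i)) (φ.map q)) := by
    rw [φ.map_comp, φ.map_comp, φ.map_diag]
  exact (congrArg (fun a : Matrix (Fin 1) (Fin 1) ℚ => a 0 0) h).trans
    (comp_diag_comp (mat φ p) (fun i => mat φ (s i)) (mat φ q))

/-- The zero ideal. -/
def zeroPrime : PrimeIdeal A where
  carrier := {a | scal φ a = 0}
  isIdeal n p a q h := by
    change scal φ _ = 0
    rw [scal_comp_diag_comp]
    exact Finset.sum_eq_zero fun i _ => by rw [h i]; simp
  one_notMem h := by
    change scal φ _ = 0 at h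
    rw [scal_one] at h
    exact one_ne_zero h
  mem_or_mem {a b} h := by
    change scal φ _ = 0 at h
    rw [scal_mul] at h
    exact mul_eq_zero.1 h

variable (hφ : ∀ n m, Function.Injective (φ.map : A.Hom n m → (matPrp ℚ).Hom n m))

include hφ in
theorem scal_inj {a b : A.Hom 1 1} (h : scal φ a = scal φ b) : a = b :=
  hφ _ _ ((mat_eq_iff_scal φ (mat φ b) a).2 h)

-- The ideal condition with no summands puts the element of value zero in every prime. Hence
-- denominators are nonzero, and fractions can be evaluated in the rational numbers.
include hφ in
theorem scal_ne_zero (x : PrimeIdeal A) {s : A.Hom 1 1} (hs : s ∉ x.carrier) : scal φ s ≠ 0 := by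
  intro h
  have h0 := x.isIdeal 0 (A.ofZero 1) (fun i => i.elim0) (A.toZero 1) fun i => i.elim0
  refine hs ?_
  rwa [scal_inj φ hφ (h.trans ?_ :
    _ = scal φ (A.comp (A.ofZero 1) (A.comp (Prp.diag fun i => i.elim0) (A.toZero 1))))]
  rw [scal_comp_diag_comp]
  simp

-- The element of value zero lies in every prime, so a basic open set that is nonempty is defined by
-- an element of nonzero value and contains the zero ideal. The property passes to intersections and
-- unions.
include hφ in
theorem zeroPrime_mem {x : PrimeIdeal A} {U : Set (PrimeIdeal A)} (hU : IsOpen U) (hx : x ∈ U) :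
    zeroPrime φ ∈ U := by
  induction hU with
  | basic s hs =>
    obtain ⟨a, rfl⟩ := hs
    exact scal_ne_zero φ hφ x hx
  | univ => trivial
  | inter s t _ _ h h' => exact ⟨h hx.1, h' hx.2⟩
  | sUnion S _ h =>
    obtain ⟨s, hs, hxs⟩ := hx
    exact ⟨s, hs, h s hs hxs⟩

/-- The embedding of the stalk `A_x` in the prop of rational matrices. -/
def ev (x : PrimeIdeal A) : PrpHom x.stalk.toPrp (matPrp ℚ).toPrp where
  map y := Quotient.liftOn y (fun z => ((scal φ z.2.1)⁻¹ • mat φ z.1 : Matrix (Fin _) (Fin _) ℚ))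
    (by
      rintro ⟨a, s⟩ ⟨b, t⟩ ⟨u, hu⟩
      have h := congrArg (mat φ) hu
      rw [mat_smul, mat_smul, scal_mul, scal_mul] at h
      have hu' := scal_ne_zero φ hφ x u.2
      have hs' := scal_ne_zero φ hφ x s.2
      have ht' := scal_ne_zero φ hφ x t.2
      dsimp only at h ⊢
      rw [mul_smul, mul_smul, smul_right_inj hu'] at h
      exact (inv_smul_eq_inv_smul_iff_of_ne_zero hs' ht' _ _).2 h)
  map_comp y z := by
    induction y using Loc.ind with | _ a s
    induction z using Loc.ind with | _ b t
    change (scal φ (s * t))⁻¹ • mat φ (A.comp a b) =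
      ((scal φ s)⁻¹ • mat φ a) * ((scal φ t)⁻¹ • mat φ b)
    rw [mat_comp, scal_mul, Matrix.smul_mul, Matrix.mul_smul, smul_smul, mul_inv]
  map_sum y z := by
    induction y using Loc.ind with | _ a s
    induction z using Loc.ind with | _ b t
    change (scal φ (s * t))⁻¹ • mat φ (A.sum (Prp.smul t.1 a) (Prp.smul s.1 b)) =
      blockSum ((scal φ s)⁻¹ • mat φ a) ((scal φ t)⁻¹ • mat φ b)
    have hs' := scal_ne_zero φ hφ x s.2
    have ht' := scal_ne_zero φ hφ x t.2
    rw [mat_sum, mat_smul, mat_smul, scal_mul]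
    ext i j
    induction i using Fin.addCases <;> induction j using Fin.addCases <;> simp <;> field_simp
  map_perm e := by
    change (scal φ 1)⁻¹ • mat φ (A.perm e) = _
    rw [scal_one, mat_perm, inv_one, one_smul]
    rfl

theorem ev_frac (x : PrimeIdeal A) {n m : ℕ} (a : A.Hom n m) (s : A.Hom 1 1)
    (hs : s ∉ x.carrier) :
    (ev φ hφ x).map (x.frac a s hs) = ((scal φ s)⁻¹ • mat φ a : Matrix (Fin n) (Fin m) ℚ) := rfl

theorem ev_inj (x : PrimeIdeal A) (n m : ℕ) :
    Function.Injective ((ev φ hφ x).map : x.stalk.Hom n m → (matPrp ℚ).Hom n m) := by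
  intro y z h
  induction y using x.frac_ind with | _ a s hs
  induction z using x.frac_ind with | _ b t ht
  rw [ev_frac, ev_frac] at h
  refine x.frac_eq.2 ⟨1, x.one_notMem, hφ _ _ ?_⟩
  change mat φ _ = mat φ _
  have hs' := scal_ne_zero φ hφ x hs
  have ht' := scal_ne_zero φ hφ x ht
  rw [mat_smul, mat_smul, one_mul, one_mul]
  exact (inv_smul_eq_inv_smul_iff_of_ne_zero hs' ht' _ _).1 h

/-- Near each point the section is a single fraction, and the neighbourhood on which this holds
contains the zero ideal. So all values agree with the value there. -/
theorem ev_section {U : Opens (PrimeIdeal A)} {n m : ℕ} (s : (sections A U).Hom n m)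
    (x : PrimeIdeal A) (hx : x ∈ U) (h0 : zeroPrime φ ∈ U) :
    (ev φ hφ x).map (s.1 x hx) = (ev φ hφ (zeroPrime φ)).map (s.1 _ h0) := by
  obtain ⟨V, -, hV, a, f, H⟩ := s.2 x hx
  have h1 : zeroPrime φ ∈ V := zeroPrime_mem φ hφ V.2 hV
  obtain ⟨hf, e⟩ := H x hV
  obtain ⟨hf', e'⟩ := H _ h1
  rw [e, e', ev_frac, ev_frac]

/-- The sections of the structure sheaf of the spectrum of a prop of rational matrices, as rational
matrices. -/
def specModel : RatModel (spec A).toPSpace where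
  S x n m := Set.range ((ev φ hφ x).map : x.stalk.Hom n m → (matPrp ℚ).Hom n m)
  val U hU := (evalAt (zeroPrime φ) (zeroPrime_mem φ hφ U.2 hU.some_mem)).trans (ev φ hφ _)
  val_res _ _ _ _ _ _ := rfl
  val_inj U hU n m s t h := by
    have h0 : zeroPrime φ ∈ U := zeroPrime_mem φ hφ U.2 hU.some_mem
    refine Subtype.ext (funext₂ fun x hx => ev_inj φ hφ x n m ?_)
    rw [ev_section φ hφ s x hx h0, ev_section φ hφ t x hx h0]
    exact h
  val_mem U hU n m s x hx := ⟨s.1 x hx, ev_section φ hφ s x hx _⟩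
  exists_val U hU n m a ha := by
    choose s hs using ha
    have h0 : zeroPrime φ ∈ U := zeroPrime_mem φ hφ U.2 hU.some_mem
    refine ⟨⟨s, fun x hx => ?_⟩, hs _ h0⟩
    obtain ⟨b, f, hf, e⟩ : ∃ b f hf, s x hx = x.frac b f hf :=
      x.frac_ind (P := fun y => ∃ b f hf, y = x.frac b f hf)
        (fun b f hf => ⟨b, f, hf, rfl⟩) (s x hx)
    -- A fraction representing the matrix at `x` represents it wherever its denominator does not
    -- vanish, because the stalks embed in the rational matrices.
    refine ⟨U ⊓ ⟨PrimeIdeal.basicOpen f, PrimeIdeal.isOpen_basicOpen f⟩, inf_le_left, ⟨hx, hf⟩,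
      b, f, fun y hy => ⟨hy.2, fun hy' => ev_inj φ hφ y n m ?_⟩⟩
    rw [hs y hy', ← hs x hx, e]
    rfl
  spread x n m a ha := by
    obtain ⟨z, rfl⟩ := ha
    induction z using x.frac_ind with | _ b f hf
    exact ⟨⟨PrimeIdeal.basicOpen f, PrimeIdeal.isOpen_basicOpen f⟩, hf, fun y hy =>
      ⟨y.frac b f hy, rfl⟩⟩

theorem mem_specModel_iff (x : PrimeIdeal A) {n m : ℕ} (a : Matrix (Fin n) (Fin m) ℚ) :
    a ∈ (specModel φ hφ).S x n m ↔
      ∃ (b : A.Hom n m) (s : A.Hom 1 1), s ∉ x.carrier ∧ scal φ s • a = mat φ b := by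
  constructor
  · rintro ⟨z, rfl⟩
    induction z using x.frac_ind with | _ b f hf
    exact ⟨b, f, hf, smul_inv_smul₀ (scal_ne_zero φ hφ x hf) (mat φ b)⟩
  · rintro ⟨b, s, hs, h⟩
    refine ⟨x.frac b s hs, ?_⟩
    rw [ev_frac, ← h]
    exact inv_smul_smul₀ (scal_ne_zero φ hφ x hs) a

end Embedded

theorem compat_specMap {A B : CPrp} (φ : PrpHom A.toPrp (matPrp ℚ).toPrp)
    (hφ : ∀ n m, Function.Injective (φ.map : A.Hom n m → (matPrp ℚ).Hom n m))
    (ψ : PrpHom B.toPrp (matPrp ℚ).toPrp)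
    (hψ : ∀ n m, Function.Injective (ψ.map : B.Hom n m → (matPrp ℚ).Hom n m))
    (f : PrpHom A.toPrp B.toPrp)
    (h : ∀ {n m : ℕ} (a : A.Hom n m), ψ.map (f.map a) = φ.map a) :
    (specModel ψ hψ).Compat (specModel φ hφ) (specMap f) := by
  intro U hU hU' n m s
  have h0 : zeroPrime ψ ∈ Opens.comap (specMap f).base U :=
    zeroPrime_mem ψ hψ (Opens.comap (specMap f).base U).2 hU.some_mem
  change (ev ψ hψ _).map ((stalkMap f _).map (s.1 _ h0)) = _
  refine Eq.trans ?_ (ev_section φ hφ s (PrimeIdeal.comap f (zeroPrime ψ)) h0 _)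
  generalize s.1 (PrimeIdeal.comap f (zeroPrime ψ)) h0 = z
  induction z using PrimeIdeal.frac_ind with | _ a t ht
  have h1 : mat ψ (f.map a) = mat φ a := h a
  have h2 : scal ψ (f.map t) = scal φ t := congrFun (congrFun (h t) 0) 0
  rw [ev_frac, ← h1, ← h2]
  rfl

/-! ### Spaces of places -/

/-- The product of a family of props. -/
def piPrp₀ {ι : Type} (A : ι → CPrp) : Prp where
  Hom n m := ∀ i, (A i).Hom n m
  comp a b i := (A i).comp (a i) (b i)
  sum a b i := (A i).sum (a i) (b i)
  perm e i := (A i).perm e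
  toZero m i := (A i).toZero m
  ofZero n i := (A i).ofZero n
  comp_assoc _ _ _ := funext fun i => (A i).comp_assoc _ _ _
  id_comp _ := funext fun i => (A i).id_comp _
  comp_id _ := funext fun i => (A i).comp_id _
  perm_comp _ _ := funext fun i => (A i).perm_comp _ _
  sum_comp _ _ _ _ := funext fun i => (A i).sum_comp _ _ _ _
  sum_perm _ _ := funext fun i => (A i).sum_perm _ _
  sum_assoc _ _ _ := funext fun i => (A i).sum_assoc _ _ _
  sum_zero _ := funext fun i => (A i).sum_zero _
  zero_sum _ := funext fun i => (A i).zero_sum _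
  swap _ _ := funext fun i => (A i).swap _ _
  eq_toZero _ := funext fun i => (A i).eq_toZero _
  eq_ofZero _ := funext fun i => (A i).eq_ofZero _

/-- The product of a family of commutative props. -/
def piPrp {ι : Type} (A : ι → CPrp) : CPrp where
  toPrp := piPrp₀ A
  comm := Prp.IsComm.ofInjective _ A
    (fun i => ⟨fun s => s i, fun _ _ => rfl, fun _ _ => rfl, fun _ => rfl⟩)
    (fun _ _ h => funext h)

/-- The constant functions on a set of places whose value is a rational matrix which is integral at
all these places. -/
def placeSections (U : Set Place) : SubPrp (piPrp fun _ : U => matPrp ℚ) where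
  carrier n m := {s : U → Matrix (Fin n) (Fin m) ℚ |
    (∀ v w, s v = s w) ∧ ∀ v : U, IsIntegralAt v.1 (s v)}
  comp_mem h h' := ⟨fun v w => congrArg₂ (matPrp ℚ).comp (h.1 v w) (h'.1 v w),
    fun v => (intAt v.1).comp_mem (h.2 v) (h'.2 v)⟩
  sum_mem h h' := ⟨fun v w => congrArg₂ (matPrp ℚ).sum (h.1 v w) (h'.1 v w),
    fun v => (intAt v.1).sum_mem (h.2 v) (h'.2 v)⟩
  perm_mem e := ⟨fun _ _ => rfl, fun v => (intAt v.1).perm_mem e⟩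
  toZero_mem m := ⟨fun _ _ => rfl, fun v => (intAt v.1).toZero_mem m⟩
  ofZero_mem n := ⟨fun _ _ => rfl, fun v => (intAt v.1).ofZero_mem n⟩

/-- Restriction to a smaller set of places. -/
def placeRestrict {U V : Set Place} (h : U ⊆ V) :
    PrpHom (placeSections V).toCPrp.toPrp (placeSections U).toCPrp.toPrp where
  map s := ⟨fun v => s.1 ⟨v.1, h v.2⟩, fun _ _ => s.2.1 _ _, fun v => s.2.2 ⟨v.1, h v.2⟩⟩
  map_comp _ _ := rfl
  map_sum _ _ := rfl
  map_perm _ := rfl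

/-- The value of a constant function. -/
def placeValue {U : Set Place} (v : U) :
    PrpHom (placeSections U).toCPrp.toPrp (matPrp ℚ).toPrp where
  map s := s.1 v
  map_comp _ _ := rfl
  map_sum _ _ := rfl
  map_perm _ := rfl

theorem placeValue_eq {U : Set Place} (v w : U) {n m : ℕ}
    (s : (placeSections U).toCPrp.Hom n m) : (placeValue v).map s = (placeValue w).map s :=
  s.2.1 v w

/-- The topology on the places determined by a set `J` of primes: the nonempty open sets contain the
generic point and all but a finite number of the primes; if they contain the real prime, they also
contain all primes outside `J`. -/
@[reducible]
def placeTopology (J : Set Nat.Primes) : TopologicalSpace Place where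
  IsOpen U := U.Nonempty → Place.generic ∈ U ∧ {p | Place.prime p ∉ U}.Finite ∧
    (Place.real ∈ U → ∀ p ∉ J, Place.prime p ∈ U)
  isOpen_univ _ := by simp
  isOpen_inter U V hU hV hUV := by
    obtain ⟨h1, h2, h3⟩ := hU (hUV.mono Set.inter_subset_left)
    obtain ⟨h1', h2', h3'⟩ := hV (hUV.mono Set.inter_subset_right)
    refine ⟨⟨h1, h1'⟩, (h2.union h2').subset fun p hp => ?_, fun hr p hp =>
      ⟨h3 hr.1 p hp, h3' hr.2 p hp⟩⟩
    by_contra h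
    exact hp ⟨not_not.1 fun h' => h (Or.inl h'), not_not.1 fun h' => h (Or.inr h')⟩
  isOpen_sUnion S hS hne := by
    obtain ⟨x, U, hU, hx⟩ := hne
    obtain ⟨h1, h2, -⟩ := hS U hU ⟨x, hx⟩
    refine ⟨⟨U, hU, h1⟩, h2.subset fun p hp h => hp ⟨U, hU, h⟩, ?_⟩
    rintro ⟨V, hV, hr⟩ p hp
    exact ⟨V, hV, (hS V hV ⟨_, hr⟩).2.2 hr p hp⟩

/-- The places with the topology determined by `J` and the sheaf of rational matrices which are
integral at all places of an open set. -/
def placePSpace (J : Set Nat.Primes) : PSpace where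
  carrier := Place
  top := placeTopology J
  O U := (placeSections (@Opens.carrier Place (placeTopology J) U)).toCPrp
  res h := placeRestrict h
  res_self _ := rfl
  res_res _ _ _ _ _ := rfl
  glue {ι} U n m s hs := by
    let _ := placeTopology J
    have hg (i) (v) (hv : v ∈ U i) : Place.generic ∈ U i := ((U i).2 ⟨v, hv⟩).1
    -- Any two nonempty open sets meet in the generic point, so constant functions that agree on
    -- overlaps have the same value everywhere.
    have key (i j) (v w) (hi : v ∈ U i) (hj : w ∈ U j) : (s i).1 ⟨v, hi⟩ = (s j).1 ⟨w, hj⟩ :=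
      ((s i).2.1 _ ⟨.generic, hg i v hi⟩).trans <| Eq.trans
        (congrFun (congrArg Subtype.val (hs i j)) ⟨.generic, hg i v hi, hg j w hj⟩)
        ((s j).2.1 _ _)
    have hex (v : Place) (hv : v ∈ iSup U) : ∃ i, v ∈ U i := Opens.mem_iSup.1 hv
    choose idx hidx using hex
    refine ⟨⟨fun v => (s (idx v.1 v.2)).1 ⟨v.1, hidx _ _⟩, fun v w => key _ _ _ _ _ _,
      fun v => (s (idx v.1 v.2)).2.2 ⟨v.1, hidx _ _⟩⟩, fun i => ?_, fun t ht => ?_⟩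
    · exact Subtype.ext (funext fun v => key _ _ _ _ _ _)
    · refine Subtype.ext (funext fun v => ?_)
      exact congrFun (congrArg Subtype.val (ht (idx v.1 v.2))) ⟨v.1, hidx _ _⟩

theorem isOpen_placePSpace {J : Set Nat.Primes} {U : Set Place} :
    IsOpen[(placePSpace J).top] U ↔ (U.Nonempty → Place.generic ∈ U ∧
      {p | Place.prime p ∉ U}.Finite ∧ (Place.real ∈ U → ∀ p ∉ J, Place.prime p ∈ U)) := Iff.rfl

/-- The stalks of the space of places: rational matrices integral at `v`, and outside `J` if `v` is
the real prime. -/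
def placeStalk (J : Set Nat.Primes) (v : Place) (n m : ℕ) : Set (Matrix (Fin n) (Fin m) ℚ) :=
  {a | IsIntegralAt v a ∧ (v = .real → ∀ p ∉ J, IsIntegralAt (.prime p) a)}

/-- Only finitely many primes divide the denominators of the entries, and the clause of `placeStalk`
at the real place is exactly what the topology demands of its neighbourhoods. -/
theorem isOpen_setOf_mem_placeStalk (J : Set Nat.Primes) {n m : ℕ}
    (a : Matrix (Fin n) (Fin m) ℚ) :
    IsOpen[(placePSpace J).top] {v | a ∈ placeStalk J v n m} :=
  isOpen_placePSpace.2 fun _ => ⟨⟨trivial, by rintro ⟨⟩⟩,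
    (finite_not_isIntegralAt a).subset fun _ hp h => hp ⟨h, by rintro ⟨⟩⟩,
    fun h p hp => ⟨h.2 rfl p hp, by rintro ⟨⟩⟩⟩

/-- Sections on the space of places are rational matrices. -/
def placeModel₀ (J : Set Nat.Primes) : RatModel (placePSpace J) where
  S := placeStalk J
  val U hU := placeValue (U := U.1) ⟨hU.some, hU.some_mem⟩
  val_res _ _ _ _ _ s := s.2.1 _ _
  val_inj U hU n m s t h := Subtype.ext (funext fun v =>
    (s.2.1 v _).trans (Eq.trans h (t.2.1 _ v)))
  val_mem U hU n m s v hv := by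
    have key (w : Place) (hw : w ∈ U) : IsIntegralAt w (s.1 ⟨hU.some, hU.some_mem⟩) := by
      have := s.2.2 ⟨w, hw⟩
      rwa [s.2.1 ⟨w, hw⟩ ⟨hU.some, hU.some_mem⟩] at this
    refine ⟨key v hv, ?_⟩
    -- An open set containing the real place contains all primes outside `J`, whence the additional
    -- integrality conditions in the stalk there.
    rintro rfl p hp
    exact key _ ((isOpen_placePSpace.1 U.2 hU).2.2 hv p hp)
  exists_val U hU n m a ha := ⟨⟨fun _ => a, fun _ _ => rfl, fun v => (ha v.1 v.2).1⟩, rfl⟩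
  spread v n m a ha := ⟨⟨_, isOpen_setOf_mem_placeStalk J a⟩, ha, fun _ h => h⟩

theorem mul_eq_one_iff_fin_one (a b : Matrix (Fin 1) (Fin 1) ℚ) :
    a * b = 1 ↔ a 0 0 * b 0 0 = 1 := by
  constructor
  · intro h
    simpa [Matrix.mul_apply] using congrFun (congrFun h 0) 0
  · intro h
    ext i j
    rw [Subsingleton.elim i 0, Subsingleton.elim j 0]
    simpa [Matrix.mul_apply] using h

/-- The multiplicative absolute value is at most one on the stalk, so a unit must have absolute
value one; the converse requires the inverse to lie in the stalk. -/
theorem placeModel_unitIn_iff (J : Set Nat.Primes) (v : Place) (a : Matrix (Fin 1) (Fin 1) ℚ)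
    (ha : a ∈ placeStalk J v 1 1) : (placeModel₀ J).UnitIn v a ↔ ¬ v.nm (a 0 0) < 1 := by
  have ha1 := (isIntegralAt_one_iff v a).1 ha.1
  change (∃ b ∈ placeStalk J v 1 1, a * b = 1) ↔ _
  constructor
  · rintro ⟨b, hb, hab⟩ h
    rw [mul_eq_one_iff_fin_one] at hab
    have h1 := (isIntegralAt_one_iff v b).1 hb.1
    have h2 := v.nm_mul (a 0 0) (b 0 0)
    rw [hab, v.nm_one] at h2
    have h3 := mul_lt_one_of_nonneg_of_lt_one_left (v.nm_nonneg _) h h1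
    exact h3.ne h2.symm
  · intro h
    have h1 : v.nm (a 0 0) = 1 := le_antisymm ha1 (not_lt.1 h)
    have h0 : a 0 0 ≠ 0 := by
      intro h0; rw [h0, v.nm_zero] at h1; exact zero_ne_one h1
    have h2 : v.nm (a 0 0)⁻¹ = 1 := by
      have := v.nm_mul (a 0 0) (a 0 0)⁻¹
      rw [mul_inv_cancel₀ h0, v.nm_one, h1, one_mul] at this
      exact this.symm
    -- At the real place absolute value one means `1` or `-1`, which is its own inverse; this also
    -- settles integrality at the primes outside `J`.
    by_cases hv : v = .real
    · subst hv
      refine ⟨a, ha, (mul_eq_one_iff_fin_one _ _).2 ?_⟩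
      have : |a 0 0| = 1 := h1
      rw [← abs_mul_abs_self, this, one_mul]
    · refine ⟨fun _ _ => (a 0 0)⁻¹, ⟨(isIntegralAt_one_iff v _).2 h2.le, fun h => absurd h hv⟩,
        (mul_eq_one_iff_fin_one _ _).2 (mul_inv_cancel₀ h0)⟩

theorem mat_placeValue_mem {U : Set Place} (v : U) {n m : ℕ}
    (p : (placeSections U).toCPrp.Hom n m) : IsIntegralAt v.1 (mat (placeValue v) p) := p.2.2 v

theorem placePSpace_unitAt_iff (J : Set Nat.Primes) (v : Place) (U : Set Place)
    (hU : IsOpen[placeTopology J] U) (hv : v ∈ U) (s : (placeSections U).toCPrp.Hom 1 1) :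
    PSpace.UnitAt (placePSpace J) v (U := @Opens.mk Place (placeTopology J) U hU) s ↔
      ¬ v.nm (scal (placeValue ⟨v, hv⟩) s) < 1 := by
  let V : Opens (placePSpace J).carrier := @Opens.mk Place (placeTopology J) U hU
  have hV : (V : Set (placePSpace J).carrier).Nonempty := ⟨v, hv⟩
  refine ((placeModel₀ J).unitAt_iff (U := V) hV hv s).trans ?_
  rw [placeModel_unitIn_iff J v _ ((placeModel₀ J).val_mem V hV s v hv)]
  have : (placeModel₀ J).val V hV = placeValue (U := U) ⟨hV.some, hV.some_mem⟩ := rfl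
  rw [this, placeValue_eq _ ⟨v, hv⟩]
  rfl

/-- The places, as a locally propped space. -/
def placeSpace (J : Set Nat.Primes) : LPSpace where
  toPSpace := placePSpace J
  isLocal v U hv n p a q ha := by
    refine fun h => (placePSpace_unitAt_iff J v U.1 U.2 hv _).1 h ?_
    refine (congrArg v.nm (scal_comp_diag_comp (placeValue (U := U.1) ⟨v, hv⟩) p a q)).trans_lt ?_
    exact nm_sum_lt_one v _ _ _ (mat_placeValue_mem ⟨v, hv⟩ p)
      (fun i => not_not.1 fun h => ha i ((placePSpace_unitAt_iff J v U.1 U.2 hv (a i)).2 h))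
      (mat_placeValue_mem ⟨v, hv⟩ q)

/-- Sections on the space of places are rational matrices. -/
def placeModel (J : Set Nat.Primes) : RatModel (placeSpace J).toPSpace := placeModel₀ J

/-! ### Props of rational matrices which are integral at a set of places -/

/-- An identification of a prop with the prop of rational matrices which are integral at a set `T`
of places; this set has units which are arbitrarily small at the real prime, if `T` contains it. -/
structure IntegralModel (A : CPrp) (T : Set Place) where
  φ : PrpHom A.toPrp (matPrp ℚ).toPrp
  inj : ∀ n m, Function.Injective (φ.map : A.Hom n m → (matPrp ℚ).Hom n m)
  mem : ∀ {n m : ℕ} (a : A.Hom n m), ∀ v ∈ T, IsIntegralAt v (mat φ a)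
  exists_mat : ∀ {n m : ℕ} (a : Matrix (Fin n) (Fin m) ℚ), (∀ v ∈ T, IsIntegralAt v a) →
    ∃ b : A.Hom n m, mat φ b = a
  generic_mem : Place.generic ∈ T
  small : ∀ ε : ℚ, 0 < ε → ∃ c : ℚ, c ≠ 0 ∧
    (∀ p : Nat.Primes, Place.prime p ∈ T → padicNorm p c = 1) ∧ (Place.real ∈ T → |c| < ε)

namespace IntegralModel

variable {A : CPrp} {T : Set Place} (M : IntegralModel A T)

/-- The rational number defined by an element of `A_{1,1}`. -/
abbrev sc (a : A.Hom 1 1) : ℚ := scal M.φ a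

theorem sc_inj {a b : A.Hom 1 1} (h : M.sc a = M.sc b) : a = b := scal_inj M.φ M.inj h

theorem sc_mul (a b : A.Hom 1 1) : M.sc (a * b) = M.sc a * M.sc b := scal_mul M.φ a b

theorem nm_sc_le (a : A.Hom 1 1) {v : Place} (hv : v ∈ T) : v.nm (M.sc a) ≤ 1 :=
  (isIntegralAt_one_iff v _).1 (M.mem a v hv)

theorem exists_sc (q : ℚ) (hq : ∀ v ∈ T, v.nm q ≤ 1) : ∃ a : A.Hom 1 1, M.sc a = q := by
  obtain ⟨b, hb⟩ := M.exists_mat (fun _ _ => q : Matrix (Fin 1) (Fin 1) ℚ)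
    fun v hv => (isIntegralAt_one_iff v _).2 (hq v hv)
  exact ⟨b, (mat_eq_iff_scal _ _ _).1 hb⟩

/-- A rational number which is a unit at all primes of `T`. -/
def IsTUnit (T : Set Place) (c : ℚ) : Prop :=
  c ≠ 0 ∧ ∀ p : Nat.Primes, Place.prime p ∈ T → padicNorm p c = 1

theorem IsTUnit.mul {c d : ℚ} (hc : IsTUnit T c) (hd : IsTUnit T d) : IsTUnit T (c * d) :=
  ⟨mul_ne_zero hc.1 hd.1, fun p hp => by rw [padicNorm.mul, hc.2 p hp, hd.2 p hp, one_mul]⟩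

theorem IsTUnit.inv {c : ℚ} (hc : IsTUnit T c) : IsTUnit T c⁻¹ :=
  ⟨inv_ne_zero hc.1, fun p hp => by
    have := padicNorm.mul (p := p) c c⁻¹
    rw [mul_inv_cancel₀ hc.1, padicNorm.one, hc.2 p hp, one_mul] at this
    exact this.symm⟩

theorem IsTUnit.nm_eq_one {c : ℚ} (hc : IsTUnit T c) {v : Place} (hv : v ∈ T)
    (hv' : v ≠ .real) : v.nm c = 1 := by
  cases v with
  | generic => simp [Place.nm, hc.1]
  | prime p => exact hc.2 p hv
  | real => exact absurd rfl hv'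

theorem isIntegralAt_smul {v : Place} {c : ℚ} (hc : v.nm c ≤ 1) (hv : v ≠ .real) {n m : ℕ}
    {a : Matrix (Fin n) (Fin m) ℚ} (ha : IsIntegralAt v a) : IsIntegralAt v (c • a) := by
  cases v with
  | generic => trivial
  | prime p =>
    rw [isIntegralAt_prime_iff] at ha ⊢
    intro i j
    rw [Matrix.smul_apply, smul_eq_mul, padicNorm.mul]
    exact mul_le_one₀ hc (padicNorm.nonneg _) (ha i j)
  | real => exact absurd rfl hv

-- A small `T`-unit from `small` turns the matrix into a contraction and does not affect integrality
-- at the primes of `T`. So the real condition can always be met at the cost of a `T`-unit.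
include M in
theorem exists_small_mul {n m : ℕ} (a : Matrix (Fin n) (Fin m) ℚ)
    (ha : ∀ p : Nat.Primes, Place.prime p ∈ T → IsIntegralAt (.prime p) a) :
    ∃ (c : A.Hom 1 1) (b : A.Hom n m), IsTUnit T (M.sc c) ∧
      (Place.real ∈ T → |M.sc c| < 1) ∧ mat M.φ b = M.sc c • a := by
  obtain ⟨ε, hε, h⟩ := exists_isIntegralAt_real_smul a
  obtain ⟨c, hc0, hc, hcr⟩ := M.small (min ε 1) (lt_min hε one_pos)
  have hcT : IsTUnit T c := ⟨hc0, hc⟩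
  have hle (v) (hv : v ∈ T) : v.nm c ≤ 1 := by
    by_cases hr : v = .real
    · subst hr; exact ((hcr hv).trans_le (min_le_right _ _)).le
    · exact (hcT.nm_eq_one hv hr).le
  obtain ⟨c', rfl⟩ := M.exists_sc c hle
  obtain ⟨b, hb⟩ := M.exists_mat (M.sc c' • a) fun v hv => by
    cases v with
    | generic => trivial
    | prime p => exact isIntegralAt_smul (hle _ hv) (by rintro ⟨⟩) (ha p hv)
    | real => exact h _ ((hcr hv).trans_le (min_le_left _ _))
  exact ⟨c', b, hcT, fun hr => (hcr hr).trans_le (min_le_right _ _), hb⟩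

include M in
theorem exists_small_mul_sc (q : ℚ) (hq : ∀ p : Nat.Primes, Place.prime p ∈ T →
    padicNorm p q ≤ 1) : ∃ c b : A.Hom 1 1, IsTUnit T (M.sc c) ∧
      (Place.real ∈ T → |M.sc c| < 1) ∧ M.sc b = M.sc c * q := by
  obtain ⟨c, b, h, h', hb⟩ := M.exists_small_mul (fun _ _ => q : Matrix (Fin 1) (Fin 1) ℚ)
    fun p hp => (isIntegralAt_one_iff (.prime p) _).2 (hq p hp)
  exact ⟨c, b, h, h', (mat_eq_iff_scal _ _ _).1 hb⟩

/-- The prime ideal of a place. -/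
def placePrime {v : Place} (hv : v ∈ T) : PrimeIdeal A where
  carrier := {a | v.nm (M.sc a) < 1}
  isIdeal n p a q h := by
    change v.nm (scal M.φ _) < 1
    rw [scal_comp_diag_comp]
    exact nm_sum_lt_one v _ _ _ (M.mem p v hv) h (M.mem q v hv)
  one_notMem h := by
    change v.nm (scal M.φ _) < 1 at h
    rw [scal_one, v.nm_one] at h
    exact lt_irrefl _ h
  mem_or_mem {a b} h := by
    change v.nm (scal M.φ _) < 1 at h
    rw [scal_mul, v.nm_mul] at h
    by_contra h'
    rw [not_or] at h'
    have h1 : 1 ≤ v.nm (M.sc a) := not_lt.1 h'.1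
    have h2 : 1 ≤ v.nm (M.sc b) := not_lt.1 h'.2
    exact h.not_ge (one_le_mul_of_one_le_of_one_le h1 h2)

/-! ### Classification of the prime ideals -/

variable (x : PrimeIdeal A)

theorem mem_of_sc_eq_mul {s a b : A.Hom 1 1} (ha : a ∈ x.carrier)
    (h : M.sc b = M.sc s * M.sc a) : b ∈ x.carrier := by
  rw [M.sc_inj (h.trans (scal_mul M.φ s a).symm)]
  exact x.isIdeal.mul_mem s ha

theorem mem_of_pow_mem {a : A.Hom 1 1} : ∀ k : ℕ, a ^ k ∈ x.carrier → a ∈ x.carrier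
  | 0, h => absurd h (by rw [pow_zero]; exact x.one_notMem)
  | k + 1, h => by
    rw [pow_succ] at h
    exact (x.mem_or_mem h).elim (mem_of_pow_mem k) fun h => h

theorem sc_pow (a : A.Hom 1 1) : ∀ k : ℕ, M.sc (a ^ k) = M.sc a ^ k
  | 0 => by rw [pow_zero, pow_zero]; exact scal_one M.φ
  | k + 1 => by rw [pow_succ, pow_succ, ← sc_pow a k]; exact scal_mul M.φ _ _

/-- The inverse of such a number is integral at all places of `T` and therefore belongs to `A`, so
the prime would contain `1`. -/
theorem notMem_of_nm_eq_one {b : A.Hom 1 1} (hb : b ∈ x.carrier)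
    (h : ∀ v ∈ T, v.nm (M.sc b) = 1) : False := by
  have h0 : M.sc b ≠ 0 := fun h0 => by
    have := h _ M.generic_mem
    simp [h0, Place.nm] at this
  obtain ⟨d, hd⟩ := M.exists_sc (M.sc b)⁻¹ fun v hv => by
    have := v.nm_mul (M.sc b) (M.sc b)⁻¹
    rw [mul_inv_cancel₀ h0, v.nm_one, h v hv, one_mul] at this
    exact this.symm.le
  refine x.one_notMem (M.mem_of_sc_eq_mul x hb (s := d) ?_)
  rw [hd, inv_mul_cancel₀ h0]
  exact scal_one M.φ

/-- A `T`-unit is invertible in `A` unless the real place is in `T`. In that case it fails to be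
invertible only because its inverse is too large, and this obstruction disappears after
multiplication by a high power of any element of absolute value less than one. -/
theorem carrier_eq_of_isTUnit_mem {b : A.Hom 1 1} (hb : b ∈ x.carrier)
    (hbT : IsTUnit T (M.sc b)) :
    Place.real ∈ T ∧ x.carrier = {a | Place.real.nm (M.sc a) < 1} := by
  have hr : Place.real ∈ T := by
    by_contra hr
    refine M.notMem_of_nm_eq_one x hb fun v hv => hbT.nm_eq_one hv ?_
    rintro rfl
    exact hr hv
  refine ⟨hr, Set.ext fun a => ⟨fun ha => ?_, fun ha => ?_⟩⟩
  · change |M.sc a| < 1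
    -- An element of absolute value one is a sign and squares to `1`, so it cannot lie in a prime.
    refine lt_of_le_of_ne (M.nm_sc_le a hr) fun h => ?_
    refine x.one_notMem (M.mem_of_sc_eq_mul x ha (s := a) ?_)
    rw [← abs_mul_abs_self, h, one_mul]
    exact scal_one M.φ
  -- With `|a| ^ k < |b|` the quotient of `a ^ k` by `b` is integral at the real place, and at all
  -- other places of `T` because `b` is a unit there. Hence `a ^ k` is a multiple of `b`.
  · obtain ⟨k, hk⟩ := exists_pow_lt_of_lt_one (abs_pos.2 hbT.1) (show |M.sc a| < 1 from ha)
    obtain ⟨d, hd⟩ := M.exists_sc (M.sc a ^ k * (M.sc b)⁻¹) fun v hv => by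
      by_cases hv' : v = .real
      · subst hv'
        change |_| ≤ _
        rw [abs_mul, abs_inv, abs_pow, ← div_eq_mul_inv]
        exact div_le_one_of_le₀ hk.le (abs_nonneg _)
      · rw [v.nm_mul, hbT.inv.nm_eq_one hv hv', mul_one, ← M.sc_pow]
        exact M.nm_sc_le _ hv
    refine mem_of_pow_mem x k (M.mem_of_sc_eq_mul x hb (s := d) ?_)
    rw [hd, sc_pow, inv_mul_cancel_right₀ hbT.1]

section

variable (hB : ∀ b ∈ x.carrier, ¬ IsTUnit T (M.sc b))

theorem exists_zero_mem : ∃ a ∈ x.carrier, M.sc a = 0 := by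
  obtain ⟨a, ha⟩ := M.exists_sc 0 fun v _ => by rw [v.nm_zero]; exact zero_le_one
  exact ⟨a, not_not.1 fun h => scal_ne_zero M.φ M.inj x h ha, ha⟩

/-- The ideal of all integers which belong to a prime ideal up to a unit. -/
def intIdeal : Ideal ℤ where
  carrier := {m | ∃ c, IsTUnit T c ∧ ∃ a ∈ x.carrier, M.sc a = c * m}
  zero_mem' := by
    obtain ⟨a, ha, h⟩ := M.exists_zero_mem x
    exact ⟨1, ⟨one_ne_zero, fun p _ => padicNorm.one⟩, a, ha, by rw [h]; simp⟩
  add_mem' := by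
    rintro m m' ⟨c, hc, a, ha, h⟩ ⟨c', hc', a', ha', h'⟩
    -- The row `(c', c)` and the column `(1, 1)`, scaled to contractions by `e` and `f`, combine `a`
    -- and `a'` into an element of the ideal with value `e f (c' a + c a') = e f c c' (m + m')`.
    obtain ⟨e, r, he, -, hr⟩ := M.exists_small_mul
      (Matrix.of fun _ i => ![c', c] i : Matrix (Fin 1) (Fin 2) ℚ) fun p hp => by
        rw [isIntegralAt_prime_iff]
        intro _ j
        fin_cases j
        · exact (hc'.2 p hp).le
        · exact (hc.2 p hp).le
    obtain ⟨f, q, hf, -, hq⟩ := M.exists_small_mul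
      (Matrix.of fun _ _ => 1 : Matrix (Fin 2) (Fin 1) ℚ) fun p hp => by
        simp [isIntegralAt_prime_iff]
    refine ⟨M.sc e * M.sc f * (c * c'), (he.mul hf).mul (hc.mul hc'), _,
      x.isIdeal 2 r ![a, a'] q fun i => ?_, ?_⟩
    · fin_cases i
      · exact ha
      · exact ha'
    · refine (scal_comp_diag_comp M.φ r ![a, a'] q).trans ?_
      rw [hr, hq]
      simp only [Fin.sum_univ_two, Matrix.smul_apply, Matrix.of_apply, Matrix.cons_val_zero,
        Matrix.cons_val_one, smul_eq_mul]
      change M.sc e * c' * (M.sc a * (M.sc f * 1)) + M.sc e * c * (M.sc a' * (M.sc f * 1)) = _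
      rw [h, h']
      push_cast
      ring
  smul_mem' := by
    rintro z m ⟨c, hc, a, ha, h⟩
    obtain ⟨e, b, he, -, hb⟩ := M.exists_small_mul_sc z fun p _ => padicNorm.of_int z
    refine ⟨M.sc e * c, he.mul hc, b * a, x.isIdeal.mul_mem b ha, ?_⟩
    rw [M.sc_mul, hb, h, smul_eq_mul]
    push_cast
    ring

-- The hypothesis `hB` keeps `1` out of the ideal. Multiplicativity is inherited from the prime of
-- `A` after both factors are scaled into `A` by `T`-units.
include hB in
theorem isPrime_intIdeal : (M.intIdeal x).IsPrime := by
  refine ⟨fun h => ?_, ?_⟩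
  · obtain ⟨c, hc, a, ha, h⟩ := (Ideal.eq_top_iff_one _).1 h
    refine hB a ha ?_
    rw [h, Int.cast_one, mul_one]
    exact hc
  · rintro m m' ⟨c, hc, a, ha, h⟩
    obtain ⟨e, b, he, -, hb⟩ := M.exists_small_mul_sc m fun p _ => padicNorm.of_int m
    obtain ⟨f, d, hf, -, hd⟩ := M.exists_small_mul_sc (c * m') fun p hp => by
      rw [padicNorm.mul, hc.2 p hp, one_mul]; exact padicNorm.of_int m'
    -- The factor `c` is attached to `m'` so that the product `b * d` has value `e f` times that of
    -- `a`.
    have h1 : b * d ∈ x.carrier := M.mem_of_sc_eq_mul x ha (s := e * f) (by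
      rw [M.sc_mul, M.sc_mul, hb, hd, h]; push_cast; ring)
    rcases x.mem_or_mem h1 with h1 | h1
    · exact Or.inl ⟨_, he, b, h1, hb⟩
    · exact Or.inr ⟨_, hf.mul hc, d, h1, by rw [hd, mul_assoc]⟩

theorem isTUnit_den (a : A.Hom 1 1) : IsTUnit T (M.sc a).den := by
  refine ⟨by exact_mod_cast (M.sc a).den_nz, fun p hp => (padicNorm.nat_eq_one_iff _).2 ?_⟩
  exact (padicNorm_le_one_iff p _).1 (M.nm_sc_le a hp)

-- The denominator of an element of `A` is prime to all primes of `T`, hence a `T`-unit. Passing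
-- between an element and its numerator costs only `T`-units, and these can be cancelled since by
-- `hB` the prime contains none.
include hB in
theorem mem_iff_num_mem_intIdeal (a : A.Hom 1 1) :
    a ∈ x.carrier ↔ (M.sc a).num ∈ M.intIdeal x := by
  have hd := M.isTUnit_den a
  have hnum : ((M.sc a).num : ℚ) = (M.sc a).den * M.sc a := (Rat.den_mul_eq_num _).symm
  constructor
  · intro ha
    obtain ⟨e, b, he, -, hb⟩ := M.exists_small_mul_sc (M.sc a).den fun p hp => (hd.2 p hp).le
    exact ⟨_, he, b * a, x.isIdeal.mul_mem b ha, by rw [M.sc_mul, hb, hnum, mul_assoc]⟩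
  · rintro ⟨c, hc, a', ha', h⟩
    obtain ⟨e, b, he, -, hb⟩ := M.exists_small_mul_sc (c * (M.sc a).den)
      fun p hp => ((hc.mul hd).2 p hp).le
    have h1 : b * a ∈ x.carrier := M.mem_of_sc_eq_mul x ha' (s := e) (by
      rw [M.sc_mul, hb, h, hnum]; ring)
    refine (x.mem_or_mem h1).resolve_left fun h2 => hB b h2 ?_
    rw [hb]
    exact he.mul (hc.mul hd)

end

/-- A prime containing a `T`-unit is the real one. Otherwise it is governed by `intIdeal`, a prime
ideal of a principal ideal domain: zero gives the generic place and a prime number gives its place.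
-/
theorem exists_place : ∃ v ∈ T, x.carrier = {a | v.nm (M.sc a) < 1} := by
  by_cases hB : ∀ b ∈ x.carrier, ¬ IsTUnit T (M.sc b)
  swap
  · push Not at hB
    obtain ⟨b, hb, hbT⟩ := hB
    exact ⟨_, (M.carrier_eq_of_isTUnit_mem x hb hbT).1, (M.carrier_eq_of_isTUnit_mem x hb hbT).2⟩
  have hI := M.isPrime_intIdeal x hB
  obtain ⟨g, hg⟩ := (IsPrincipalIdealRing.principal (M.intIdeal x)).principal
  replace hg : M.intIdeal x = Ideal.span {g} := hg
  by_cases hg0 : g = 0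
  · refine ⟨.generic, M.generic_mem, Set.ext fun a => ?_⟩
    rw [M.mem_iff_num_mem_intIdeal x hB, hg, hg0, Ideal.mem_span_singleton, zero_dvd_iff,
      Rat.num_eq_zero]
    change _ ↔ Place.generic.nm (M.sc a) < 1
    by_cases h : M.sc a = 0 <;> simp [Place.nm, h]
  · have hp : g.natAbs.Prime := by
      rw [← Int.prime_iff_natAbs_prime]
      rw [hg] at hI
      exact (Ideal.span_singleton_prime hg0).1 hI
    obtain ⟨p, hpg⟩ : ∃ p : Nat.Primes, (p : ℕ) = g.natAbs := ⟨⟨_, hp⟩, rfl⟩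
    have hmem (m : ℤ) : m ∈ M.intIdeal x ↔ ((p : ℕ) : ℤ) ∣ m := by
      rw [hg, Ideal.mem_span_singleton, hpg, Int.natAbs_dvd]
    -- If `p` were not in `T` it would be a `T`-unit, and the prime would contain a `T`-unit against
    -- `hB`.
    have hpT : Place.prime p ∈ T := by
      by_contra hpT
      obtain ⟨c, hc, a, ha, h⟩ := (hmem (p : ℕ)).2 dvd_rfl
      refine hB a ha ?_
      rw [h]
      refine hc.mul ⟨by exact_mod_cast p.2.ne_zero, fun q hq => ?_⟩
      rw [Int.cast_natCast]
      refine padicNorm.padicNorm_of_prime_of_ne fun h => hpT ?_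
      rwa [← Subtype.ext h]
    refine ⟨.prime p, hpT, Set.ext fun a => ?_⟩
    rw [M.mem_iff_num_mem_intIdeal x hB, hmem, ← padicNorm.int_lt_one_iff (p := p)]
    change _ ↔ padicNorm p (M.sc a) < 1
    have h1 : padicNorm p (M.sc a) = padicNorm p (M.sc a).num := by
      conv_lhs => rw [← Rat.num_div_den (M.sc a)]
      rw [padicNorm.div, (M.isTUnit_den a).2 p hpT, div_one]
    rw [h1]

/-- The place of a prime ideal. -/
def place : Place := (M.exists_place x).choose

theorem place_mem : M.place x ∈ T := (M.exists_place x).choose_spec.1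

theorem mem_carrier_iff (a : A.Hom 1 1) : a ∈ x.carrier ↔ (M.place x).nm (M.sc a) < 1 :=
  Set.ext_iff.1 (M.exists_place x).choose_spec.2 a

theorem place_injective : Function.Injective M.place := fun x y h =>
  PrimeIdeal.ext (Set.ext fun a => by rw [M.mem_carrier_iff, M.mem_carrier_iff, h])

-- Test elements separate the places: a `T`-unit of absolute value less than one detects the real
-- place, and `p` times a `T`-unit detects the place of `p`.
include M in
theorem place_unique {v w : Place} (hv : v ∈ T) (hw : w ∈ T)
    (h : ∀ a : A.Hom 1 1, v.nm (M.sc a) < 1 ↔ w.nm (M.sc a) < 1) : v = w := by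
  have hreal {v w : Place} (hv : v ∈ T) (hw : w ∈ T)
      (h : ∀ a : A.Hom 1 1, v.nm (M.sc a) < 1 ↔ w.nm (M.sc a) < 1) (hr : v = .real) :
      w = .real := by
    by_contra hwr
    subst hr
    obtain ⟨c, _, hc, hc', -⟩ := M.exists_small_mul_sc 1 fun p _ => by simp
    exact ((h c).1 (hc' hv)).ne (hc.nm_eq_one hw hwr)
  have hprime {v w : Place} (hv : v ∈ T) (hw : w ∈ T)
      (h : ∀ a : A.Hom 1 1, v.nm (M.sc a) < 1 ↔ w.nm (M.sc a) < 1) (hwr : w ≠ .real)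
      (p : Nat.Primes) (hp : v = .prime p) : w = .prime p := by
    by_contra hwp
    subst hp
    obtain ⟨c, b, hc, -, hb⟩ := M.exists_small_mul_sc (p : ℕ) fun q _ => padicNorm.of_nat _
    have h1 := (h b).1 (by
      rw [hb, Place.nm_mul, hc.nm_eq_one hv (by rintro ⟨⟩), one_mul]
      exact padicNorm.padicNorm_p_lt_one_of_prime)
    rw [hb, Place.nm_mul, hc.nm_eq_one hw hwr, one_mul] at h1
    refine h1.ne ?_
    cases w with
    | generic => simp [Place.nm, p.2.ne_zero]
    | prime q =>
      refine padicNorm.padicNorm_of_prime_of_ne fun h => hwp ?_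
      rw [Subtype.ext h]
    | real => exact absurd rfl hwr
  by_cases hvr : v = .real
  · rw [hvr, hreal hv hw h hvr]
  · have hwr : w ≠ .real := fun hwr => hvr (hreal hw hv (fun a => (h a).symm) hwr)
    cases v with
    | prime p => exact (hprime hv hw h hwr p rfl).symm
    | real => exact absurd rfl hvr
    | generic =>
      cases w with
      | generic => rfl
      | prime q => exact hprime hw hv (fun a => (h a).symm) hvr q rfl
      | real => exact absurd rfl hwr

theorem place_eq_iff {v : Place} (hv : v ∈ T) :
    M.place x = v ↔ x.carrier = {a | v.nm (M.sc a) < 1} := by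
  constructor
  · rintro rfl
    exact Set.ext fun a => M.mem_carrier_iff x a
  · intro h
    exact M.place_unique (M.place_mem x) hv fun a => by
      rw [← M.mem_carrier_iff, h]; rfl

theorem place_placePrime {v : Place} (hv : v ∈ T) : M.place (M.placePrime hv) = v :=
  (M.place_eq_iff _ hv).2 rfl

theorem range_place : Set.range M.place = T :=
  Set.ext fun _ => ⟨fun ⟨x, hx⟩ => hx ▸ M.place_mem x, fun hv => ⟨_, M.place_placePrime hv⟩⟩

end IntegralModel

/-! ### Comparison of the spectrum with the space of places. -/

namespace IntegralModel

variable {A : CPrp} {T : Set Place} (M : IntegralModel A T) (J : Set Nat.Primes)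

/-- Sections of the structure sheaf of the spectrum are rational matrices. -/
abbrev model : RatModel (spec A).toPSpace := specModel M.φ M.inj

/-- The product of the denominators of all entries clears them at every prime, and it is a unit at
`v` because each denominator is prime to `v` when the matrix is integral there. -/
theorem exists_nm_eq_one_smul_eq_intCast {v : Place} (hv : v ≠ .real) {n m : ℕ}
    (a : Matrix (Fin n) (Fin m) ℚ) (ha : IsIntegralAt v a) :
    ∃ d : ℕ, v.nm d = 1 ∧ ∀ p : Nat.Primes, IsIntegralAt (.prime p) ((d : ℚ) • a) := by
  refine ⟨∏ i, ∏ j, (a i j).den, ?_, fun p => (isIntegralAt_prime_iff p _).2 fun i j => ?_⟩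
  · cases v with
    | generic =>
      have : ∏ i, ∏ j, ((a i j).den : ℚ) ≠ 0 := by
        simp [Finset.prod_ne_zero_iff]
      simp only [Place.nm, Nat.cast_prod]
      rw [if_neg this]
    | prime p =>
      refine (padicNorm.nat_eq_one_iff _).2 fun h => ?_
      obtain ⟨i, -, h⟩ := (p.2.prime.dvd_finsetProd_iff _).1 h
      obtain ⟨j, -, h⟩ := (p.2.prime.dvd_finsetProd_iff _).1 h
      exact (padicNorm_le_one_iff p _).1 ((isIntegralAt_prime_iff p a).1 ha i j) h
    | real => exact absurd rfl hv
  · obtain ⟨k, hk⟩ : (a i j).den ∣ ∏ i, ∏ j, (a i j).den :=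
      (Finset.dvd_prod_of_mem (fun j => (a i j).den) (Finset.mem_univ j)).trans
        (Finset.dvd_prod_of_mem (fun i => ∏ j, (a i j).den) (Finset.mem_univ i))
    have h : ((∏ i, ∏ j, (a i j).den : ℕ) : ℚ) * a i j = ((k * (a i j).num : ℤ) : ℚ) := by
      rw [hk]
      push_cast
      rw [mul_right_comm, Rat.den_mul_eq_num, mul_comm]
    rw [Matrix.smul_apply, smul_eq_mul, h]
    exact padicNorm.of_int _

variable (hJ : Place.real ∈ T → ∀ p, Place.prime p ∈ T ↔ p ∉ J)

-- At the real place the denominators are signs, so localization adds nothing and the stalk is `A`;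
-- `hJ` identifies its integrality conditions with those of `placeStalk`. At the other places all
-- conditions elsewhere can be removed by denominators that are units at the given place.
include hJ in
theorem model_S (x : PrimeIdeal A) (n m : ℕ) :
    M.model.S x n m = placeStalk J (M.place x) n m := by
  ext a
  refine (mem_specModel_iff M.φ M.inj x a).trans ?_
  have hxT := M.place_mem x
  simp only [M.mem_carrier_iff]
  constructor
  · rintro ⟨b, s, hs, h⟩
    have hs1 : (M.place x).nm (M.sc s) = 1 := le_antisymm (M.nm_sc_le s hxT) (not_lt.1 hs)
    by_cases hr : M.place x = .real
    · rw [hr] at hs1 hxT ⊢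
      have ha : a = mat M.φ (Prp.smul s b) := by
        rw [mat_smul, ← h, smul_smul, ← abs_mul_abs_self, show |scal M.φ s| = 1 from hs1, one_mul,
          one_smul]
      rw [ha]
      exact ⟨M.mem _ _ hxT, fun _ p hp => M.mem _ _ ((hJ hxT p).2 hp)⟩
    · refine ⟨?_, fun h => absurd h hr⟩
      have hs0 : M.sc s ≠ 0 := fun h0 => by
        rw [h0, Place.nm_zero] at hs1; exact zero_ne_one hs1
      have hs2 : (M.place x).nm (M.sc s)⁻¹ ≤ 1 := by
        have := (M.place x).nm_mul (M.sc s) (M.sc s)⁻¹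
        rw [mul_inv_cancel₀ hs0, Place.nm_one, hs1, one_mul] at this
        exact this.symm.le
      rw [← inv_smul_smul₀ hs0 a, h]
      exact isIntegralAt_smul hs2 hr (M.mem b _ hxT)
  · rintro ⟨ha, ha'⟩
    by_cases hr : M.place x = .real
    · rw [hr] at hxT ha
      obtain ⟨b, hb⟩ := M.exists_mat a fun v hv => by
        cases v with
        | generic => trivial
        | prime p => exact ha' hr p ((hJ hxT p).1 hv)
        | real => exact ha
      exact ⟨b, 1, by simp [scal_one, Place.nm_one], by rw [scal_one, one_smul, hb]⟩
    · obtain ⟨d, hd, hda⟩ := exists_nm_eq_one_smul_eq_intCast hr a ha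
      -- Two `T`-units are needed: `e` makes the cleared matrix `d • a` a contraction, and `f`
      -- brings `d` itself into `A`. The fraction is then `f b` over `e g`, where `g` has value `f
      -- d`.
      obtain ⟨e, b, he, -, hb⟩ := M.exists_small_mul ((d : ℚ) • a) fun p _ => hda p
      obtain ⟨f, g, hf, -, hg⟩ := M.exists_small_mul_sc d fun p _ => padicNorm.of_nat d
      refine ⟨Prp.smul f b, e * g, ?_, ?_⟩
      · rw [M.sc_mul, hg, Place.nm_mul, Place.nm_mul, he.nm_eq_one hxT hr, hf.nm_eq_one hxT hr, hd]
        simp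
      · rw [mat_smul, hb]
        refine (congrArg (· • a) ((M.sc_mul e g).trans (congrArg _ hg))).trans ?_
        simp only [smul_smul]
        congr 1
        ring

-- The preimage is empty, everything, or a basic open set, according to whether the real place has
-- to be kept or removed.
include hJ in
theorem isOpen_preimage_place {U : Set Place} (hU : IsOpen[placeTopology J] U) :
    IsOpen (M.place ⁻¹' U) := by
  rcases U.eq_empty_or_nonempty with rfl | hne
  · exact isOpen_empty
  obtain ⟨h1, h2, h3⟩ := hU hne
  by_cases hr : Place.real ∈ U ∧ Place.real ∈ T
  -- The primes of `T` are those outside `J`, all of which belong to `U` together with the real and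
  -- generic places.
  · convert isOpen_univ
    refine Set.eq_univ_of_forall fun x => ?_
    have hx := M.place_mem x
    change M.place x ∈ U
    generalize M.place x = v at hx
    cases v with
    | generic => exact h1
    | prime p => exact h3 hr.1 p ((hJ hr.2 p).1 hx)
    | real => exact hr.1
  · have hq (p : Nat.Primes) : padicNorm p (∏ q ∈ h2.toFinset, (q : ℕ) : ℕ) = 1 ↔
        Place.prime p ∈ U := by
      rw [padicNorm.nat_eq_one_iff, p.2.prime.dvd_finsetProd_iff]
      constructor
      · intro h
        by_contra hp
        exact h ⟨p, by simpa using hp, dvd_rfl⟩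
      · rintro hp ⟨q, hq, hpq⟩
        rw [Nat.prime_dvd_prime_iff_eq p.2 q.2] at hpq
        rw [Subtype.ext hpq] at hp
        simp only [Set.Finite.mem_toFinset, Set.mem_ofPred_eq] at hq
        exact hq hp
    -- The element `c * b` has value `c ^ 2` times the product of the omitted primes. Among the
    -- primes of `T` it fails to be a unit exactly at the omitted ones, and the additional factor
    -- `c` makes it less than one at the real place, which is thereby removed if it is in `T`.
    obtain ⟨c, b, hc, hcr, hb⟩ := M.exists_small_mul_sc (∏ q ∈ h2.toFinset, (q : ℕ) : ℕ)
      fun p _ => padicNorm.of_nat _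
    convert PrimeIdeal.isOpen_basicOpen (c * b)
    ext x
    change M.place x ∈ U ↔ c * b ∉ x.carrier
    rw [M.mem_carrier_iff, M.sc_mul]
    have hx := M.place_mem x
    generalize M.place x = v at hx
    rw [not_lt]
    cases v with
    | generic =>
      refine iff_of_true h1 ?_
      have h0 : M.sc c * M.sc b ≠ 0 := by
        rw [hb]
        refine mul_ne_zero hc.1 (mul_ne_zero hc.1 ?_)
        rw [Nat.cast_ne_zero, Finset.prod_ne_zero_iff]
        exact fun q _ => q.2.ne_zero
      simp [Place.nm, h0]
    | prime p =>
      rw [hb, Place.nm_mul, Place.nm_mul, hc.nm_eq_one hx (by rintro ⟨⟩), one_mul, one_mul, ← hq p]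
      exact ⟨fun h => h.ge, fun h => le_antisymm (padicNorm.of_nat _) h⟩
    | real =>
      refine iff_of_false (fun h => hr ⟨h, hx⟩) ?_
      rw [not_le]
      change |_| < _
      rw [abs_mul]
      exact mul_lt_one_of_nonneg_of_lt_one_left (abs_nonneg _) (hcr hx) (M.nm_sc_le b hx)

/-- The map from the spectrum to the space of places. -/
def toPlaces : spec A ⟶ placeSpace J :=
  M.model.ofBase (placeModel J) ⟨M.place, ⟨fun _ hU => M.isOpen_preimage_place J hJ hU⟩⟩
    (fun x n m => (M.model_S J hJ x n m).ge)
    (fun x _ _ ⟨b, hb, h⟩ => ⟨b, (M.model_S J hJ x 1 1).le hb, h⟩)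

theorem compat_toPlaces : M.model.Compat (placeModel J) (M.toPlaces J hJ) :=
  RatModel.compat_ofBase _ _ _ _ _

-- Finiteness of the omitted primes makes `T` open. It remains to see that basic open sets are
-- traces of open sets of places: a nonzero number is a unit at almost all primes.
include hJ in
theorem isOpenEmbedding_place (hT : {p | Place.prime p ∉ T}.Finite) :
    @Topology.IsOpenEmbedding _ _ (PrimeIdeal.zariski A) (placeTopology J) M.place := by
  have hT' (S : Set Place) (hg : Place.generic ∈ S) (hS : {p | Place.prime p ∉ S}.Finite)
      (hr : Place.real ∈ T → Place.real ∈ S → ∀ p, Place.prime p ∈ T → Place.prime p ∈ S) :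
      IsOpen[placeTopology J] (T ∩ S) := fun _ =>
    ⟨⟨M.generic_mem, hg⟩, (hT.union hS).subset fun p hp => by
      by_contra h
      exact hp ⟨not_not.1 fun h' => h (Or.inl h'), not_not.1 fun h' => h (Or.inr h')⟩,
      fun h p hp => ⟨(hJ h.1 p).2 hp, hr h.1 h.2 p ((hJ h.1 p).2 hp)⟩⟩
  let _ := placeTopology J
  refine ⟨⟨⟨le_antisymm (continuous_iff_le_induced.1
    ⟨fun _ hU => M.isOpen_preimage_place J hJ hU⟩) (le_generateFrom ?_)⟩, M.place_injective⟩, ?_⟩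
  · rintro _ ⟨b, rfl⟩
    by_cases hb : M.sc b = 0
    · convert isOpen_empty
      refine Set.eq_empty_of_forall_notMem fun x (hx : b ∉ x.carrier) => hx ?_
      rw [M.mem_carrier_iff, hb, Place.nm_zero]
      exact one_pos
    refine ⟨T ∩ {v | v.nm (M.sc b) = 1}, hT' _ (if_neg hb) (finite_padicNorm_ne_one hb) ?_, ?_⟩
    -- If the real place is in the set, the number is `1` or `-1` and hence a unit at every prime of
    -- `T`.
    · intro hrT hr p hp
      have hr : |M.sc b| = 1 := hr
      refine le_antisymm (M.nm_sc_le b hp) (not_lt.1 fun h => ?_)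
      have h1 := mul_lt_one_of_nonneg_of_lt_one_left (Place.nm_nonneg _ _) h h.le
      rw [← Place.nm_mul, ← abs_mul_abs_self, hr, one_mul, Place.nm_one] at h1
      exact lt_irrefl _ h1
    · ext x
      change M.place x ∈ T ∩ {v | v.nm (M.sc b) = 1} ↔ b ∉ x.carrier
      rw [M.mem_carrier_iff, not_lt]
      exact ⟨fun h => h.2.ge, fun h => ⟨M.place_mem x, le_antisymm (M.nm_sc_le b (M.place_mem x)) h⟩⟩
  · have := hT' Set.univ trivial (by simp) (fun _ _ _ _ => trivial)
    rwa [Set.inter_univ, ← M.range_place] at this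

theorem isOpenImmersion_toPlaces (hT : {p | Place.prime p ∉ T}.Finite) :
    IsOpenImmersion (M.toPlaces J hJ) :=
  (M.compat_toPlaces J hJ).isOpenImmersion (M.isOpenEmbedding_place J hJ hT)
    fun x n m => (M.model_S J hJ x n m).le

end IntegralModel

/-! ### The props of integers, of fractions, and of fractions which are integral at the real prime -/

/-- All places except the real prime. -/
def finitePlaces : Set Place := {v | v ≠ .real}

/-- All places except the primes in `J`. -/
def placesOff (J : Set Nat.Primes) : Set Place := {v | ∀ p ∈ J, v ≠ .prime p}

theorem prime_mem_finitePlaces (p : Nat.Primes) : Place.prime p ∈ finitePlaces := by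
  rintro ⟨⟩

theorem prime_mem_placesOff {J : Set Nat.Primes} {p : Nat.Primes} :
    Place.prime p ∈ placesOff J ↔ p ∉ J :=
  ⟨fun h hp => h p hp rfl, fun h q hq hpq => h (by cases hpq; exact hq)⟩

theorem real_mem_placesOff (J : Set Nat.Primes) : Place.real ∈ placesOff J := by
  rintro p - ⟨⟩

theorem generic_mem_placesOff (J : Set Nat.Primes) : Place.generic ∈ placesOff J := by
  rintro p - ⟨⟩

theorem matHom_injective {R S : Type} [CommRing R] [CommRing S] (f : R →+* S)
    (hf : Function.Injective f) (n m : ℕ) :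
    Function.Injective ((matHom f).map : (matPrp R).Hom n m → (matPrp S).Hom n m) :=
  fun _ _ h => Matrix.map_injective hf h

theorem exists_int_of_padicNorm_le_one {q : ℚ} (h : ∀ p : Nat.Primes, padicNorm p q ≤ 1) :
    ∃ z : ℤ, (z : ℚ) = q := by
  refine ⟨q.num, (Rat.den_eq_one_iff q).1 (not_not.1 fun hd => ?_)⟩
  obtain ⟨p, hp, hpd⟩ := Nat.exists_prime_and_dvd hd
  exact (padicNorm_le_one_iff ⟨p, hp⟩ q).1 (h _) hpd

/-- The matrices over `ℤ` as rational matrices. -/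
def intModel : IntegralModel (matPrp ℤ) finitePlaces where
  φ := matHom (Int.castRingHom ℚ)
  inj := matHom_injective _ Int.cast_injective
  mem a v hv := by
    cases v with
    | generic => trivial
    | prime p => exact (isIntegralAt_prime_iff p _).2 fun i j => padicNorm.of_int _
    | real => exact absurd rfl hv
  exists_mat {n m} a ha := by
    have h (i j) : ∃ z : ℤ, (z : ℚ) = a i j := exists_int_of_padicNorm_le_one fun p =>
      (isIntegralAt_prime_iff p a).1 (ha _ (prime_mem_finitePlaces p)) i j
    choose z hz using h
    exact ⟨(z : Matrix (Fin n) (Fin m) ℤ), Matrix.ext hz⟩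
  generic_mem := by rintro ⟨⟩
  small ε hε := ⟨1, one_ne_zero, fun p _ => padicNorm.one, fun h => absurd rfl h⟩

theorem PrimeSet.prod_ne_zero (j : PrimeSet) : j.prod ≠ 0 :=
  Finset.prod_ne_zero_iff.2 fun p _ => p.2.ne_zero

theorem PrimeSet.dvd_prod_iff (j : PrimeSet) (p : Nat.Primes) : (p : ℕ) ∣ j.prod ↔ p ∈ j.1 := by
  rw [PrimeSet.prod, p.2.prime.dvd_finsetProd_iff]
  constructor
  · rintro ⟨q, hq, h⟩
    rw [Nat.prime_dvd_prime_iff_eq p.2 q.2] at h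
    rwa [Subtype.ext h]
  · exact fun h => ⟨p, h, dvd_rfl⟩

/-- Induction on the prime factorization: for a prime `p` dividing the product `N`, the inverse of
`p` is an integer multiple of the inverse of `N`. -/
theorem inv_mem_intInv (j : PrimeSet) : ∀ n : ℕ, n ≠ 0 →
    (∀ p : Nat.Primes, (p : ℕ) ∣ n → p ∈ j.1) → ((n : ℚ)⁻¹) ∈ intInv j.prod := by
  refine induction_on_primes (fun h => absurd rfl h) (fun _ _ => by simp) ?_
  intro p n hp ih hn h
  obtain ⟨k, hk⟩ := (j.dvd_prod_iff ⟨p, hp⟩).2 (h ⟨p, hp⟩ (dvd_mul_right _ _))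
  have hk0 : (j.prod : ℚ) ≠ 0 := by exact_mod_cast j.prod_ne_zero
  have hp0 : (p : ℚ) ≠ 0 := by exact_mod_cast hp.ne_zero
  have h1 : ((p * n : ℕ) : ℚ)⁻¹ = (k * (j.prod : ℚ)⁻¹) * (n : ℚ)⁻¹ := by
    rw [hk] at hk0 ⊢
    push_cast at hk0 ⊢
    have hk1 := right_ne_zero_of_mul hk0
    rw [mul_inv, mul_inv]
    field_simp
  rw [h1]
  exact mul_mem (mul_mem (natCast_mem _ k) (Subring.subset_closure rfl))
    (ih (right_ne_zero_of_mul hn) fun q hq => h q (dvd_mul_of_dvd_right hq p))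

theorem mem_intInv_iff (j : PrimeSet) (q : ℚ) :
    q ∈ intInv j.prod ↔ ∀ p : Nat.Primes, p ∉ j.1 → padicNorm p q ≤ 1 := by
  constructor
  · intro hq p hp
    induction hq using Subring.closure_induction with
    | mem x hx =>
      rw [Set.mem_singleton_iff.1 hx, ← one_div, padicNorm.div, padicNorm.one,
        (padicNorm.nat_eq_one_iff _).2 fun h => hp ((j.dvd_prod_iff p).1 h), div_one]
    | zero => simp
    | one => simp
    | add x y _ _ hx hy => exact padicNorm.nonarchimedean.trans (max_le hx hy)
    | neg x _ hx => rwa [padicNorm.neg]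
    | mul x y _ _ hx hy =>
      rw [padicNorm.mul]
      exact mul_le_one₀ hx (padicNorm.nonneg _) hy
  · intro h
    rw [← Rat.num_div_den q, div_eq_mul_inv]
    refine mul_mem (intCast_mem _ _) (inv_mem_intInv j _ q.den_nz fun p hp => ?_)
    by_contra hpj
    exact (padicNorm_le_one_iff p q).1 (h p hpj) hp

theorem isIntegralAt_map_subtype (j : PrimeSet) {n m : ℕ}
    (a : Matrix (Fin n) (Fin m) (intInv j.prod)) (p : Nat.Primes) (hp : p ∉ j.1) :
    IsIntegralAt (.prime p) (a.map (intInv j.prod).subtype) :=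
  (isIntegralAt_prime_iff p _).2 fun i k => (mem_intInv_iff j _).1 (a i k).2 p hp

theorem exists_map_subtype (j : PrimeSet) {n m : ℕ} (a : Matrix (Fin n) (Fin m) ℚ)
    (ha : ∀ p : Nat.Primes, p ∉ j.1 → IsIntegralAt (.prime p) a) :
    ∃ b : Matrix (Fin n) (Fin m) (intInv j.prod), b.map (intInv j.prod).subtype = a :=
  ⟨fun i k => ⟨a i k, (mem_intInv_iff j _).2 fun p hp => (isIntegralAt_prime_iff p a).1
    (ha p hp) i k⟩, rfl⟩

/-- The matrices over `ℤ[1/N]` as rational matrices. -/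
def invModel (j : PrimeSet) :
    IntegralModel (matPrp (intInv j.prod)) (finitePlaces ∩ placesOff j.1) where
  φ := matHom (intInv j.prod).subtype
  inj := matHom_injective _ Subtype.val_injective
  mem a v hv := by
    cases v with
    | generic => trivial
    | prime p => exact isIntegralAt_map_subtype j _ p (prime_mem_placesOff.1 hv.2)
    | real => exact absurd rfl hv.1
  exists_mat a ha := exists_map_subtype j a fun p hp =>
    ha _ ⟨prime_mem_finitePlaces p, prime_mem_placesOff.2 hp⟩
  generic_mem := ⟨intModel.generic_mem, generic_mem_placesOff _⟩
  small ε hε := ⟨1, one_ne_zero, fun p _ => padicNorm.one, fun h => absurd rfl h.1⟩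

/-- The matrices over `ℤ[1/N]` which belong to `ℤ_ℝ` as rational matrices. -/
def invRealModel (j : PrimeSet) : IntegralModel (intInvReal j.prod).toCPrp (placesOff j.1) where
  φ := (intInvReal j.prod).incl.trans (matHom (intInv j.prod).subtype)
  inj n m _ _ h := Subtype.ext ((invModel j).inj n m h)
  mem a v hv := by
    cases v with
    | generic => trivial
    | prime p => exact isIntegralAt_map_subtype j a.1 p (prime_mem_placesOff.1 hv)
    | real => exact a.2
  exists_mat {n m} a ha := by
    obtain ⟨b, rfl⟩ := exists_map_subtype j a fun p hp => ha _ (prime_mem_placesOff.2 hp)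
    exact ⟨⟨b, ha _ (real_mem_placesOff _)⟩, rfl⟩
  generic_mem := generic_mem_placesOff _
  small ε hε := by
    -- The set of primes is nonempty, and powers of the inverse of one of its members `p` are units
    -- at all primes outside the set while tending to zero at the real place.
    obtain ⟨p, hp⟩ := j.2
    have hp1 : (1 : ℚ) < (p : ℕ) := by exact_mod_cast p.2.one_lt
    have hp0 : (0 : ℚ) < (p : ℕ) := one_pos.trans hp1
    obtain ⟨k, hk⟩ := exists_pow_lt_of_lt_one hε (inv_lt_one_of_one_lt₀ hp1)
    refine ⟨((p : ℕ) : ℚ)⁻¹ ^ k, (pow_pos (inv_pos.2 hp0) k).ne', fun q hq => ?_, fun _ => ?_⟩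
    · have hqp : (q : ℕ) ≠ p := fun h => prime_mem_placesOff.1 hq (by
        rw [Subtype.ext h]; exact hp)
      rw [inv_pow, ← one_div, padicNorm.div, padicNorm.one, ← Nat.cast_pow,
        (padicNorm.nat_eq_one_iff _).2, div_one]
      exact fun h => hqp ((Nat.prime_dvd_prime_iff_eq q.2 p.2).1 (q.2.dvd_of_dvd_pow h))
    · rwa [abs_of_nonneg (pow_nonneg (inv_nonneg.2 hp0.le) k)]

/-! ### The prop schemes `X_N` -/

variable (j j' : PrimeSet)

/-- The primes in a finite set. -/
abbrev PrimeSet.toSet (j : PrimeSet) : Set Nat.Primes := (j.1 : Set Nat.Primes)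

/-- The map of the spectrum of `ℤ` to the space of places. -/
def placesInl (J : Set Nat.Primes) : spec (matPrp ℤ) ⟶ placeSpace J :=
  intModel.toPlaces J fun h => absurd rfl h

/-- The map of the spectrum of `ℤ[1/N] ∩ ℤ_ℝ` to the space of places. -/
def placesInr : spec (intInvReal j.prod).toCPrp ⟶ placeSpace j.toSet :=
  (invRealModel j).toPlaces j.toSet fun _ _ => prime_mem_placesOff

theorem isOpenImmersion_placesInl (J : Set Nat.Primes) : IsOpenImmersion (placesInl J) :=
  intModel.isOpenImmersion_toPlaces J _ (by
    convert Set.finite_empty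
    exact Set.eq_empty_of_forall_notMem fun p hp => hp (prime_mem_finitePlaces p))

theorem isOpenImmersion_placesInr : IsOpenImmersion (placesInr j) :=
  (invRealModel j).isOpenImmersion_toPlaces _ _ (j.1.finite_toSet.subset fun _ hp =>
    not_not.1 fun h => hp (prime_mem_placesOff.2 h))

theorem range_placesInl (J : Set Nat.Primes) : Set.range (placesInl J).base = finitePlaces :=
  intModel.range_place

theorem range_placesInr : Set.range (placesInr j).base = placesOff j.toSet :=
  (invRealModel j).range_place

theorem isPropScheme_placeSpace : isPropScheme (placeSpace j.toSet) := by
  intro v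
  by_cases hv : v = Place.real
  · subst hv
    exact ⟨_, placesInr j, isOpenImmersion_placesInr j, by
      rw [range_placesInr]; exact real_mem_placesOff _⟩
  · exact ⟨_, placesInl _, isOpenImmersion_placesInl _, by
      rw [range_placesInl]; exact hv⟩

theorem compat_placesInl (J : Set Nat.Primes) :
    intModel.model.Compat (placeModel J) (placesInl J) := intModel.compat_toPlaces J _

theorem compat_placesInr :
    (invRealModel j).model.Compat (placeModel j.toSet) (placesInr j) :=
  (invRealModel j).compat_toPlaces j.toSet _

theorem compat_intToInv :
    (invModel j).model.Compat intModel.model (specMap (intToInv j.prod)) :=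
  compat_specMap _ _ _ _ _ fun a => Matrix.ext fun i k =>
    map_intCast (intInv j.prod).subtype ((a : Matrix (Fin _) (Fin _) ℤ) i k)

theorem compat_incl :
    (invModel j).model.Compat (invRealModel j).model (specMap (intInvReal j.prod).incl) :=
  compat_specMap _ _ _ _ _ fun _ => rfl

/-- A map that preserves the underlying numbers pulls the ideal of a place back to the ideal of the
same place, so on points it is the inclusion of `T'` in `T`. -/
theorem place_comap {A B : CPrp} {T T' : Set Place} (M : IntegralModel A T)
    (N : IntegralModel B T') (f : PrpHom A.toPrp B.toPrp)
    (h : ∀ a : A.Hom 1 1, N.sc (f.map a) = M.sc a) (hT : T' ⊆ T) (x : PrimeIdeal B) :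
    M.place (PrimeIdeal.comap f x) = N.place x :=
  (M.place_eq_iff _ (hT (N.place_mem x))).2 <| Set.ext fun a => by
    change f.map a ∈ x.carrier ↔ (N.place x).nm (M.sc a) < 1
    rw [N.mem_carrier_iff, h]

theorem place_comap_intToInv (x : PrimeIdeal (matPrp (intInv j.prod))) :
    intModel.place (PrimeIdeal.comap (intToInv j.prod) x) = (invModel j).place x :=
  place_comap intModel (invModel j) (intToInv j.prod) (fun a => map_intCast (intInv j.prod).subtype
    ((a : Matrix (Fin 1) (Fin 1) ℤ) 0 0)) Set.inter_subset_left x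

theorem place_comap_incl (x : PrimeIdeal (matPrp (intInv j.prod))) :
    (invRealModel j).place (PrimeIdeal.comap (intInvReal j.prod).incl x) = (invModel j).place x :=
  place_comap (invRealModel j) (invModel j) (intInvReal j.prod).incl (fun _ => rfl)
    Set.inter_subset_right x

theorem place_zeroPrime {A : CPrp} {T : Set Place} (M : IntegralModel A T) :
    M.place (zeroPrime M.φ) = .generic :=
  (M.place_eq_iff _ M.generic_mem).2 <| Set.ext fun a => by
    change M.sc a = 0 ↔ Place.generic.nm (M.sc a) < 1
    by_cases h : M.sc a = 0 <;> simp [Place.nm, h]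

/-! ### The pushout -/

theorem RatModel.val_app_congr {X W : LPSpace} (M : RatModel X.toPSpace) {f g : X ⟶ W}
    (e : f = g) (U : Opens W.carrier) (hU : (Opens.comap f.base U : Set X.carrier).Nonempty)
    (hU' : (Opens.comap g.base U : Set X.carrier).Nonempty) {n m : ℕ} (s : (W.O U).Hom n m) :
    (M.val _ hU).map ((f.app U).map s) = (M.val _ hU').map ((g.app U).map s) := by
  subst e; rfl

namespace IntegralModel

variable {A : CPrp} {T : Set Place} (M : IntegralModel A T) (J : Set Nat.Primes)
  (hJ : Place.real ∈ T → ∀ p, Place.prime p ∈ T ↔ p ∉ J) {W : LPSpace} (k : spec A ⟶ W)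
  (U : Opens W.carrier) (hU : (Opens.comap k.base U : Set (spec A).carrier).Nonempty)

include hJ in
theorem val_app_mem_placeStalk {n m : ℕ} (s : (W.O U).Hom n m) (x : PrimeIdeal A)
    (hx : k.base x ∈ U) :
    (M.model.val _ hU).map ((k.app U).map s) ∈ placeStalk J (M.place x) n m :=
  (M.model_S J hJ x n m).le (M.model.val_mem _ hU _ x hx)

include hJ in
theorem unitAt_of_unitIn (s : (W.O U).Hom 1 1) (x : PrimeIdeal A) (hx : k.base x ∈ U)
    (h : (placeModel J).UnitIn (M.place x) ((M.model.val _ hU).map ((k.app U).map s))) :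
    W.UnitAt (k.base x) s := by
  obtain ⟨b, hb, hab⟩ := h
  by_contra hs
  exact k.isLocal x U hx s hs ((M.model.unitAt_iff hU hx _).2
    ⟨b, (M.model_S J hJ x 1 1).ge hb, hab⟩)

end IntegralModel

section Pushout

variable (j : PrimeSet) {W : LPSpace}

/-- The two charts cover all points. For sections the chart of the integers suffices, since it
contains the generic point, where the rational matrix of a section can be read off. -/
theorem placeSpace_hom_ext {m m' : placeSpace j.toSet ⟶ W}
    (hl : placesInl j.toSet ≫ m = placesInl j.toSet ≫ m')
    (hr : placesInr j ≫ m = placesInr j ≫ m') : m = m' := by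
  refine (placeModel j.toSet).hom_ext m m' (ContinuousMap.ext fun v => ?_)
    fun U hU hU' n k s => ?_
  · by_cases hv : v = Place.real
    · obtain ⟨y, rfl⟩ : v ∈ Set.range (placesInr j).base := by
        rw [range_placesInr, hv]; exact real_mem_placesOff _
      exact congrArg (fun f : _ ⟶ W => f.base y) hr
    · obtain ⟨y, rfl⟩ : v ∈ Set.range (placesInl j.toSet).base := by
        rw [range_placesInl]; exact hv
      exact congrArg (fun f : _ ⟶ W => f.base y) hl
  · have key (m : placeSpace j.toSet ⟶ W)
        (hU : (Opens.comap m.base U : Set (placeSpace j.toSet).carrier).Nonempty) :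
        (Opens.comap (placesInl j.toSet ≫ m).base U : Set (spec (matPrp ℤ)).carrier).Nonempty := by
      refine ⟨intModel.placePrime intModel.generic_mem, ?_⟩
      change intModel.place _ ∈ Opens.comap m.base U
      rw [intModel.place_placePrime]
      exact ((Opens.comap m.base U).2 hU).1
    rw [← compat_placesInl j.toSet (Opens.comap m.base U) (key m hU) hU,
      ← compat_placesInl j.toSet (Opens.comap m'.base U) (key m' hU') hU']
    exact intModel.model.val_app_congr hl U _ _ s

theorem specMap_comp_placesInl :
    specMap (intToInv j.prod) ≫ placesInl j.toSet =
      specMap (intInvReal j.prod).incl ≫ placesInr j :=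
  ((compat_intToInv j).comp (compat_placesInl _)).ext ((compat_incl j).comp (compat_placesInr j)) <|
    ContinuousMap.ext fun x => (place_comap_intToInv j x).trans (place_comap_incl j x).symm

variable {f : spec (matPrp ℤ) ⟶ W} {g : spec (intInvReal j.prod).toCPrp ⟶ W}
  (hfg : specMap (intToInv j.prod) ≫ f = specMap (intInvReal j.prod).incl ≫ g)

-- A place common to both charts is a place of `ℤ[1/N]`, where the two maps agree by hypothesis.
include hfg in
theorem base_eq_of_place_eq (x : PrimeIdeal (matPrp ℤ))
    (y : PrimeIdeal (intInvReal j.prod).toCPrp)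
    (h : intModel.place x = (invRealModel j).place y) : f.base x = g.base y := by
  have hz : intModel.place x ∈ finitePlaces ∩ placesOff j.toSet :=
    ⟨intModel.place_mem x, h ▸ (invRealModel j).place_mem y⟩
  have h1 : PrimeIdeal.comap (intToInv j.prod) ((invModel j).placePrime hz) = x :=
    intModel.place_injective (by rw [place_comap_intToInv, (invModel j).place_placePrime])
  have h2 : PrimeIdeal.comap (intInvReal j.prod).incl ((invModel j).placePrime hz) = y :=
    (invRealModel j).place_injective (by rw [place_comap_incl, (invModel j).place_placePrime, h])
  have := congrArg (fun f : _ ⟶ W => f.base ((invModel j).placePrime hz)) hfg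
  rw [← h1, ← h2]
  exact this

-- Both matrices can be computed after pulling back to the spectrum of `ℤ[1/N]`, whose generic point
-- maps to the generic points of both charts.
include hfg in
theorem val_app_eq_of_pushout (U : Opens W.carrier)
    (hU : (Opens.comap f.base U : Set (spec (matPrp ℤ)).carrier).Nonempty)
    (hU' : (Opens.comap g.base U :
      Set (spec (intInvReal j.prod).toCPrp).carrier).Nonempty)
    {n m : ℕ} (s : (W.O U).Hom n m) :
    (intModel.model.val _ hU).map ((f.app U).map s) =
      ((invRealModel j).model.val _ hU').map ((g.app U).map s) := by
  have h0 : (Opens.comap (specMap (intToInv j.prod) ≫ f).base U :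
      Set (spec (matPrp (intInv j.prod))).carrier).Nonempty := by
    refine ⟨(invModel j).placePrime (invModel j).generic_mem, ?_⟩
    change PrimeIdeal.comap (intToInv j.prod) _ ∈ Opens.comap f.base U
    have : PrimeIdeal.comap (intToInv j.prod)
        ((invModel j).placePrime (invModel j).generic_mem) = zeroPrime intModel.φ :=
      intModel.place_injective (by
        rw [place_comap_intToInv, (invModel j).place_placePrime, place_zeroPrime])
    rw [this]
    exact zeroPrime_mem _ intModel.inj (Opens.comap f.base U).2 hU.some_mem
  rw [← compat_intToInv j (Opens.comap f.base U) h0 hU,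
    ← compat_incl j (Opens.comap g.base U) (by rw [hfg] at h0; exact h0) hU']
  exact (invModel j).model.val_app_congr hfg U _ _ s

variable (f g) in
open Classical in
/-- The continuous map on the pushout, as a function. -/
def descFun (v : Place) : W.carrier :=
  if hv : v ∈ finitePlaces then f.base (intModel.placePrime hv)
  else g.base ((invRealModel j).placePrime (real_mem_placesOff j.toSet))

theorem descFun_inl (x : PrimeIdeal (matPrp ℤ)) :
    descFun j f g (intModel.place x) = f.base x := by
  rw [descFun, dif_pos (intModel.place_mem x)]
  congr 1
  exact intModel.place_injective (intModel.place_placePrime _)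

include hfg in
theorem descFun_inr (y : PrimeIdeal (intInvReal j.prod).toCPrp) :
    descFun j f g ((invRealModel j).place y) = g.base y := by
  rw [descFun]
  split_ifs with hv
  · exact base_eq_of_place_eq j hfg _ _ (intModel.place_placePrime _)
  · congr 1
    refine (invRealModel j).place_injective ?_
    rw [(invRealModel j).place_placePrime]
    exact (not_not.1 hv).symm

-- The preimage is the union of the images of two open sets under the charts, which are open maps.
include hfg in
theorem isOpen_preimage_descFun {U : Set W.carrier} (hU : IsOpen U) :
    IsOpen[placeTopology j.toSet] (descFun j f g ⁻¹' U) := by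
  have h : descFun j f g ⁻¹' U = (placesInl j.toSet).base '' (f.base ⁻¹' U) ∪
      (placesInr j).base '' (g.base ⁻¹' U) := by
    ext v
    constructor
    · intro hv
      by_cases hr : v = Place.real
      · obtain ⟨y, rfl⟩ : v ∈ Set.range (placesInr j).base := by
          rw [range_placesInr, hr]; exact real_mem_placesOff _
        exact Or.inr ⟨y, Set.mem_of_eq_of_mem (s := U) (descFun_inr j hfg y).symm hv, rfl⟩
      · obtain ⟨y, rfl⟩ : v ∈ Set.range (placesInl j.toSet).base := by
          rw [range_placesInl]; exact hr
        exact Or.inl ⟨y, Set.mem_of_eq_of_mem (s := U) (descFun_inl j (g := g) y).symm hv, rfl⟩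
    · rintro (⟨y, hy, rfl⟩ | ⟨y, hy, rfl⟩)
      · exact Set.mem_of_eq_of_mem (s := U) (descFun_inl j y) hy
      · exact Set.mem_of_eq_of_mem (s := U) (descFun_inr j hfg y) hy
  rw [h]
  exact ((isOpenImmersion_placesInl j.toSet).1.isOpenMap _ (hU.preimage f.base.continuous)).union
    ((isOpenImmersion_placesInr j).1.isOpenMap _ (hU.preimage g.base.continuous))

/-- The continuous map on the pushout. -/
def descBase : C((placeSpace j.toSet).carrier, W.carrier) :=
  ⟨descFun j f g, ⟨fun _ hU => isOpen_preimage_descFun j hfg hU⟩⟩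

theorem nonempty_comap_inl (U : Opens W.carrier)
    (hU : (Opens.comap (descBase j hfg) U : Set (placeSpace j.toSet).carrier).Nonempty) :
    (Opens.comap f.base U : Set (spec (matPrp ℤ)).carrier).Nonempty := by
  have h : descFun j f g Place.generic ∈ U := ((Opens.comap (descBase j hfg) U).2 hU).1
  rw [← intModel.place_placePrime intModel.generic_mem, descFun_inl] at h
  exact ⟨_, h⟩

theorem nonempty_comap_inr (U : Opens W.carrier)
    (hU : (Opens.comap (descBase j hfg) U : Set (placeSpace j.toSet).carrier).Nonempty) :
    (Opens.comap g.base U :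
      Set (spec (intInvReal j.prod).toCPrp).carrier).Nonempty := by
  have h : descFun j f g Place.generic ∈ U := ((Opens.comap (descBase j hfg) U).2 hU).1
  rw [← (invRealModel j).place_placePrime (invRealModel j).generic_mem, descFun_inr j hfg] at h
  exact ⟨_, h⟩

/-- The universal map from the pushout. -/
def placeDesc : placeSpace j.toSet ⟶ W :=
  (placeModel j.toSet).mkMap (descBase j hfg)
    (fun U hU => (f.app U).trans (intModel.model.val _ (nonempty_comap_inl j hfg U hU)))
    (fun {U V} h hU hV n m s =>
      (congrArg (intModel.model.val _ (nonempty_comap_inl j hfg U hU)).map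
        (f.naturality h s)).trans (intModel.model.val_res _ _
          (nonempty_comap_inl j hfg V hV) _))
    (fun U hU n m s v hv => by
      -- The matrix is read on the chart of the integers, which does not see the real place. There
      -- `val_app_eq_of_pushout` replaces it by the matrix from the other chart, whose integrality
      -- is known.
      by_cases hr : v = Place.real
      · obtain ⟨y, rfl⟩ : v ∈ Set.range (placesInr j).base := by
          rw [range_placesInr, hr]; exact real_mem_placesOff _
        have h := (invRealModel j).val_app_mem_placeStalk j.toSet (fun _ _ => prime_mem_placesOff)
          g U (nonempty_comap_inr j hfg U hU) s y (descFun_inr j hfg y ▸ hv)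
        rw [← val_app_eq_of_pushout j hfg U (nonempty_comap_inl j hfg U hU)] at h
        exact h
      · obtain ⟨y, rfl⟩ : v ∈ Set.range (placesInl j.toSet).base := by
          rw [range_placesInl]; exact hr
        exact intModel.val_app_mem_placeStalk j.toSet (fun h => absurd rfl h) f U
          (nonempty_comap_inl j hfg U hU) s y
          (descFun_inl j y ▸ hv))
    (fun U hU s v hv h => by
      by_cases hr : v = Place.real
      · obtain ⟨y, rfl⟩ : v ∈ Set.range (placesInr j).base := by
          rw [range_placesInr, hr]; exact real_mem_placesOff _
        have e : descBase j hfg ((placesInr j).base y) = g.base y := descFun_inr j hfg y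
        rw [PrpHom.trans_map, val_app_eq_of_pushout j hfg U _ (nonempty_comap_inr j hfg U hU)] at h
        rw [e] at hv ⊢
        exact (invRealModel j).unitAt_of_unitIn j.toSet (fun _ _ => prime_mem_placesOff) g U
          _ s y hv h
      · obtain ⟨y, rfl⟩ : v ∈ Set.range (placesInl j.toSet).base := by
          rw [range_placesInl]; exact hr
        have e : descBase j hfg ((placesInl j.toSet).base y) = f.base y := descFun_inl j y
        rw [e] at hv ⊢
        exact intModel.unitAt_of_unitIn j.toSet (fun h => absurd rfl h) f U
          (nonempty_comap_inl j hfg U hU) s y hv h)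

theorem val_placeDesc (U : Opens W.carrier)
    (hU : (Opens.comap (descBase j hfg) U : Set (placeSpace j.toSet).carrier).Nonempty)
    {n m : ℕ} (s : (W.O U).Hom n m) :
    ((placeModel j.toSet).val _ hU).map (((placeDesc j hfg).app U).map s) =
      (intModel.model.val _ (nonempty_comap_inl j hfg U hU)).map ((f.app U).map s) :=
  (placeModel j.toSet).val_mkApp (descBase j hfg) _ _ U hU s

theorem placesInl_comp_placeDesc : placesInl j.toSet ≫ placeDesc j hfg = f := by
  refine intModel.model.hom_ext _ _ (ContinuousMap.ext fun x => descFun_inl j x)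
    fun U hU hU' n m s => ?_
  have h : (Opens.comap (descBase j hfg) U : Set (placeSpace j.toSet).carrier).Nonempty :=
    ⟨_, hU.some_mem⟩
  exact (compat_placesInl j.toSet (Opens.comap (descBase j hfg) U) hU h _ _ _).trans
    (val_placeDesc j hfg U h s)

theorem placesInr_comp_placeDesc : placesInr j ≫ placeDesc j hfg = g := by
  refine (invRealModel j).model.hom_ext _ _ (ContinuousMap.ext fun x => descFun_inr j hfg x)
    fun U hU hU' n m s => ?_
  have h : (Opens.comap (descBase j hfg) U : Set (placeSpace j.toSet).carrier).Nonempty :=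
    ⟨_, hU.some_mem⟩
  exact ((compat_placesInr j (Opens.comap (descBase j hfg) U) hU h _ _ _).trans
    (val_placeDesc j hfg U h s)).trans (val_app_eq_of_pushout j hfg U _ _ s)

end Pushout

theorem isPushout_placeSpace (j : PrimeSet) :
    IsPushout (specMap (intToInv j.prod)) (specMap (intInvReal j.prod).incl)
      (placesInl j.toSet) (placesInr j) :=
  ⟨⟨specMap_comp_placesInl j⟩, ⟨Limits.PushoutCocone.IsColimit.mk _
    (fun s => placeDesc j s.condition)
    (fun s => placesInl_comp_placeDesc j s.condition)
    (fun s => placesInr_comp_placeDesc j s.condition)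
    (fun s _ hl hr => placeSpace_hom_ext j
      (hl.trans (placesInl_comp_placeDesc j s.condition).symm)
      (hr.trans (placesInr_comp_placeDesc j s.condition).symm))⟩⟩

/-! ### The inverse system -/

/-- Enlarging `J` weakens the demand on neighbourhoods of the real place. So the identity on places
is continuous from the larger index to the smaller, the direction of the transition maps. -/
theorem placeTopology_anti {J J' : Set Nat.Primes} (h : J ⊆ J') {U : Set Place}
    (hU : IsOpen[placeTopology J] U) : IsOpen[placeTopology J'] U := fun hne =>
  ⟨(hU hne).1, (hU hne).2.1, fun hr p hp => (hU hne).2.2 hr p fun hp' => hp (h hp')⟩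

/-- The map of spaces of places which is the identity on points and on sections. -/
def placeMap {J J' : Set Nat.Primes} (h : J ⊆ J') : placeSpace J' ⟶ placeSpace J where
  base := ⟨fun v => v, ⟨fun _ hU => placeTopology_anti h hU⟩⟩
  app _ := PrpHom.id _
  naturality _ _ _ _ := rfl
  isLocal v U hv s hs h' := hs <| (placePSpace_unitAt_iff J v U.1 U.2 hv s).2
    ((placePSpace_unitAt_iff J' v U.1 (placeTopology_anti h U.2) hv s).1 h')

theorem compat_placeMap {J J' : Set Nat.Primes} (h : J ⊆ J') :
    (placeModel J').Compat (placeModel J) (placeMap h) := fun _ _ _ _ _ s => s.2.1 _ _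

/-- The system of the spaces of places. -/
def placeSystem : PrimeSetᵒᵖ ⥤ PSch where
  obj j := ⟨placeSpace j.unop.toSet, isPropScheme_placeSpace j.unop⟩
  map {j j'} f := ⟨placeMap (J := j'.unop.toSet) (J' := j.unop.toSet)
    fun _ hp => leOfHom f.unop hp⟩

theorem placesInl_comp_placeMap {J J' : Set Nat.Primes} (h : J ⊆ J') :
    placesInl J' ≫ placeMap h = placesInl J :=
  ((compat_placesInl J').comp (compat_placeMap h)).ext (compat_placesInl J) <|
    ContinuousMap.ext fun _ => rfl

theorem incl_map_intInvRealMap {M N : ℕ} (h : intInv M ≤ intInv N) {n m : ℕ}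
    (a : (intInvReal M).toCPrp.Hom n m) :
    ((intInvReal N).incl.trans (matHom (intInv N).subtype)).map ((intInvRealMap h).map a) =
      ((intInvReal M).incl.trans (matHom (intInv M).subtype)).map a := by
  have e : (intInv N).subtype.comp (Subring.inclusion h) = (intInv M).subtype :=
    RingHom.ext fun x => Subring.coe_inclusion h x
  rw [PrpHom.trans_map, PrpHom.trans_map, ← e]
  exact matHom_matHom (Subring.inclusion h) (intInv N).subtype ((intInvReal M).incl.map a)

theorem map_intInvRealMap {j j' : PrimeSet} (h : intInv j.prod ≤ intInv j'.prod) {n m : ℕ}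
    (a : (intInvReal j.prod).toCPrp.Hom n m) :
    (invRealModel j').φ.map ((intInvRealMap h).map a) = (invRealModel j).φ.map a :=
  incl_map_intInvRealMap h a

theorem place_comap_intInvRealMap {j j' : PrimeSet} (h : j ≤ j')
    (x : PrimeIdeal (intInvReal j'.prod).toCPrp) :
    (invRealModel j).place (PrimeIdeal.comap
      (intInvRealMap (PrimeSet.intInv_le h)) x) = (invRealModel j').place x :=
  place_comap (invRealModel j) (invRealModel j') _
    (fun a => congrFun (congrFun (map_intInvRealMap (PrimeSet.intInv_le h) a) 0) 0)
    (fun _ hv p hp => hv p (h hp)) x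

theorem compat_intInvRealMap {j j' : PrimeSet} (h : j ≤ j') :
    (invRealModel j').model.Compat (invRealModel j).model
      (specMap (intInvRealMap (PrimeSet.intInv_le h))) :=
  compat_specMap _ _ _ _ _ fun a => map_intInvRealMap (PrimeSet.intInv_le h) a

theorem placesInr_comp_placeMap {j j' : PrimeSet} (h : j ≤ j') (hs : j.toSet ⊆ j'.toSet) :
    placesInr j' ≫ placeMap hs =
      specMap (intInvRealMap (PrimeSet.intInv_le h)) ≫ placesInr j := by
  have hb : (placesInr j' ≫ placeMap hs).base =
      (specMap (intInvRealMap (PrimeSet.intInv_le h)) ≫ placesInr j).base :=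
    ContinuousMap.ext fun x => (place_comap_intInvRealMap h x).symm
  exact ((compat_placesInr j').comp (compat_placeMap hs)).ext
    ((compat_intInvRealMap h).comp (compat_placesInr j)) hb

/-- The compactified spectrum of `ℤ`. -/
def compactSpecZ : CompactSpecZ where
  sys := placeSystem
  inl j := placesInl j.toSet
  inr j := placesInr j
  isPushout := isPushout_placeSpace
  inl_map {_ _} h := placesInl_comp_placeMap h
  inr_map {_ _} h := placesInr_comp_placeMap h h

/-! ### Uniqueness -/

namespace CompactSpecZ

variable (X Y Z : CompactSpecZ)

/-- The map of members of two systems given by the universal property of the pushout. -/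
def compare (j : PrimeSet) : (X.sys.obj (.op j)).obj ⟶ (Y.sys.obj (.op j)).obj :=
  (X.isPushout j).desc (Y.inl j) (Y.inr j) (Y.isPushout j).w

theorem inl_compare (j : PrimeSet) : X.inl j ≫ X.compare Y j = Y.inl j :=
  (X.isPushout j).inl_desc _ _ _

theorem inr_compare (j : PrimeSet) : X.inr j ≫ X.compare Y j = Y.inr j :=
  (X.isPushout j).inr_desc _ _ _

theorem compare_comp (j : PrimeSet) : X.compare Y j ≫ Y.compare Z j = X.compare Z j :=
  (X.isPushout j).hom_ext
    (by rw [← Category.assoc, inl_compare, inl_compare, inl_compare])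
    (by rw [← Category.assoc, inr_compare, inr_compare, inr_compare])

theorem compare_self (j : PrimeSet) : X.compare X j = 𝟙 _ :=
  (X.isPushout j).hom_ext
    (by rw [inl_compare, Category.comp_id]) (by rw [inr_compare, Category.comp_id])

/-- Both composites start at a pushout and agree on its two charts, so the comparison maps are
automatically compatible with the transition maps. -/
theorem compare_naturality {j j' : PrimeSet} (h : j ≤ j') :
    (X.sys.map (homOfLE h).op).hom ≫ X.compare Y j =
      X.compare Y j' ≫ (Y.sys.map (homOfLE h).op).hom :=
  (X.isPushout j').hom_ext
    (by rw [← Category.assoc, X.inl_map, inl_compare, ← Category.assoc, inl_compare, Y.inl_map])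
    (by rw [← Category.assoc, X.inr_map, Category.assoc, inr_compare, ← Category.assoc,
      inr_compare, Y.inr_map])

/-- The comparison map of pro-objects. -/
def proCompare : X.pro ⟶ Y.pro where
  comp j := Quot.mk _ ⟨j, ⟨X.compare Y j⟩⟩
  compat h := Eq.symm <| Quot.sound ⟨h, ObjectProperty.hom_ext _
    (X.compare_naturality Y h).symm⟩

theorem proCompare_comp : X.proCompare Y ≫ Y.proCompare X = 𝟙 X.pro :=
  PreCat.Map.ext (funext fun j => congrArg (fun f : X.sys.obj (.op j) ⟶ X.sys.obj (.op j) =>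
    (Quot.mk _ ⟨j, f⟩ : X.pro.ColimHom (X.pro.sys.obj (.op j))))
    (ObjectProperty.hom_ext _ ((X.compare_comp Y X j).trans (X.compare_self j))))

/-- Two systems with the same pushouts are isomorphic. -/
def proIso : X.pro ≅ Y.pro where
  hom := X.proCompare Y
  inv := Y.proCompare X
  hom_inv_id := X.proCompare_comp Y
  inv_hom_id := Y.proCompare_comp X

end CompactSpecZ

/-! ### The limit -/

/-- Every open set of the limit topology is open at a finite level. -/
theorem exists_isOpen_placeTopology {U : Set Place} (hU : IsOpen[placeTopology Set.univ] U) :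
    ∃ j : PrimeSet, IsOpen[placeTopology j.toSet] U := by
  classical
  by_cases hne : U.Nonempty
  · obtain ⟨h1, h2, -⟩ := hU hne
    -- Taking the omitted primes into `J` leaves all primes outside `J` in `U`; the prime `2` is
    -- added only to make the index nonempty.
    refine ⟨⟨insert ⟨2, Nat.prime_two⟩ h2.toFinset, Finset.insert_nonempty _ _⟩,
      fun _ => ⟨h1, h2, fun _ p hp => ?_⟩⟩
    by_contra h
    exact hp (Finset.mem_coe.2 (Finset.mem_insert_of_mem (h2.mem_toFinset.2 h)))
  · exact ⟨⟨{⟨2, Nat.prime_two⟩}, Finset.singleton_nonempty _⟩, fun h => absurd h hne⟩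

theorem PSpace.UnitAt.of_res {X : PSpace} {x : X.carrier} {U V : Opens X.carrier} {h : V ≤ U}
    {s : (X.O U).Hom 1 1} (hs : X.UnitAt x ((X.res h).map s)) : X.UnitAt x s := by
  obtain ⟨W, hW, hx, hu⟩ := hs
  rw [X.res_res] at hu
  exact ⟨W, hW.trans h, hx, hu⟩

section pull

variable {W : LPSpace} {J J' : Set Nat.Primes}

/-- The pull-back of sections over `U`, restricted to an open set which is mapped to `U`. -/
def pull (g : W ⟶ placeSpace J) (U : Set Place) (hU : IsOpen[placeTopology J] U)
    (V : Opens W.carrier) (hV : ∀ x ∈ V, g.base x ∈ U) :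
    PrpHom (placeSections U).toCPrp.toPrp (W.O V).toPrp :=
  (g.app (@Opens.mk Place (placeTopology J) U hU)).trans (W.res hV)

theorem pull_congr {g g' : W ⟶ placeSpace J} (h : g = g') (U : Set Place)
    (hU : IsOpen[placeTopology J] U) (V : Opens W.carrier) (hV : ∀ x ∈ V, g.base x ∈ U) :
    pull g U hU V hV = pull g' U hU V (h ▸ hV) := by
  subst h
  rfl

theorem res_pull (g : W ⟶ placeSpace J) (U : Set Place) (hU : IsOpen[placeTopology J] U)
    (V V' : Opens W.carrier) (hV : ∀ x ∈ V, g.base x ∈ U) (h : V' ≤ V) {n m : ℕ}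
    (s : (placeSections U).toCPrp.Hom n m) :
    (W.res h).map ((pull g U hU V hV).map s) =
      (pull g U hU V' fun x hx => hV x (h hx)).map s :=
  W.res_res _ _ _

theorem pull_restrict (g : W ⟶ placeSpace J) (U U' : Set Place)
    (hU : IsOpen[placeTopology J] U) (hU' : IsOpen[placeTopology J] U')
    (V : Opens W.carrier) (hV : ∀ x ∈ V, g.base x ∈ U) (h : U ⊆ U') {n m : ℕ}
    (s : (placeSections U').toCPrp.Hom n m) :
    (pull g U hU V hV).map ((placeRestrict h).map s) =
      (pull g U' hU' V fun x hx => h (hV x hx)).map s :=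
  (congrArg (W.res _).map (g.naturality (U := @Opens.mk Place (placeTopology J) U hU)
    (V := @Opens.mk Place (placeTopology J) U' hU') h s)).trans (W.res_res _ _ _)

theorem pull_self (g : W ⟶ placeSpace J) (U : Opens (placeSpace J).carrier) {n m : ℕ}
    (s : ((placeSpace J).O U).Hom n m) :
    (pull g U.1 U.2 (Opens.comap g.base U) fun _ h => h).map s = (g.app U).map s :=
  W.res_self _

end pull

section lift

variable {W : LPSpace} (f : ∀ j : PrimeSet, W ⟶ placeSpace j.toSet)
  (hf : ∀ {j j' : PrimeSet} (h : j.toSet ⊆ j'.toSet), f j' ≫ placeMap h = f j)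

/-- The set of primes `{2}`. -/
def PrimeSet.two : PrimeSet := ⟨{⟨2, Nat.prime_two⟩}, Finset.singleton_nonempty _⟩

-- The transition maps do not move places, so members of the family with comparable indices agree;
-- directedness supplies a common upper bound for the rest.
include hf in
theorem base_eq_base (j j' : PrimeSet) (x : W.carrier) :
    ((f j).base x : Place) = (f j').base x := by
  have key {j j' : PrimeSet} (h : j.toSet ⊆ j'.toSet) :
      ((f j).base x : Place) = (f j').base x := by
    rw [← hf h]; rfl
  obtain ⟨k, h, h'⟩ := compactSpecZ.pro.directed j j'
  exact (key (j := j) (j' := k) h).trans (key (j := j') (j' := k) h').symm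

-- Independence of the level: `placeMap` is the identity on sections, so pulling back along a
-- transition map changes nothing, and two levels are compared at a common upper bound.
include hf in
theorem pull_eq_pull (j j' : PrimeSet) (U : Set Place) (hU : IsOpen[placeTopology j.toSet] U)
    (hU' : IsOpen[placeTopology j'.toSet] U) (V : Opens W.carrier)
    (hV : ∀ x ∈ V, (f j).base x ∈ U) (hV' : ∀ x ∈ V, (f j').base x ∈ U) :
    pull (f j) U hU V hV = pull (f j') U hU' V hV' := by
  have key {j j' : PrimeSet} (h : j.toSet ⊆ j'.toSet) (hU : IsOpen[placeTopology j.toSet] U)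
      (hU' : IsOpen[placeTopology j'.toSet] U)
      (hV : ∀ x ∈ V, (f j).base x ∈ U) (hV' : ∀ x ∈ V, (f j').base x ∈ U) :
      pull (f j) U hU V hV = pull (f j') U hU' V hV' :=
    pull_congr (hf h).symm U hU V hV
  obtain ⟨k, h, h'⟩ := compactSpecZ.pro.directed j j'
  have hk : ∀ x ∈ V, (f k).base x ∈ U := fun x hx => by
    rw [base_eq_base f hf k j x]; exact hV x hx
  exact (key (j := j) (j' := k) h hU (placeTopology_anti h hU) hV hk).trans
    (key (j := j') (j' := k) h' hU' _ hV' hk).symm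

include hf in
theorem isOpen_preimage_base {U : Set Place} (hU : IsOpen[placeTopology Set.univ] U) :
    IsOpen ((f .two).base ⁻¹' U) := by
  obtain ⟨j, hj⟩ := exists_isOpen_placeTopology hU
  have h : (f .two).base ⁻¹' U = (f j).base ⁻¹' U :=
    Set.ext fun x => by
      change _ ∈ U ↔ _ ∈ U
      rw [base_eq_base f hf .two j x]
  rw [h]
  exact (f j).base.continuous.isOpen_preimage U hj

/-- The continuous map to the limit given by a compatible family of maps. -/
def limBase : C(W.carrier, (placeSpace Set.univ).carrier) :=
  ⟨fun x => (f .two).base x, ⟨fun _ hU => isOpen_preimage_base f hf hU⟩⟩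

theorem base_mem_of_limBase_mem (j : PrimeSet) {U : Set Place} {x : W.carrier}
    (hx : limBase f hf x ∈ U) : (f j).base x ∈ U := by
  rw [base_eq_base f hf j .two x]
  exact hx

/-- The map to the limit given by a compatible family of maps. -/
def limLift : W ⟶ placeSpace Set.univ where
  base := limBase f hf
  app U := pull (f (exists_isOpen_placeTopology U.2).choose) U.1
    (exists_isOpen_placeTopology U.2).choose_spec (Opens.comap (limBase f hf) U) fun _ hx =>
      base_mem_of_limBase_mem f hf _ hx
  naturality {U V} h n m s := by
    -- The levels chosen for `U` and `V` are unrelated. At a common upper bound both sets are open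
    -- and naturality of a single map applies.
    obtain ⟨k, h1, h2⟩ := compactSpecZ.pro.directed (exists_isOpen_placeTopology U.2).choose
      (exists_isOpen_placeTopology V.2).choose
    have hU : IsOpen[placeTopology (PrimeSet.toSet k)] U.1 :=
      placeTopology_anti h1 (exists_isOpen_placeTopology U.2).choose_spec
    have hV : IsOpen[placeTopology (PrimeSet.toSet k)] V.1 :=
      placeTopology_anti h2 (exists_isOpen_placeTopology V.2).choose_spec
    rw [pull_eq_pull f hf _ k U.1 _ hU _ _ fun _ hx => base_mem_of_limBase_mem f hf k hx,
      pull_eq_pull f hf _ k V.1 _ hV _ _ fun _ hx => base_mem_of_limBase_mem f hf k hx]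
    exact (pull_restrict (f k) U.1 V.1 hU hV _ _ h s).trans (res_pull (f k) V.1 hV
      (Opens.comap (limBase f hf) V) (Opens.comap (limBase f hf) U)
      (fun _ hx => base_mem_of_limBase_mem f hf k hx) (Opens.comap_mono (limBase f hf) h) s).symm
  isLocal x U hx s hs h := by
    have hx' := base_mem_of_limBase_mem f hf (exists_isOpen_placeTopology U.2).choose hx
    refine (f (exists_isOpen_placeTopology U.2).choose).isLocal x
      (@Opens.mk Place (placeTopology _) U.1 (exists_isOpen_placeTopology U.2).choose_spec) hx' s
      (fun h' => hs ((placePSpace_unitAt_iff _ _ U.1 U.2 hx s).2 ?_)) h.of_res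
    have key (v w : Place) (hv : v ∈ U.1) (hw : w ∈ U.1) (e : v = w)
        (H : ¬ v.nm (scal (placeValue ⟨v, hv⟩) s) < 1) :
        ¬ w.nm (scal (placeValue ⟨w, hw⟩) s) < 1 := by
      subst e; exact H
    exact key _ _ hx' hx (base_eq_base f hf _ _ x)
      ((placePSpace_unitAt_iff _ _ U.1 (exists_isOpen_placeTopology U.2).choose_spec hx' s).1 h')

theorem limLift_app (j : PrimeSet) (U : Set Place) (hU : IsOpen[placeTopology Set.univ] U)
    (hU' : IsOpen[placeTopology j.toSet] U) {n m : ℕ} (s : (placeSections U).toCPrp.Hom n m) :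
    ((limLift f hf).app (@Opens.mk Place (placeTopology Set.univ) U hU)).map s =
      (pull (f j) U hU' (Opens.comap (limBase f hf)
        (@Opens.mk Place (placeTopology Set.univ) U hU)) fun _ hx =>
        base_mem_of_limBase_mem f hf j hx).map s := by
  rw [← pull_eq_pull f hf (exists_isOpen_placeTopology hU).choose j U
    (exists_isOpen_placeTopology hU).choose_spec hU' _
    (fun _ hx => base_mem_of_limBase_mem f hf _ hx)]
  rfl

theorem limLift_comp (j : PrimeSet) :
    limLift f hf ≫ placeMap (Set.subset_univ j.toSet) = f j :=
  LPSpace.hom_ext _ _ (ContinuousMap.ext fun x => base_eq_base f hf _ _ x) fun U n m s => by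
    have h := limLift_app f hf j U.1 (placeTopology_anti (Set.subset_univ _) U.2) U.2 s
    refine Eq.trans ?_ h.symm
    rw [← pull_self (f j) U s]
    exact res_pull _ _ _ _ _ _ _ s

theorem limLift_unique (g : W ⟶ placeSpace Set.univ)
    (hg : ∀ j : PrimeSet, g ≫ placeMap (Set.subset_univ j.toSet) = f j) : g = limLift f hf := by
  have hb (j : PrimeSet) (x : W.carrier) : (g.base x : Place) = (f j).base x := by
    rw [← hg j]; rfl
  refine LPSpace.hom_ext _ _ (ContinuousMap.ext fun x => hb .two x) fun U n m s => ?_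
  obtain ⟨j, hj⟩ := exists_isOpen_placeTopology U.2
  have h := limLift_app f hf j U.1 U.2 hj s
  rw [← pull_congr (hg j) U.1 hj _ fun x hx => by
    change (g.base x : Place) ∈ U.1
    rw [hb j x]; exact base_mem_of_limBase_mem f hf j hx] at h
  refine (congrArg (W.res _).map h).trans ?_
  rw [← pull_self g U s]
  exact res_pull _ _ _ _ _ _ _ s

end lift

/-- The limit of the system of spaces of places. -/
def limCone : Limits.Cone (compactSpecZ.pro.sys ⋙ isPropScheme.ι) where
  pt := placeSpace Set.univ
  π :=
    { app := fun j => placeMap (Set.subset_univ (PrimeSet.toSet j.unop))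
      naturality := fun _ _ _ => rfl }

theorem cone_w (s : Limits.Cone (compactSpecZ.pro.sys ⋙ isPropScheme.ι)) {j j' : PrimeSet}
    (h : j.toSet ⊆ j'.toSet) : s.π.app (.op j') ≫ placeMap h = s.π.app (.op j) :=
  s.w (homOfLE (show j ≤ j' from h)).op

/-- The universal property of the limit. -/
def isLimitLimCone : Limits.IsLimit limCone where
  lift s := limLift (fun j => s.π.app (.op j)) (cone_w s)
  fac s j := limLift_comp (fun j => s.π.app (.op j)) (cone_w s) j.unop
  uniq s g hg := limLift_unique (fun j => s.π.app (.op j)) (cone_w s) g fun j => hg (.op j)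

/-! ### The topology of the spaces of places -/

theorem isClosed_placeTopology_iff {J : Set Nat.Primes} {C : Set Place} :
    IsClosed[placeTopology J] C ↔ (C ≠ Set.univ → Place.generic ∉ C ∧
      {p | Place.prime p ∈ C}.Finite ∧ (Place.real ∉ C → ∀ p ∉ J, Place.prime p ∉ C)) := by
  rw [← @isOpen_compl_iff _ _ (placeTopology J)]
  change (Cᶜ.Nonempty → Place.generic ∉ C ∧ {p | ¬ ¬ Place.prime p ∈ C}.Finite ∧ _) ↔ _
  simp only [not_not, Set.nonempty_compl]
  rfl

/-- A proper closed set omitting the real place can contain only primes of `J`, because every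
neighbourhood of the real place contains the others. At a finite level the remaining primes are
therefore not closed. -/
theorem isClosed_singleton_place_iff (J : Set Nat.Primes) (v : Place) :
    IsClosed[placeTopology J] {v} ↔ v = .real ∨ ∃ p ∈ J, v = .prime p := by
  rw [isClosed_placeTopology_iff]
  have hne : ({v} : Set Place) ≠ Set.univ := fun h => by
    have h1 : Place.generic = v := h.symm.subset (Set.mem_univ _)
    have h2 : Place.real = v := h.symm.subset (Set.mem_univ _)
    cases h1.trans h2.symm
  have hfin : {p | Place.prime p = v}.Finite :=
    (Set.finite_singleton v).preimage fun _ _ _ _ h => by cases h; rfl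
  simp only [ne_eq, hne, not_false_eq_true, hfin, true_and, forall_true_left,
    Set.mem_singleton_iff]
  cases v with
  | generic => simp
  | real => simp
  | prime p => simp only [reduceCtorEq, not_false_eq_true, Place.prime.injEq, true_and,
      forall_true_left, false_or, exists_eq_right']; grind

theorem isClosed_singleton_place_univ_iff (v : Place) :
    IsClosed[placeTopology Set.univ] {v} ↔ v ≠ .generic := by
  rw [isClosed_singleton_place_iff]
  cases v <;> simp

/-- When `J` consists of all primes, the only restrictions on a proper closed set are to omit the
generic point and to contain finitely many primes; both pass to subsets. -/
theorem IsClosed.of_subset_place {C D : Set Place} (hC : IsClosed[placeTopology Set.univ] C)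
    (hC' : C ≠ Set.univ) (h : D ⊆ C) : IsClosed[placeTopology Set.univ] D := by
  obtain ⟨h1, h2, -⟩ := isClosed_placeTopology_iff.1 hC hC'
  exact isClosed_placeTopology_iff.2 fun _ => ⟨fun hg => h1 (h hg), h2.subset fun _ hp => h hp,
    fun _ p hp => absurd (Set.mem_univ p) hp⟩

theorem closure_singleton_place_iff (v : Place) :
    @closure _ (placeTopology Set.univ) {v} = Set.univ ↔ v = .generic := by
  let _ := placeTopology Set.univ
  constructor
  · intro h
    by_contra hv
    rw [((isClosed_singleton_place_univ_iff v).2 hv).closure_eq] at h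
    exact hv (h.symm.subset (Set.mem_univ Place.generic)).symm
  · rintro rfl
    by_contra h
    exact (isClosed_placeTopology_iff.1 isClosed_closure h).1 (subset_closure rfl)

/-- Proper irreducible closed sets are single points, since any proper closed set splits into closed
pieces. The longest chains thus consist of a closed point inside the closure of the generic point.
-/
theorem topologicalKrullDim_place :
    @topologicalKrullDim Place (placeTopology Set.univ) = 1 := by
  let _ := placeTopology Set.univ
  have hsub (C : IrreducibleCloseds Place) (hC : (C : Set Place) ≠ Set.univ) :
      (C : Set Place).Subsingleton := by
    have hcl : IsClosed (C : Set Place) := C.isClosed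
    intro x hx y hy
    -- The point `x` and its complement in `C` are both closed, so irreducibility forces `C` into
    -- one of them.
    have := isPreirreducible_iff_isClosed_union_isClosed.1 C.isIrreducible.isPreirreducible {x}
      ((C : Set Place) \ {x}) (hcl.of_subset_place hC (by simpa using hx))
      (hcl.of_subset_place hC Set.sdiff_subset) (by simp)
    rcases this with h | h
    · exact (h hy).symm
    · exact absurd rfl (h hx).2
  refine le_antisymm (Order.krullDim_le_one_iff.2 fun C => ?_) (Order.one_le_krullDim_iff.2 ?_)
  · by_cases hC : (C : Set Place) = Set.univ
    · exact Or.inr fun D _ x _ => hC.symm.subset (Set.mem_univ x)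
    · refine Or.inl fun D hD x hx => ?_
      obtain ⟨y, hy⟩ := D.isIrreducible.nonempty
      rw [hsub C hC hx (hD hy)]
      exact hy
  · have hr : IsClosed ({Place.real} : Set Place) :=
      (isClosed_singleton_place_univ_iff _).2 (by rintro ⟨⟩)
    have hg : closure ({Place.generic} : Set Place) = Set.univ :=
      (closure_singleton_place_iff _).2 rfl
    refine ⟨⟨{Place.real}, isIrreducible_singleton, hr⟩,
      ⟨Set.univ, hg ▸ isIrreducible_singleton.closure, isClosed_univ⟩,
      lt_of_le_not_ge (fun x _ => Set.mem_univ x) fun h => ?_⟩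
    have : Place.generic = Place.real := h (Set.mem_univ _)
    cases this

/-! ### The points -/

theorem isPlace_compactSpecZ (j : PrimeSet) (v : Place) : compactSpecZ.IsPlace j v v := by
  cases v with
  | generic =>
    refine ⟨intModel.placePrime intModel.generic_mem, Set.ext fun a => ?_,
      intModel.place_placePrime _⟩
    change Place.generic.nm ((a : Matrix (Fin 1) (Fin 1) ℤ) 0 0 : ℚ) < 1 ↔
      (a : Matrix (Fin 1) (Fin 1) ℤ) 0 0 = 0
    by_cases h : (a : Matrix (Fin 1) (Fin 1) ℤ) 0 0 = 0 <;> simp [Place.nm, h]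
  | prime p =>
    exact ⟨intModel.placePrime (prime_mem_finitePlaces p), Set.ext fun a =>
      padicNorm.int_lt_one_iff _, intModel.place_placePrime _⟩
  | real =>
    exact ⟨(invRealModel j).placePrime (real_mem_placesOff _), rfl,
      (invRealModel j).place_placePrime _⟩

/-! ### Global sections -/

theorem forall_isIntegralAt_iff {n m : ℕ} (a : Matrix (Fin n) (Fin m) ℚ) :
    (∀ v, IsIntegralAt v a) ↔ (∃ b : Matrix (Fin n) (Fin m) ℤ, b.map Int.cast = a) ∧
      a.map Rat.cast ∈ realInt.carrier n m := by
  constructor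
  · intro h
    obtain ⟨b, hb⟩ := intModel.exists_mat a fun v _ => h v
    exact ⟨⟨b, hb⟩, h .real⟩
  · rintro ⟨⟨b, rfl⟩, h⟩ v
    cases v with
    | real => exact h
    | generic => trivial
    | prime p => exact intModel.mem b _ (prime_mem_finitePlaces p)

theorem eq_zero_or_eq_one_or_eq_neg_one_of_sq_le_one {a : ℤ} (h : a ^ 2 ≤ 1) :
    a = 0 ∨ a = 1 ∨ a = -1 := by
  have h1 : a ≤ 1 := by nlinarith
  have h2 : -1 ≤ a := by nlinarith
  omega

theorem unique_of_sum_sq_le_one {ι : Type} [Fintype ι] {a : ι → ℤ} (h : ∑ i, a i ^ 2 ≤ 1) {i i' : ι}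
    (hi : a i ≠ 0) (hi' : a i' ≠ 0) : i = i' := by
  classical
  by_contra hne
  have h1 : ∑ k ∈ {i, i'}, a k ^ 2 ≤ ∑ k, a k ^ 2 :=
    Finset.sum_le_sum_of_subset_of_nonneg (Finset.subset_univ _) fun _ _ _ => sq_nonneg _
  rw [Finset.sum_pair hne] at h1
  have h2 : 0 < a i ^ 2 := by positivity
  have h3 : 0 < a i' ^ 2 := by positivity
  omega

theorem sum_sq_le_one {ι : Type} [Fintype ι] {a : ι → ℤ} (h : ∀ i, a i = 0 ∨ a i = 1 ∨ a i = -1)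
    (h' : ∀ i i', a i ≠ 0 → a i' ≠ 0 → i = i') : ∑ i, a i ^ 2 ≤ 1 := by
  by_cases h0 : ∃ i, a i ≠ 0
  · obtain ⟨i, hi⟩ := h0
    rw [Finset.sum_eq_single i (fun k _ hk => by
      rw [not_not.1 fun h0 => hk (h' k i h0 hi), zero_pow two_ne_zero]) (by simp)]
    rcases h i with h | h | h <;> simp [h]
  · push Not at h0
    simp [h0]

/-- A sum of integer squares that is at most one has at most one nonzero term, and that term is one.
So it is enough to bound all row and column sums of squares. -/
theorem map_intCast_isIntegralAt_real_iff {n m : ℕ} (b : Matrix (Fin n) (Fin m) ℤ) :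
    IsIntegralAt .real (b.map (Int.cast : ℤ → ℚ)) ↔ b ∈ signedF n m := by
  rw [isIntegralAt_real_iff]
  simp only [Matrix.map_apply, Rat.cast_intCast]
  constructor
  · intro h
    have hcol (j : Fin m) : ∑ i, b i j ^ 2 ≤ 1 := by
      have := h (Pi.single j 1)
      simp only [Pi.single_apply, mul_ite, mul_one, mul_zero, Finset.sum_ite_eq',
        Finset.mem_univ, if_true, ite_pow, one_pow, ne_eq, OfNat.ofNat_ne_zero,
        not_false_eq_true, zero_pow] at this
      exact_mod_cast this
    have hrow (i : Fin n) : ∑ j, b i j ^ 2 ≤ 1 := by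
      -- Applied to its own row `i`, the matrix has coordinate `i` equal to the sum `S` of squares
      -- of that row. Contraction gives `S ^ 2 ≤ S`.
      have h1 := h fun j => (b i j : ℝ)
      have h2 := (Finset.single_le_sum (f := fun i' => (∑ j, (b i' j : ℝ) * b i j) ^ 2)
        (fun _ _ => sq_nonneg _) (Finset.mem_univ i)).trans h1
      have h3 : (∑ j, b i j ^ 2) ^ 2 ≤ ∑ j, b i j ^ 2 := by
        simp only [← sq] at h2
        exact_mod_cast h2
      nlinarith
    refine ⟨fun i j => eq_zero_or_eq_one_or_eq_neg_one_of_sq_le_one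
      ((Finset.single_le_sum (f := fun i => b i j ^ 2) (fun _ _ => sq_nonneg _)
        (Finset.mem_univ i)).trans (hcol j)),
      fun i _ _ => unique_of_sum_sq_le_one (hrow i), fun _ _ j => unique_of_sum_sq_le_one (hcol j)⟩
  · rintro ⟨h, hr, hc⟩ z
    have hcol (j : Fin m) : ∑ i, (b i j : ℝ) ^ 2 ≤ 1 := by
      exact_mod_cast sum_sq_le_one (fun i => h i j) fun i i' => hc i i' j
    -- At most one term of the row is nonzero, so there are no cross terms and the square of the sum
    -- is the sum of the squares. Summation over rows then reduces to the column bound.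
    have hrow (i : Fin n) : (∑ j, (b i j : ℝ) * z j) ^ 2 = ∑ j, (b i j : ℝ) ^ 2 * z j ^ 2 := by
      by_cases h0 : ∃ j, b i j ≠ 0
      · obtain ⟨j, hj⟩ := h0
        have hk (k : Fin m) (hkj : k ≠ j) : b i k = 0 :=
          not_not.1 fun h0 => hkj (hr i k j h0 hj)
        rw [Finset.sum_eq_single j (fun k _ hkj => by simp [hk k hkj]) (by simp),
          Finset.sum_eq_single j (fun k _ hkj => by simp [hk k hkj]) (by simp), mul_pow]
      · push Not at h0
        simp [h0]
    simp only [hrow]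
    rw [Finset.sum_comm]
    refine Finset.sum_le_sum fun j _ => ?_
    rw [← Finset.sum_mul]
    exact mul_le_of_le_one_left (sq_nonneg _) (hcol j)

theorem map_intCast_mem_realInt_eq_image_signedF (n m : ℕ) :
    {a : Matrix (Fin n) (Fin m) ℚ | (∃ b : Matrix (Fin n) (Fin m) ℤ, b.map Int.cast = a) ∧
      a.map Rat.cast ∈ realInt.carrier n m} =
      (fun b : Matrix (Fin n) (Fin m) ℤ => b.map Int.cast) '' signedF n m := by
  ext a
  constructor
  · rintro ⟨⟨b, rfl⟩, h⟩
    exact ⟨b, (map_intCast_isIntegralAt_real_iff b).1 h, rfl⟩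
  · rintro ⟨b, hb, rfl⟩
    exact ⟨⟨b, rfl⟩, (map_intCast_isIntegralAt_real_iff b).2 hb⟩

theorem range_val_placeModel (U : Opens (placeSpace Set.univ).carrier)
    (hU : (U : Set (placeSpace Set.univ).carrier).Nonempty) (n m : ℕ) :
    Set.range (((placeModel Set.univ).val U hU).map :
      ((placeSpace Set.univ).O U).Hom n m → (matPrp ℚ).Hom n m) =
      {a : Matrix (Fin n) (Fin m) ℚ | ∀ v : Place, v ∈ U.1 → IsIntegralAt v a} := by
  ext a
  constructor
  · rintro ⟨s, rfl⟩ v hv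
    exact ((placeModel Set.univ).val_mem U hU s v hv).1
  · exact fun ha => (placeModel Set.univ).exists_val U hU a fun v hv =>
      ⟨ha v hv, fun _ p hp => absurd (Set.mem_univ p) hp⟩

end PropGeom

end

/-! ### The compactified spectrum of the integers. -/

theorem mainTheorem6 :
    ∃ X : CompactSpecZ,
      (∀ Y : CompactSpecZ, Nonempty (X.pro ≅ Y.pro)) ∧
      ∃ (c : Limits.Cone (X.pro.sys ⋙ isPropScheme.ι)) (_ : Limits.IsLimit c)
        (e : Place ≃ c.pt.carrier),
        -- the points of the limit, and of the members of the system
        (∀ (j : PrimeSet) (v : Place), X.IsPlace j ((c.π.app (.op j)).base (e v)) v) ∧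
        (∀ j : PrimeSet, Function.Bijective (c.π.app (.op j)).base) ∧
        (∀ (j : PrimeSet) (v : Place), IsClosed {(c.π.app (.op j)).base (e v)} ↔
          v = .real ∨ ∃ p ∈ j.1, v = .prime p) ∧
        topologicalKrullDim c.pt.carrier = 1 ∧
        (∀ v : Place, closure {e v} = Set.univ ↔ v = .generic) ∧
        (∀ v : Place, IsClosed {e v} ↔ v ≠ .generic) ∧
        -- the structure sheaf
        ∃ Φ : ∀ U : Opens c.pt.carrier, (U : Set c.pt.carrier).Nonempty →
            PrpHom (c.pt.O U).toPrp (matPrp ℚ).toPrp,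
          (∀ (U V : Opens c.pt.carrier) (hU : (U : Set c.pt.carrier).Nonempty)
            (hV : (V : Set c.pt.carrier).Nonempty) (h : U ≤ V) (n m : ℕ)
            (s : (c.pt.O V).Hom n m), (Φ U hU).map ((c.pt.res h).map s) = (Φ V hV).map s) ∧
          (∀ (U : Opens c.pt.carrier) (hU : (U : Set c.pt.carrier).Nonempty) (n m : ℕ),
            Function.Injective ((Φ U hU).map : (c.pt.O U).Hom n m → (matPrp ℚ).Hom n m) ∧
            Set.range ((Φ U hU).map : (c.pt.O U).Hom n m → (matPrp ℚ).Hom n m) =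
              {a : Matrix (Fin n) (Fin m) ℚ | ∀ v : Place, e v ∈ U → IsIntegralAt v a}) ∧
          -- the global sections
          ∀ (h : ((⊤ : Opens c.pt.carrier) : Set c.pt.carrier).Nonempty) (n m : ℕ),
            Set.range ((Φ ⊤ h).map : (c.pt.O ⊤).Hom n m → (matPrp ℚ).Hom n m) =
              {a : Matrix (Fin n) (Fin m) ℚ |
                (∃ b : Matrix (Fin n) (Fin m) ℤ, b.map Int.cast = a) ∧
                  a.map Rat.cast ∈ realInt.carrier n m} ∧
            {a : Matrix (Fin n) (Fin m) ℚ |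
                (∃ b : Matrix (Fin n) (Fin m) ℤ, b.map Int.cast = a) ∧
                  a.map Rat.cast ∈ realInt.carrier n m} =
              (fun b : Matrix (Fin n) (Fin m) ℤ => b.map Int.cast) '' signedF n m := by
  -- The points of the model of the limit are by definition the places, and the projections are the
  -- identity on them. Hence the parametrization of points is the identity.
  refine ⟨compactSpecZ, fun Y => ⟨compactSpecZ.proIso Y⟩, limCone, isLimitLimCone, Equiv.refl Place,
    isPlace_compactSpecZ, fun j => Function.bijective_id,
    fun j v => isClosed_singleton_place_iff j.toSet v, topologicalKrullDim_place,
    closure_singleton_place_iff, isClosed_singleton_place_univ_iff,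
    (placeModel Set.univ).val, fun U V hU hV h n m s => (placeModel Set.univ).val_res h hU hV s,
    fun U hU n m => ⟨(placeModel Set.univ).val_inj U hU n m, range_val_placeModel U hU n m⟩,
    fun h n m => ⟨(range_val_placeModel ⊤ h n m).trans (Set.ext fun a => ?_),
      map_intCast_mem_realInt_eq_image_signedF n m⟩⟩
  exact Iff.trans ⟨fun H v => H v trivial, fun H v _ => H v⟩ (forall_isIntegralAt_iff a)
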